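/- Let $n,N\ge 1$. Balls in $\mathbb R^n$ are open; for a ball $B$ of centre $x_0$ and radius $r$, $2B$ is the ball of centre $x_0$ and radius $2r$. Matrices $Q\in\mathbb R^{N\times n}$ carry the Euclidean norm $|Q|$, and $\langle g\rangle_B=\frac{1}{|B|}\int_B g\,dx$ denotes the mean value. **Growth function.** Let $\phi:[0,\infty)\to[0,\infty)$ be an N-function that is $C^1$ on $[0,\infty)$ and $C^2$ on $(0,\infty)$ (that is, $\phi(0)=\phi'(0)=0$, $\phi'$ is non-decreasing, $\phi'(t)>0$ for $t>0$, $\phi'(t)\to\infty$ as $t\to\infty$), with $c_0\,t\phi''(t)\le\phi'(t)\le c_1\,t\phi''(t)$ for all $t>0$, where $c_0,c_1>0$ (the characteristics of $\phi$). Put $\phi_a(t)=\int_0^t\phi'(a+s)\frac{s}{a+s}\,ds$ for $a,t\ge0$, and $V(Q)=\sqrt{\phi'(|Q|)\,|Q|}\;\frac{Q}{|Q|}$, $V(0)=0$. **Integrand.** Let $\Omega\subset\mathbb R^n$ be open, and let $f\in C^1(\mathbb R^{N\times n})\cap C^2(\mathbb R^{N\times n}\setminus\{0\})$ satisfy, with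 constants $K,L\in\mathbb R$, $k>0$ and $\beta>0$: 1. $|f(Q)|\le K\phi(|Q|)$ for all $Q$; 2. (strict $W^{1,\phi}$-quasiconvexity) $\int_B \big(f(Q+\nabla w)-f(Q)\big)\,dx\ge k\int_B\phi_{|Q|}(|\nabla w|)\,dx$ for all balls $B\subset\Omega$, all $Q$ and all $w\in C^1_0(B;\mathbb R^N)$; 3. $|D^2f(Q)|\le L\,\phi''(|Q|)$ for all $Q\ne0$; 4. $|D^2f(Q)-D^2f(Q+P)|\le L\,\phi''(|Q|)\,|Q|^{-\beta}|P|^{\beta}$ for all $Q\neq 0$ and $P$ with $|P|\le\frac12|Q|$, where $|D^2f|$ is the norm of $D^2f$ as a bilinear form. **Local minimizers.** A function $u\in W^{1,\phi}_{\mathrm{loc}}(\Omega;\mathbb R^N)$ is a local minimizer of $\mathcal F(u)=\int_\Omega f(\nabla u)\,dx$ if $\int_{\operatorname{supp} w}f(\nabla u)\,dx\le\int_{\operatorname{supp} w}f(\nabla u+\nabla w)\,dx$ for every $w\in W^{1,\phi}(\Omega;\mathbb R^N)$ with compact support in $\Omega$. **Lemma.** For every $\varepsilon>0$ there is $\delta>0$,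 depending only on $\varepsilon,n,N,c_0,c_1,k,K,L,\beta$, such that the following holds for all $\phi,\Omega,f$ as above, every local minimizer $u$ of $\mathcal F$ and every ball $B$ with $\overline{2B}\subset\Omega$: if $$\frac{1}{|2B|}\int_{2B}\big|V(\nabla u)-\langle V(\nabla u)\rangle_{2B}\big|^2dx\le\delta\frac{1}{|2B|}\int_{2B}|V(\nabla u)|^2dx ,$$ then, with $Q:=\langle\nabla u\rangle_{2B}$, $$\Big|\frac{1}{|B|}\int_B D^2f(Q)(\nabla u-Q,\nabla\xi)\,dx\Big|\le\varepsilon\,\phi''(|Q|)\,\frac{1}{|2B|}\int_{2B}|\nabla u-Q|\,dx\;\|\nabla\xi\|_{L^\infty(B)}\qquad\text{for all }\xi\in C_0^\infty(B;\mathbb R^N).$$ In particular, $u$ is almost $\mathcal A$-harmonic on $B$ with $\mathcal A=D^2f(Q)/\phi''(|Q|)$, in the sense that $$\Big|\frac{1}{|B|}\int_B\mathcal A(\nabla u,\nabla\xi)\,dx\Big|\le\varepsilon\,\frac{1}{|2B|}\int_{2B}|\nabla u|\,dx\;\|\nabla\xi\|_{L^\infty(B)}\qquad\text{for all }\xi\in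 C_0^\infty(B;\mathbb R^N).$$ (If $Q=0$, then $\nabla u=0$ a.e. on $2B$ and all integrals in the two conclusions are read as $0$.) -/

import Mathlib

open MeasureTheory Set Filter Topology
open scoped ContDiff ENNReal

namespace OrliczGrowth

/-- Points of `ℝⁿ`, with the Euclidean norm. -/
abbrev Vec (n : ℕ) : Type := EuclideanSpace ℝ (Fin n)

/-- Real `N × n` matrices, with the Euclidean norm. The entry in row `i` and column `j` of `Q` is
`Q (i, j)`. -/
abbrev Mat (N n : ℕ) : Type := EuclideanSpace ℝ (Fin N × Fin n)

/-! ### N-functions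

An N-function is a function on `[0, ∞)`; it is represented by a function `ℝ → ℝ` of which only the
values on `[0, ∞)` are ever used. -/

/-- The derivative `φ'` on `[0, ∞)` (one-sided at `0`). -/
noncomputable def dphi (φ : ℝ → ℝ) (t : ℝ) : ℝ := derivWithin φ (Ici 0) t

/-- The second derivative `φ''`, meaningful on `(0, ∞)`. -/
noncomputable def ddphi (φ : ℝ → ℝ) (t : ℝ) : ℝ := deriv (dphi φ) t

/-- `φ` is an N-function, `C¹` on `[0, ∞)` and `C²` on `(0, ∞)`, and `φ'(t) ∼ t φ''(t)` uniformly in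
`t > 0` with constants `c₀`, `c₁` (the characteristics of `φ`). -/
structure IsRegularNFunction (φ : ℝ → ℝ) (c₀ c₁ : ℝ) : Prop where
  map_zero : φ 0 = 0
  contDiffOn_one : ContDiffOn ℝ 1 φ (Ici 0)
  contDiffOn_two : ContDiffOn ℝ 2 φ (Ioi 0)
  deriv_zero : dphi φ 0 = 0
  deriv_pos : ∀ t, 0 < t → 0 < dphi φ t
  deriv_mono : MonotoneOn (dphi φ) (Ici 0)
  deriv_tendsto : Tendsto (dphi φ) atTop atTop
  lower : ∀ t, 0 < t → c₀ * (t * ddphi φ t) ≤ dphi φ t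
  upper : ∀ t, 0 < t → dphi φ t ≤ c₁ * (t * ddphi φ t)

/-- The shifted N-function `φ_a(t) = ∫₀ᵗ φ'(a + s) s / (a + s) ds`. -/
noncomputable def shifted (φ : ℝ → ℝ) (a t : ℝ) : ℝ :=
  ∫ s in (0 : ℝ)..t, dphi φ (a + s) * (s / (a + s))

/-- `V(Q) = ψ'(|Q|) Q / |Q|` with `ψ'(t) = √(φ'(t) t)`, and `V(0) = 0`. -/
noncomputable def V {N n : ℕ} (φ : ℝ → ℝ) (Q : Mat N n) : Mat N n :=
  (Real.sqrt (dphi φ ‖Q‖ * ‖Q‖) / ‖Q‖) • Q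

/-! ### Gradients and Sobolev–Orlicz spaces -/

/-- The classical gradient of `w : ℝⁿ → ℝᴺ`, with entries `∂ⱼ wᵢ`. -/
noncomputable def grad {N n : ℕ} (w : Vec n → Vec N) (x : Vec n) : Mat N n :=
  WithLp.toLp 2 fun p => fderiv ℝ w x (EuclideanSpace.single p.2 1) p.1

/-- `G` is the weak gradient of `u` on the open set `Ω`: both are locally integrable on `Ω`, and
`∫ uᵢ ∂ⱼη = - ∫ Gᵢⱼ η` for all `η ∈ C₀^∞(Ω)`. -/
structure HasWeakGradient {N n : ℕ} (Ω : Set (Vec n)) (u : Vec n → Vec N) (G : Vec n → Mat N n) :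
    Prop where
  locInt : LocallyIntegrableOn u Ω
  locInt_grad : LocallyIntegrableOn G Ω
  weak : ∀ η : Vec n → ℝ, ContDiff ℝ ∞ η → HasCompactSupport η → tsupport η ⊆ Ω →
    ∀ (i : Fin N) (j : Fin n),
      ∫ x in Ω, u x i * fderiv ℝ η x (EuclideanSpace.single j 1) = - ∫ x in Ω, G x (i, j) * η x

/-- `g ∈ L^φ(S)`: `g` is measurable and `∫_S φ(|g|) < ∞`. -/
def MemOrlicz {n : ℕ} {F : Type*} [NormedAddCommGroup F] (φ : ℝ → ℝ) (S : Set (Vec n))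
    (g : Vec n → F) : Prop :=
  AEStronglyMeasurable g (volume.restrict S) ∧ IntegrableOn (fun x => φ ‖g x‖) S

/-- `w ∈ W^{1,φ}(Ω)`, with weak gradient `H`. -/
structure MemSobolev {N n : ℕ} (φ : ℝ → ℝ) (Ω : Set (Vec n)) (w : Vec n → Vec N)
    (H : Vec n → Mat N n) : Prop where
  weakGrad : HasWeakGradient Ω w H
  mem : MemOrlicz φ Ω w
  mem_grad : MemOrlicz φ Ω H

/-- `u ∈ W^{1,φ}_loc(Ω)`, with weak gradient `G`. -/
structure MemSobolevLoc {N n : ℕ} (φ : ℝ → ℝ) (Ω : Set (Vec n)) (u : Vec n → Vec N)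
    (G : Vec n → Mat N n) : Prop where
  weakGrad : HasWeakGradient Ω u G
  mem : ∀ S : Set (Vec n), IsCompact S → S ⊆ Ω → MemOrlicz φ S u
  mem_grad : ∀ S : Set (Vec n), IsCompact S → S ⊆ Ω → MemOrlicz φ S G

/-! ### The integrand and its local minimizers -/

/-- `f` is strictly `W^{1,φ}`-quasiconvex on `Ω` with constant `k`:
`∫_B f(Q + ∇w) - f(Q) ≥ k ∫_B φ_{|Q|}(|∇w|)` for all balls `B ⊆ Ω`, all matrices `Q` and all
`w ∈ C¹₀(B)`. -/
def StrictlyQuasiconvex {N n : ℕ} (Ω : Set (Vec n)) (φ : ℝ → ℝ) (f : Mat N n → ℝ) (k : ℝ) : Prop :=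
  ∀ (x₀ : Vec n) (r : ℝ), 0 < r → Metric.ball x₀ r ⊆ Ω → ∀ (Q : Mat N n) (w : Vec n → Vec N),
    ContDiff ℝ 1 w → HasCompactSupport w → tsupport w ⊆ Metric.ball x₀ r →
      k * ∫ x in Metric.ball x₀ r, shifted φ ‖Q‖ ‖grad w x‖ ≤
        ∫ x in Metric.ball x₀ r, (f (Q + grad w x) - f Q)

/-- The second derivative `D²f(Q)`, as a bilinear form on matrices. -/
noncomputable def D2 {N n : ℕ} (f : Mat N n → ℝ) (Q : Mat N n) : Mat N n →L[ℝ] Mat N n →L[ℝ] ℝ :=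
  fderiv ℝ (fderiv ℝ f) Q

/-- The structure conditions on the integrand `f`: regularity, growth with constant `K`, strict
quasiconvexity with constant `k`, and the bound and the Hölder condition (with exponent `β`) for
`D²f` away from `0`, with constant `L`. -/
structure IsIntegrand {N n : ℕ} (Ω : Set (Vec n)) (φ : ℝ → ℝ) (f : Mat N n → ℝ) (k K L β : ℝ) :
    Prop where
  contDiff_one : ContDiff ℝ 1 f
  contDiffOn_two : ContDiffOn ℝ 2 f {0}ᶜ
  growth : ∀ Q, |f Q| ≤ K * φ ‖Q‖
  quasiconvex : StrictlyQuasiconvex Ω φ f k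
  bound : ∀ Q, Q ≠ 0 → ‖D2 f Q‖ ≤ L * ddphi φ ‖Q‖
  holder : ∀ P Q : Mat N n, Q ≠ 0 → ‖P‖ ≤ 1 / 2 * ‖Q‖ →
    ‖D2 f Q - D2 f (Q + P)‖ ≤ L * ddphi φ ‖Q‖ * ‖Q‖ ^ (-β) * ‖P‖ ^ β

/-- `u ∈ W^{1,φ}_loc(Ω)`, with weak gradient `G`, is a local minimizer of `∫ f(∇u)`: the integral
does not decrease when one adds to `u` a function `w ∈ W^{1,φ}(Ω)` with compact support in `Ω`. -/
structure IsLocalMinimizer {N n : ℕ} (φ : ℝ → ℝ) (f : Mat N n → ℝ) (Ω : Set (Vec n))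
    (u : Vec n → Vec N) (G : Vec n → Mat N n) : Prop where
  memSobolevLoc : MemSobolevLoc φ Ω u G
  le : ∀ (w : Vec n → Vec N) (H : Vec n → Mat N n), MemSobolev φ Ω w H →
    HasCompactSupport w → tsupport w ⊆ Ω →
      ∫ x in tsupport w, f (G x) ≤ ∫ x in tsupport w, f (G x + H x)

/-! ### Almost harmonic functions -/

/-- `ξ ∈ C₀^∞(B; ℝᴺ)`. -/
def IsTest {N n : ℕ} (B : Set (Vec n)) (ξ : Vec n → Vec N) : Prop :=
  ContDiff ℝ ∞ ξ ∧ HasCompactSupport ξ ∧ tsupport ξ ⊆ B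

/-- `‖∇ξ‖_{L^∞(B)}`. -/
noncomputable def supGrad {N n : ℕ} (B : Set (Vec n)) (ξ : Vec n → Vec N) : ℝ :=
  (eLpNorm (grad ξ) ∞ (volume.restrict B)).toReal

/-- For a constant bilinear form `A` on matrices, the Sobolev function `u` on `B'`, with weak
gradient `G`, is almost `A`-harmonic on `B ⊆ B'` with constant `ε`:
`|⨍_B A(∇u, ∇ξ)| ≤ ε ⨍_{B'} |∇u| ‖∇ξ‖_{L^∞(B)}` for all `ξ ∈ C₀^∞(B)`. -/
def AlmostHarmonic {N n : ℕ} (A : Mat N n →L[ℝ] Mat N n →L[ℝ] ℝ) (ε : ℝ) (B B' : Set (Vec n))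
    (u : Vec n → Vec N) (G : Vec n → Mat N n) : Prop :=
  HasWeakGradient B' u G ∧
    ∀ ξ : Vec n → Vec N, IsTest B ξ →
      |⨍ x in B, A (G x) (grad ξ x)| ≤ ε * (⨍ x in B', ‖G x‖) * supGrad B ξ

end OrliczGrowth

open OrliczGrowth

namespace OrliczGrowth

/-! Write `H = ∇u - Q`, `a = |Q|` and `t₀ = ⨍_{2B} |H|`. By the Euler–Lagrange equation and because
`∇ξ` has mean zero, `∫ D²f(Q)(H, ∇ξ)` is, up to sign, the integral against `∇ξ` of the error `Df(Q +
H) - Df(Q) - D²f(Q)H`. Fix `σ ≤ 1/2`. Where `|H| ≤ σa`, the Hölder condition bounds the error by `L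
σ^β φ''(a) |H|`; where `|H| ≥ σa`, it is at most `C σ⁻¹ φ_a(|H|) / a`
(`IsIntegrand.norm_linearization_le`). The first contribution is a small multiple of `φ''(a) t₀`
once `σ` is small.

The second contribution requires the energy `⨍_B φ_a(|H|)` to be controlled by `φ_a(t₀)`, a reverse
Hölder inequality with an `L¹` mean on the right (`exists_reverse_holder`). Minimality and strict
quasiconvexity give a Caccioppoli inequality (`exists_caccioppoli`). Its zero-order term is handled
by comparing the function with its mollification at a small fraction of the cut-off width: this
costs a small multiple of the energy, plus `φ_a` of a multiple of `t₀`, since the mollified gradient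
is bounded by the `L¹` mean (`IsLocalized.exists_oscillation_le`). Hole filling and iteration over
radii then remove the energy from the right-hand side.

Near `0` the shifted function `φ_a` is quadratic, so `φ_a(t₀) ≤ C τ a φ''(a) t₀` as soon as `t₀ ≤
τa`. That is what the small excess provides: `φ_{|P|}(|G - P|) ≤ C |V(G) - V(P)|²`, hence the excess
of `V(∇u)` controls `⨍ φ_a(|H|)`, and for small `δ` this is at most `C δ φ(a)` (`small_excess`).
Jensen's inequality turns it into a bound for `φ_a(t₀)`, and so for `t₀`. The parameters are chosen
in the order `σ`, `τ`, `δ`. If `Q = 0`, the same argument forces `V(∇u) = 0`. -/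

/-- A natural number bounding the growth exponent `t φ''(t) / φ'(t) ≤ 1 / c₀`. -/
noncomputable def growthExp (c₀ : ℝ) : ℕ := ⌈1 / c₀⌉₊

/-- The derivative of `shifted φ a`. -/
noncomputable def dshift (φ : ℝ → ℝ) (a s : ℝ) : ℝ := dphi φ (a + s) * (s / (a + s))

/-! ### Growth of an N-function and of its shifts. -/

namespace IsRegularNFunction

variable {φ : ℝ → ℝ} {c₀ c₁ : ℝ}

theorem dphi_continuousOn (h : IsRegularNFunction φ c₀ c₁) : ContinuousOn (dphi φ) (Ici 0) :=
  h.contDiffOn_one.continuousOn_derivWithin (uniqueDiffOn_Ici 0) le_rfl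

theorem dphi_eq_deriv {t : ℝ} (ht : 0 < t) : dphi φ t = deriv φ t :=
  derivWithin_of_mem_nhds (Ici_mem_nhds ht)

theorem hasDerivAt (h : IsRegularNFunction φ c₀ c₁) {t : ℝ} (ht : 0 < t) :
    HasDerivAt φ (dphi φ t) t := by
  rw [dphi_eq_deriv ht]
  have := (h.contDiffOn_one.differentiableOn (by norm_num)) t ht.le
  exact (this.differentiableAt (Ici_mem_nhds ht)).hasDerivAt

theorem continuousOn (h : IsRegularNFunction φ c₀ c₁) : ContinuousOn φ (Ici 0) :=
  h.contDiffOn_one.continuousOn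

theorem hasDerivAt_dphi (h : IsRegularNFunction φ c₀ c₁) {t : ℝ} (ht : 0 < t) :
    HasDerivAt (dphi φ) (ddphi φ t) t := by
  have h1 : ContDiffOn ℝ 1 (deriv φ) (Ioi 0) :=
    ((contDiffOn_succ_iff_deriv_of_isOpen (n := 1) isOpen_Ioi).1
      (by simpa [one_add_one_eq_two] using h.contDiffOn_two)).2.2
  have h2 : DifferentiableAt ℝ (deriv φ) t :=
    (h1.differentiableOn (by norm_num)).differentiableAt (Ioi_mem_nhds ht)
  have h3 : dphi φ =ᶠ[𝓝 t] deriv φ := by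
    filter_upwards [Ioi_mem_nhds ht] with s hs using dphi_eq_deriv hs
  exact (h2.congr_of_eventuallyEq h3).hasDerivAt

theorem dphi_nonneg (h : IsRegularNFunction φ c₀ c₁) {t : ℝ} (ht : 0 ≤ t) : 0 ≤ dphi φ t := by
  rcases ht.eq_or_lt with rfl | ht
  · exact h.deriv_zero.ge
  · exact (h.deriv_pos t ht).le

theorem dphi_mono (h : IsRegularNFunction φ c₀ c₁) {s t : ℝ} (hs : 0 ≤ s) (hst : s ≤ t) :
    dphi φ s ≤ dphi φ t :=
  h.deriv_mono hs (hs.trans hst) hst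

theorem ddphi_pos (h : IsRegularNFunction φ c₀ c₁) (hc₁ : 0 < c₁) {t : ℝ} (ht : 0 < t) :
    0 < ddphi φ t := by
  have h1 := (h.deriv_pos t ht).trans_le (h.upper t ht)
  have h2 := (pos_iff_pos_of_mul_pos h1).1 hc₁
  exact (pos_iff_pos_of_mul_pos h2).1 ht

theorem mul_ddphi_le (h : IsRegularNFunction φ c₀ c₁) (hc₀ : 0 < c₀) {t : ℝ} (ht : 0 < t) :
    t * ddphi φ t ≤ 1 / c₀ * dphi φ t := by
  have := h.lower t ht
  rw [one_div, ← div_eq_inv_mul, le_div_iff₀ hc₀]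
  linarith

/-- The numerator of the derivative is `(t φ'' - p φ') t^(p-1)`, nonpositive because `t φ'' ≤ φ' /
c₀` and `p ≥ 1 / c₀`. All doubling constants below come from here and therefore depend on `c₀` only.
-/
theorem antitoneOn_dphi_div_pow (h : IsRegularNFunction φ c₀ c₁) (hc₀ : 0 < c₀) :
    AntitoneOn (fun t => dphi φ t / t ^ growthExp c₀) (Ioi 0) := by
  set p := growthExp c₀ with hp
  have hd : ∀ t ∈ Ioi (0 : ℝ), HasDerivAt (fun t => dphi φ t / t ^ p)
      ((ddphi φ t * t ^ p - dphi φ t * (p * t ^ (p - 1))) / (t ^ p) ^ 2) t := fun t ht =>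
    (h.hasDerivAt_dphi ht).div (hasDerivAt_pow p t) (pow_ne_zero _ (ne_of_gt ht))
  refine antitoneOn_of_deriv_nonpos (convex_Ioi 0)
    (fun t ht => (hd t ht).continuousAt.continuousWithinAt)
    (fun t ht => (hd t (interior_subset ht)).differentiableAt.differentiableWithinAt) ?_
  intro t ht
  have ht : 0 < t := interior_subset ht
  rw [(hd t ht).deriv]
  refine div_nonpos_of_nonpos_of_nonneg ?_ (by positivity)
  have h1 := h.mul_ddphi_le hc₀ ht
  have h2 : 1 / c₀ ≤ p := Nat.le_ceil _
  -- The power rule involves the truncated difference `p - 1`, which is the true one because `p ≥ 1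
  -- / c₀ > 0`.
  have hp0 : p ≠ 0 := by
    rintro h0
    rw [h0] at h2
    have : 0 < 1 / c₀ := by positivity
    norm_num at h2
    exact absurd h2 (not_le.2 hc₀)
  obtain ⟨m, hm⟩ := Nat.exists_eq_succ_of_ne_zero hp0
  have h3 : t * ddphi φ t ≤ p * dphi φ t :=
    h1.trans (mul_le_mul_of_nonneg_right h2 (h.dphi_nonneg ht.le))
  rw [hm] at h3 ⊢
  have : ddphi φ t * t ^ (m + 1) - dphi φ t * (((m + 1 : ℕ) : ℝ) * t ^ (m + 1 - 1)) =
      (t * ddphi φ t - ((m + 1 : ℕ) : ℝ) * dphi φ t) * t ^ m := by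
    simp only [Nat.add_sub_cancel]; ring
  rw [Nat.succ_eq_add_one, this]
  exact mul_nonpos_of_nonpos_of_nonneg (by simpa using h3) (by positivity)

theorem dphi_mul_le (h : IsRegularNFunction φ c₀ c₁) (hc₀ : 0 < c₀) {l t : ℝ} (hl : 1 ≤ l)
    (ht : 0 ≤ t) : dphi φ (l * t) ≤ l ^ growthExp c₀ * dphi φ t := by
  rcases ht.eq_or_lt with rfl | ht
  · simp [h.deriv_zero]
  · have hlt : 0 < l * t := by positivity
    have := h.antitoneOn_dphi_div_pow hc₀ ht hlt (le_mul_of_one_le_left ht.le hl)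
    simp only at this
    rw [div_le_div_iff₀ (by positivity) (by positivity), mul_pow] at this
    have ht' : 0 < t ^ growthExp c₀ := by positivity
    nlinarith

theorem dshift_zero (φ : ℝ → ℝ) (a : ℝ) : dshift φ a 0 = 0 := by simp [dshift]

theorem dshift_nonneg (h : IsRegularNFunction φ c₀ c₁) {a t : ℝ} (ha : 0 ≤ a) (ht : 0 ≤ t) :
    0 ≤ dshift φ a t :=
  mul_nonneg (h.dphi_nonneg (by positivity)) (by positivity)

theorem dshift_zero_left (h : IsRegularNFunction φ c₀ c₁) (t : ℝ) :
    dshift φ 0 t = dphi φ t := by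
  rcases eq_or_ne t 0 with rfl | ht
  · simp [dshift, h.deriv_zero]
  · simp [dshift, ht]

theorem dshift_mono (h : IsRegularNFunction φ c₀ c₁) {a s t : ℝ} (ha : 0 ≤ a) (hs : 0 ≤ s)
    (hst : s ≤ t) : dshift φ a s ≤ dshift φ a t := by
  rcases hs.eq_or_lt with rfl | hs
  · rw [dshift_zero]; exact h.dshift_nonneg ha hst
  · refine mul_le_mul (h.dphi_mono (by positivity) (by linarith)) ?_ (by positivity)
      (h.dphi_nonneg (by linarith))
    rw [div_le_div_iff₀ (by linarith) (by linarith)]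
    nlinarith

theorem dshift_continuousOn (h : IsRegularNFunction φ c₀ c₁) {a : ℝ} (ha : 0 ≤ a) :
    ContinuousOn (dshift φ a) (Ici 0) := by
  rcases ha.eq_or_lt with rfl | ha
  · exact h.dphi_continuousOn.congr fun t _ => h.dshift_zero_left t
  · have h1 : ContinuousOn (fun s => a + s) (Ici 0) := by fun_prop
    refine (h.dphi_continuousOn.comp h1 fun s (hs : 0 ≤ s) => ?_).mul
      (continuousOn_id.div h1 fun s (hs : 0 ≤ s) => by positivity)
    exact mem_Ici.2 (by positivity)

/-- The factor `φ'(a + lt) ≤ φ'(l(a + t))` costs `l ^ p` and the quotient `t / (a + t)` costs one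
more `l`. The constant does not see the shift, which is what makes all later estimates uniform in
`|Q|`. -/
theorem dshift_mul_le (h : IsRegularNFunction φ c₀ c₁) (hc₀ : 0 < c₀) {a l t : ℝ} (ha : 0 ≤ a)
    (hl : 1 ≤ l) (ht : 0 ≤ t) :
    dshift φ a (l * t) ≤ l ^ (growthExp c₀ + 1) * dshift φ a t := by
  rcases ht.eq_or_lt with rfl | ht
  · simp [dshift_zero]
  have hlt : 0 < l * t := by positivity
  have hle : t ≤ l * t := le_mul_of_one_le_left ht.le hl
  have h1 : dphi φ (a + l * t) ≤ l ^ growthExp c₀ * dphi φ (a + t) :=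
    (h.dphi_mono (by positivity) (by nlinarith)).trans (h.dphi_mul_le hc₀ hl (by positivity))
  have h2 : l * t / (a + l * t) ≤ l * (t / (a + t)) := by
    rw [← mul_div_assoc]
    exact div_le_div_of_nonneg_left (by positivity) (by positivity) (by linarith)
  calc dshift φ a (l * t) ≤ (l ^ growthExp c₀ * dphi φ (a + t)) * (l * (t / (a + t))) :=
        mul_le_mul h1 h2 (by positivity)
          (mul_nonneg (by positivity) (h.dphi_nonneg (by positivity)))
    _ = l ^ (growthExp c₀ + 1) * dshift φ a t := by rw [dshift]; ring

theorem intervalIntegrable_dshift (h : IsRegularNFunction φ c₀ c₁) {a s t : ℝ} (ha : 0 ≤ a)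
    (hs : 0 ≤ s) (ht : 0 ≤ t) : IntervalIntegrable (dshift φ a) volume s t :=
  ((h.dshift_continuousOn ha).mono fun x hx => by
    rcases mem_uIcc.1 hx with hx | hx
    · exact hs.trans hx.1
    · exact ht.trans hx.1).intervalIntegrable

theorem shifted_eq (φ : ℝ → ℝ) (a t : ℝ) : shifted φ a t = ∫ s in (0 : ℝ)..t, dshift φ a s := rfl

theorem shifted_zero (φ : ℝ → ℝ) (a : ℝ) : shifted φ a 0 = 0 := by simp [shifted]

theorem hasDerivAt_shifted (h : IsRegularNFunction φ c₀ c₁) {a t : ℝ} (ha : 0 ≤ a) (ht : 0 < t) :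
    HasDerivAt (shifted φ a) (dshift φ a t) t := by
  refine intervalIntegral.integral_hasDerivAt_right
    (h.intervalIntegrable_dshift ha le_rfl ht.le) ?_
    ((h.dshift_continuousOn ha).continuousAt (Ici_mem_nhds ht))
  exact ((h.dshift_continuousOn ha).mono Ioi_subset_Ici_self).stronglyMeasurableAtFilter
    isOpen_Ioi t ht

theorem shifted_sub (h : IsRegularNFunction φ c₀ c₁) {a s t : ℝ} (ha : 0 ≤ a) (hs : 0 ≤ s)
    (ht : 0 ≤ t) : shifted φ a t - shifted φ a s = ∫ x in s..t, dshift φ a x := by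
  rw [shifted_eq, shifted_eq, intervalIntegral.integral_interval_sub_left
    (h.intervalIntegrable_dshift ha le_rfl ht) (h.intervalIntegrable_dshift ha le_rfl hs)]

/-- Integrate the monotone function `φ_a'` over `[s, t]`. Positivity, monotonicity and the
comparison of `φ_a(t)` with `t φ_a'(t)` are all special cases. -/
theorem shifted_sub_bounds (h : IsRegularNFunction φ c₀ c₁) {a s t : ℝ} (ha : 0 ≤ a) (hs : 0 ≤ s)
    (hst : s ≤ t) : (t - s) * dshift φ a s ≤ shifted φ a t - shifted φ a s ∧
      shifted φ a t - shifted φ a s ≤ (t - s) * dshift φ a t := by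
  have hi := h.intervalIntegrable_dshift ha hs (hs.trans hst)
  rw [h.shifted_sub ha hs (hs.trans hst)]
  constructor
  · have := intervalIntegral.integral_mono_on hst
      (intervalIntegrable_const (c := dshift φ a s)) hi
      fun x hx => h.dshift_mono ha hs hx.1
    simpa using this
  · have := intervalIntegral.integral_mono_on hst hi
      (intervalIntegrable_const (c := dshift φ a t))
      fun x hx => h.dshift_mono ha (hs.trans hx.1) hx.2
    simpa using this

theorem shifted_le (h : IsRegularNFunction φ c₀ c₁) {a t : ℝ} (ha : 0 ≤ a) (ht : 0 ≤ t) :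
    shifted φ a t ≤ t * dshift φ a t := by
  simpa [shifted_zero] using (h.shifted_sub_bounds ha le_rfl ht).2

theorem shifted_nonneg (h : IsRegularNFunction φ c₀ c₁) {a t : ℝ} (ha : 0 ≤ a) (ht : 0 ≤ t) :
    0 ≤ shifted φ a t := by
  simpa [shifted_zero, dshift_zero] using (h.shifted_sub_bounds ha le_rfl ht).1

theorem shifted_mono (h : IsRegularNFunction φ c₀ c₁) {a s t : ℝ} (ha : 0 ≤ a) (hs : 0 ≤ s)
    (hst : s ≤ t) : shifted φ a s ≤ shifted φ a t := by
  have := (h.shifted_sub_bounds ha hs hst).1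
  have h2 := mul_nonneg (sub_nonneg.2 hst) (h.dshift_nonneg ha hs)
  linarith

/-- On `[t/2, t]` the integrand of `φ_a` is at least `φ_a'(t/2)`, which doubling compares with
`φ_a'(t)`. -/
theorem mul_dshift_le (h : IsRegularNFunction φ c₀ c₁) (hc₀ : 0 < c₀) {a t : ℝ} (ha : 0 ≤ a)
    (ht : 0 ≤ t) : t * dshift φ a t ≤ 2 ^ (growthExp c₀ + 2) * shifted φ a t := by
  have h1 := (h.shifted_sub_bounds ha (s := t / 2) (t := t) (by positivity) (by linarith)).1
  have h2 := h.shifted_nonneg ha (t := t / 2) (by positivity)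
  have h3 := h.dshift_mul_le hc₀ ha (l := 2) (t := t / 2) (by norm_num) (by positivity)
  rw [mul_div_cancel₀ _ (two_ne_zero)] at h3
  have h4 := mul_le_mul_of_nonneg_left h3 ht
  have h5 : t * (2 ^ (growthExp c₀ + 1) * dshift φ a (t / 2)) =
    2 ^ (growthExp c₀ + 2) * ((t - t / 2) * dshift φ a (t / 2)) := by ring
  rw [h5] at h4
  exact h4.trans (mul_le_mul_of_nonneg_left (by linarith) (by positivity))

theorem shifted_continuousOn (h : IsRegularNFunction φ c₀ c₁) {a : ℝ} (ha : 0 ≤ a) :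
    ContinuousOn (shifted φ a) (Ici 0) := by
  intro t ht
  rcases (mem_Ici.1 ht).eq_or_lt with rfl | ht
  · have h1 : Tendsto (fun t => t * dshift φ a t) (𝓝[Ici 0] 0) (𝓝 (0 * dshift φ a 0)) :=
      (continuousOn_id.mul (h.dshift_continuousOn ha)) 0 (mem_Ici.2 le_rfl)
    rw [zero_mul] at h1
    rw [ContinuousWithinAt, shifted_zero]
    refine tendsto_of_tendsto_of_tendsto_of_le_of_le' tendsto_const_nhds h1 ?_ ?_
    · filter_upwards [self_mem_nhdsWithin] with s hs using h.shifted_nonneg ha hs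
    · filter_upwards [self_mem_nhdsWithin] with s hs using h.shifted_le ha hs
  · exact (h.hasDerivAt_shifted ha ht).continuousAt.continuousWithinAt

theorem shifted_convexOn (h : IsRegularNFunction φ c₀ c₁) {a : ℝ} (ha : 0 ≤ a) :
    ConvexOn ℝ (Ici 0) (shifted φ a) := by
  refine MonotoneOn.convexOn_of_deriv (convex_Ici 0) (h.shifted_continuousOn ha) ?_ ?_
  · intro t ht
    rw [interior_Ici] at ht
    exact (h.hasDerivAt_shifted ha ht).differentiableAt.differentiableWithinAt
  · intro s hs t ht hst
    rw [interior_Ici] at hs ht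
    rw [(h.hasDerivAt_shifted ha hs).deriv, (h.hasDerivAt_shifted ha ht).deriv]
    exact h.dshift_mono ha (le_of_lt hs) hst

/-- Through the shift `a = 0` every estimate for shifted functions specialises to `φ` itself. -/
theorem shifted_zero_left (h : IsRegularNFunction φ c₀ c₁) {t : ℝ} (ht : 0 ≤ t) :
    shifted φ 0 t = φ t := by
  have h1 : shifted φ 0 t = ∫ s in (0 : ℝ)..t, dphi φ s := by
    rw [shifted_eq]; congr 1; ext s; exact h.dshift_zero_left s
  rw [h1, intervalIntegral.integral_eq_sub_of_hasDerivAt_of_le ht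
    (h.continuousOn.mono Icc_subset_Ici_self) (fun x hx => h.hasDerivAt hx.1), h.map_zero, sub_zero]
  have := h.intervalIntegrable_dshift (a := 0) le_rfl le_rfl ht
  rwa [funext h.dshift_zero_left] at this

theorem shifted_mul_le (h : IsRegularNFunction φ c₀ c₁) (hc₀ : 0 < c₀) {a l t : ℝ} (ha : 0 ≤ a)
    (hl : 1 ≤ l) (ht : 0 ≤ t) :
    shifted φ a (l * t) ≤
      2 ^ (growthExp c₀ + 2) * l ^ (growthExp c₀ + 2) * shifted φ a t := by
  have h1 := h.shifted_le ha (t := l * t) (by positivity)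
  have h2 := h.dshift_mul_le hc₀ ha hl ht
  have h3 := h.mul_dshift_le hc₀ ha ht
  calc shifted φ a (l * t) ≤ l * t * (l ^ (growthExp c₀ + 1) * dshift φ a t) :=
        h1.trans (mul_le_mul_of_nonneg_left h2 (by positivity))
    _ = l ^ (growthExp c₀ + 2) * (t * dshift φ a t) := by ring
    _ ≤ l ^ (growthExp c₀ + 2) * (2 ^ (growthExp c₀ + 2) * shifted φ a t) :=
        mul_le_mul_of_nonneg_left h3 (by positivity)
    _ = _ := by ring

/-- Convexity together with `φ_a(0) = 0`. This gain of a full factor `l` makes the gradient term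
small in the oscillation estimate. -/
theorem shifted_mul_le_of_le_one (h : IsRegularNFunction φ c₀ c₁) {a l t : ℝ} (ha : 0 ≤ a)
    (hl0 : 0 ≤ l) (hl : l ≤ 1) (ht : 0 ≤ t) : shifted φ a (l * t) ≤ l * shifted φ a t := by
  have := (h.shifted_convexOn ha).2 (mem_Ici.2 ht) (mem_Ici.2 le_rfl) hl0 (sub_nonneg.2 hl)
    (by ring)
  simpa [shifted_zero] using this

theorem shifted_add_le (h : IsRegularNFunction φ c₀ c₁) (hc₀ : 0 < c₀) {a s t : ℝ} (ha : 0 ≤ a)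
    (hs : 0 ≤ s) (ht : 0 ≤ t) :
    shifted φ a (s + t) ≤
      4 ^ (growthExp c₀ + 2) * (shifted φ a s + shifted φ a t) := by
  have key : ∀ {s t : ℝ}, 0 ≤ s → s ≤ t → shifted φ a (s + t) ≤
      4 ^ (growthExp c₀ + 2) * (shifted φ a s + shifted φ a t) := by
    intro s t hs hst
    have h1 := h.shifted_mono ha (s := s + t) (t := 2 * t) (by linarith) (by linarith)
    have h2 := h.shifted_mul_le hc₀ ha (l := 2) (t := t) (by norm_num) (by linarith)
    rw [← mul_pow] at h2
    norm_num at h2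
    have h3 := h.shifted_nonneg ha hs
    exact h1.trans (h2.trans (mul_le_mul_of_nonneg_left (by linarith) (by positivity)))
  rcases le_total s t with hst | hst
  · exact key hs hst
  · rw [add_comm s t, add_comm (shifted φ a s)]; exact key ht hst

/-- Change of shift. -/
theorem shifted_le_shifted (h : IsRegularNFunction φ c₀ c₁) (hc₀ : 0 < c₀) {a b t : ℝ}
    (ha : 0 ≤ a) (hb : 0 ≤ b) (hab : |a - b| ≤ t) :
    shifted φ a t ≤ 4 ^ (growthExp c₀ + 2) * shifted φ b t := by
  have ht : 0 ≤ t := (abs_nonneg _).trans hab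
  rcases ht.eq_or_lt with rfl | ht
  · simp [shifted_zero]
  obtain ⟨h1, h2⟩ := abs_le.1 hab
  -- From `|a - b| ≤ t` one has `a + t ≤ 2(b + t)` and `b + t ≤ 2(a + t)`, so both factors of
  -- `φ_a'(t)` and `φ_b'(t)` are comparable.
  have h3 : dphi φ (a + t) ≤ 2 ^ growthExp c₀ * dphi φ (b + t) :=
    (h.dphi_mono (by positivity) (by linarith)).trans
      (h.dphi_mul_le hc₀ (l := 2) (by norm_num) (by positivity))
  have h4 : t / (a + t) ≤ 2 * (t / (b + t)) := by
    rw [← mul_div_assoc, div_le_div_iff₀ (by positivity) (by positivity)]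
    nlinarith
  have h5 : dshift φ a t ≤ (2 ^ growthExp c₀ * dphi φ (b + t)) * (2 * (t / (b + t))) :=
    mul_le_mul h3 h4 (by positivity) (mul_nonneg (by positivity) (h.dphi_nonneg (by positivity)))
  have h6 := h.mul_dshift_le hc₀ hb ht.le
  have h8 : 0 ≤ shifted φ b t := h.shifted_nonneg hb ht.le
  calc shifted φ a t ≤ t * ((2 ^ growthExp c₀ * dphi φ (b + t)) * (2 * (t / (b + t)))) :=
        (h.shifted_le ha ht.le).trans (mul_le_mul_of_nonneg_left h5 ht.le)
    _ = 2 ^ (growthExp c₀ + 1) * (t * dshift φ b t) := by rw [dshift]; ring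
    _ ≤ 2 ^ (growthExp c₀ + 1) * (2 ^ (growthExp c₀ + 2) * shifted φ b t) :=
        mul_le_mul_of_nonneg_left h6 (by positivity)
    _ ≤ 2 ^ (growthExp c₀ + 2) * (2 ^ (growthExp c₀ + 2) * shifted φ b t) := by
        gcongr <;> norm_num
    _ = 4 ^ (growthExp c₀ + 2) * shifted φ b t := by
        rw [← mul_assoc, ← mul_pow]; norm_num

theorem dshift_le_dphi (h : IsRegularNFunction φ c₀ c₁) {a t : ℝ} (ha : 0 ≤ a) (ht : 0 ≤ t) :
    dshift φ a t ≤ dphi φ (a + t) :=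
  mul_le_of_le_one_right (h.dphi_nonneg (by positivity)) (div_le_one_of_le₀ (by linarith)
    (by positivity))

theorem nonneg (h : IsRegularNFunction φ c₀ c₁) {t : ℝ} (ht : 0 ≤ t) : 0 ≤ φ t := by
  rw [← h.shifted_zero_left ht]; exact h.shifted_nonneg le_rfl ht

theorem mono (h : IsRegularNFunction φ c₀ c₁) {s t : ℝ} (hs : 0 ≤ s) (hst : s ≤ t) :
    φ s ≤ φ t := by
  rw [← h.shifted_zero_left hs, ← h.shifted_zero_left (hs.trans hst)]
  exact h.shifted_mono le_rfl hs hst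

theorem convexOn (h : IsRegularNFunction φ c₀ c₁) : ConvexOn ℝ (Ici 0) φ :=
  (h.shifted_convexOn le_rfl).congr fun _ ht => h.shifted_zero_left ht

theorem add_le (h : IsRegularNFunction φ c₀ c₁) (hc₀ : 0 < c₀) {s t : ℝ} (hs : 0 ≤ s)
    (ht : 0 ≤ t) : φ (s + t) ≤ 4 ^ (growthExp c₀ + 2) * (φ s + φ t) := by
  have := h.shifted_add_le hc₀ le_rfl hs ht
  rwa [h.shifted_zero_left hs, h.shifted_zero_left ht, h.shifted_zero_left (by positivity)] at this

theorem mul_dphi_le (h : IsRegularNFunction φ c₀ c₁) (hc₀ : 0 < c₀) {t : ℝ} (ht : 0 ≤ t) :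
    t * dphi φ t ≤ 2 ^ (growthExp c₀ + 2) * φ t := by
  have := h.mul_dshift_le hc₀ le_rfl ht
  rwa [h.shifted_zero_left ht, h.dshift_zero_left] at this

theorem le_mul_dphi (h : IsRegularNFunction φ c₀ c₁) {t : ℝ} (ht : 0 ≤ t) :
    φ t ≤ t * dphi φ t := by
  have := h.shifted_le le_rfl ht
  rwa [h.shifted_zero_left ht, h.dshift_zero_left] at this

/-- Membership in `L^φ` thereby yields integrability of `φ_a(|G - P|)` for every shift `a` and every
`P`. -/
theorem shifted_le_phi (h : IsRegularNFunction φ c₀ c₁) (hc₀ : 0 < c₀) {a t : ℝ} (ha : 0 ≤ a)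
    (ht : 0 ≤ t) : shifted φ a t ≤ 2 ^ (growthExp c₀ + 2) * φ (a + t) := by
  have h1 := h.shifted_le ha ht
  have h2 := h.dshift_le_dphi ha ht
  have h3 := h.mul_dphi_le hc₀ (t := a + t) (by positivity)
  have h4 : t * dshift φ a t ≤ (a + t) * dphi φ (a + t) :=
    mul_le_mul (by linarith) h2 (h.dshift_nonneg ha ht) (by positivity)
  linarith

end IsRegularNFunction
end OrliczGrowth

/-! ### Pointwise estimates for the integrand and its derivatives. -/

namespace OrliczGrowth
namespace IsIntegrand

variable {N n : ℕ} {Ω : Set (Vec n)} {φ : ℝ → ℝ} {f : Mat N n → ℝ} {c₀ c₁ k K L β : ℝ}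

theorem differentiable (hf : IsIntegrand Ω φ f k K L β) : Differentiable ℝ f :=
  hf.contDiff_one.differentiable (by norm_num)

theorem continuous_fderiv (hf : IsIntegrand Ω φ f k K L β) : Continuous (fderiv ℝ f) :=
  hf.contDiff_one.continuous_fderiv (by norm_num)

theorem hasFDerivAt_fderiv (hf : IsIntegrand Ω φ f k K L β) {Q : Mat N n} (hQ : Q ≠ 0) :
    HasFDerivAt (fderiv ℝ f) (D2 f Q) Q := by
  have h1 : ContDiffOn ℝ 1 (fderiv ℝ f) {0}ᶜ :=
    ((contDiffOn_succ_iff_fderiv_of_isOpen (n := 1) isOpen_compl_singleton).1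
      (by simpa [one_add_one_eq_two] using hf.contDiffOn_two)).2.2
  exact ((h1.differentiableOn (by norm_num)).differentiableAt
    (isOpen_compl_singleton.mem_nhds hQ)).hasFDerivAt

/-- `L` is only assumed real; its sign is read off the bound for `D²f` at one nonzero matrix, where
`φ'' > 0`. -/
theorem L_nonneg (hf : IsIntegrand Ω φ f k K L β) (hφ : IsRegularNFunction φ c₀ c₁)
    (hc₁ : 0 < c₁) {Q : Mat N n} (hQ : Q ≠ 0) : 0 ≤ L := by
  have h1 := (norm_nonneg (D2 f Q)).trans (hf.bound Q hQ)
  have h2 := hφ.ddphi_pos hc₁ (norm_pos_iff.2 hQ)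
  by_contra! h
  nlinarith

theorem map_zero (hf : IsIntegrand Ω φ f k K L β) (hφ : IsRegularNFunction φ c₀ c₁) :
    f 0 = 0 := by
  simpa [hφ.map_zero] using hf.growth 0

/-- The growth condition gives `|f(P)| ≤ |K| φ(|P|) ≤ |K| |P| φ'(|P|) = o(|P|)`. -/
theorem fderiv_zero (hf : IsIntegrand Ω φ f k K L β) (hφ : IsRegularNFunction φ c₀ c₁) :
    fderiv ℝ f 0 = 0 := by
  refine HasFDerivAt.fderiv ?_
  rw [hasFDerivAt_iff_isLittleO_nhds_zero]
  have h1 : Tendsto (fun P : Mat N n => |K| * dphi φ ‖P‖) (𝓝 0) (𝓝 0) := by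
    have h2 : Tendsto (dphi φ) (𝓝[Ici 0] 0) (𝓝 (dphi φ 0)) :=
      hφ.dphi_continuousOn 0 (mem_Ici.2 le_rfl)
    rw [hφ.deriv_zero] at h2
    have h3 : Tendsto (fun P : Mat N n => ‖P‖) (𝓝 0) (𝓝[Ici 0] 0) :=
      tendsto_nhdsWithin_iff.2 ⟨tendsto_norm_zero, Eventually.of_forall fun P => norm_nonneg P⟩
    simpa using (h2.comp h3).const_mul |K|
  rw [Asymptotics.isLittleO_iff]
  intro c hc
  filter_upwards [h1.eventually (gt_mem_nhds hc)] with P hP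
  simp only [zero_add, hf.map_zero hφ, sub_zero, _root_.zero_apply, Real.norm_eq_abs]
  have h4 := hφ.nonneg (norm_nonneg P)
  calc |f P| ≤ K * φ ‖P‖ := hf.growth P
    _ ≤ |K| * φ ‖P‖ := mul_le_mul_of_nonneg_right (le_abs_self K) h4
    _ ≤ |K| * (‖P‖ * dphi φ ‖P‖) :=
        mul_le_mul_of_nonneg_left (hφ.le_mul_dphi (norm_nonneg P)) (abs_nonneg K)
    _ = |K| * dphi φ ‖P‖ * ‖P‖ := by ring
    _ ≤ c * ‖P‖ := mul_le_mul_of_nonneg_right hP.le (norm_nonneg P)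

/-- Along the ray `t ↦ tP` the bound for `D²f` says that the derivative of `Df(tP)` is dominated by
that of `L φ'(t|P|)`. Since `D²f` is not available at `0`, one integrates from `e > 0` and lets `e →
0`, using `Df(0) = 0`. -/
theorem norm_fderiv_le (hf : IsIntegrand Ω φ f k K L β) (hφ : IsRegularNFunction φ c₀ c₁)
    (P : Mat N n) : ‖fderiv ℝ f P‖ ≤ L * dphi φ ‖P‖ := by
  rcases eq_or_ne P 0 with rfl | hP
  · simp [hf.fderiv_zero hφ, hφ.deriv_zero]
  have hpos := norm_pos_iff.2 hP
  have hcont : Continuous fun t : ℝ => fderiv ℝ f (t • P) :=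
    hf.continuous_fderiv.comp (by fun_prop)
  have key : ∀ e ∈ Ioc (0 : ℝ) 1, ‖fderiv ℝ f P - fderiv ℝ f (e • P)‖ ≤
      L * dphi φ ‖P‖ - L * dphi φ (e * ‖P‖) := by
    intro e he
    have hB : ContinuousOn (fun t : ℝ => L * dphi φ (t * ‖P‖) - L * dphi φ (e * ‖P‖))
        (Icc e 1) := by
      refine (continuousOn_const.mul (hφ.dphi_continuousOn.comp (by fun_prop) ?_)).sub
        continuousOn_const
      intro t ht
      exact mem_Ici.2 (mul_nonneg (he.1.le.trans ht.1) hpos.le)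
    have := image_norm_le_of_norm_deriv_right_le_deriv_boundary'
      (f := fun t : ℝ => fderiv ℝ f (t • P) - fderiv ℝ f (e • P))
      (f' := fun t => D2 f (t • P) P)
      (B := fun t : ℝ => L * dphi φ (t * ‖P‖) - L * dphi φ (e * ‖P‖))
      (B' := fun t => L * (ddphi φ (t * ‖P‖) * ‖P‖)) (a := e) (b := 1)
      (hcont.sub continuous_const).continuousOn ?_ (by simp) hB ?_ ?_
      (right_mem_Icc.2 he.2)
    · simpa using this
    · intro t ht
      have ht0 : 0 < t := he.1.trans_le ht.1
      have h1 := hf.hasFDerivAt_fderiv (smul_ne_zero ht0.ne' hP)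
      have h2 : HasDerivAt (fun t : ℝ => t • P) P t := by
        simpa using (hasDerivAt_id t).smul_const P
      exact ((h1.comp_hasDerivAt t h2).sub_const _).hasDerivWithinAt
    · intro t ht
      have ht0 : 0 < t := he.1.trans_le ht.1
      have h1 := hφ.hasDerivAt_dphi (t := t * ‖P‖) (by positivity)
      have h2 : HasDerivAt (fun t : ℝ => t * ‖P‖) ‖P‖ t := by
        simpa using (hasDerivAt_id t).mul_const ‖P‖
      exact (((h1.comp t h2).const_mul L).sub_const _).hasDerivWithinAt
    · intro t ht
      have ht0 : 0 < t := he.1.trans_le ht.1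
      have h1 := hf.bound (t • P) (smul_ne_zero ht0.ne' hP)
      rw [norm_smul, Real.norm_of_nonneg ht0.le] at h1
      calc ‖D2 f (t • P) P‖ ≤ ‖D2 f (t • P)‖ * ‖P‖ := ContinuousLinearMap.le_opNorm _ _
        _ ≤ (L * ddphi φ (t * ‖P‖)) * ‖P‖ := mul_le_mul_of_nonneg_right h1 hpos.le
        _ = _ := by ring
  have h1 : Tendsto (fun e : ℝ => ‖fderiv ℝ f P - fderiv ℝ f (e • P)‖) (𝓝[>] 0)
      (𝓝 ‖fderiv ℝ f P‖) := by
    have := (continuous_const.sub hcont).norm (f := fun e : ℝ => fderiv ℝ f P - fderiv ℝ f (e • P))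
    have := (this.tendsto 0).mono_left (nhdsWithin_le_nhds (s := Ioi 0))
    simpa [hf.fderiv_zero hφ] using this
  have h2 : Tendsto (fun e : ℝ => L * dphi φ ‖P‖ - L * dphi φ (e * ‖P‖)) (𝓝[>] 0)
      (𝓝 (L * dphi φ ‖P‖)) := by
    have h3 : Tendsto (fun e : ℝ => e * ‖P‖) (𝓝[>] 0) (𝓝[Ici 0] 0) := by
      refine tendsto_nhdsWithin_iff.2 ⟨?_, ?_⟩
      · have : Tendsto (fun e : ℝ => e * ‖P‖) (𝓝 0) (𝓝 (0 * ‖P‖)) :=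
          (continuous_id.mul continuous_const).tendsto 0
        rw [zero_mul] at this
        exact this.mono_left nhdsWithin_le_nhds
      · filter_upwards [self_mem_nhdsWithin] with e he
        exact mem_Ici.2 (mul_nonneg (le_of_lt he) hpos.le)
    have h4 : Tendsto (dphi φ) (𝓝[Ici 0] 0) (𝓝 (dphi φ 0)) :=
      hφ.dphi_continuousOn 0 (mem_Ici.2 le_rfl)
    rw [hφ.deriv_zero] at h4
    simpa using ((h4.comp h3).const_mul L).const_sub (L * dphi φ ‖P‖)
  refine le_of_tendsto_of_tendsto h1 h2 ?_
  filter_upwards [Ioc_mem_nhdsGT zero_lt_one] with e he using key e he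

/-- On the ball of radius `‖Q‖ / 2` around `Q`, `D²f` is bounded by a multiple of `φ'(‖Q‖)/‖Q‖`. -/
theorem norm_D2_le (hf : IsIntegrand Ω φ f k K L β) (hφ : IsRegularNFunction φ c₀ c₁)
    (hc₀ : 0 < c₀) (hc₁ : 0 < c₁) {Q A : Mat N n} (hQ : Q ≠ 0) (hA : ‖A‖ ≤ ‖Q‖ / 2) :
    ‖D2 f (Q + A)‖ ≤ L * (1 / c₀) * 2 ^ (growthExp c₀ + 1) * (dphi φ ‖Q‖ / ‖Q‖) := by
  have hpos := norm_pos_iff.2 hQ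
  have hL := hf.L_nonneg hφ hc₁ hQ
  have h1 : ‖Q‖ / 2 ≤ ‖Q + A‖ := by
    have := norm_sub_le (Q + A) A
    rw [add_sub_cancel_right] at this
    linarith
  have h2 : ‖Q + A‖ ≤ 2 * ‖Q‖ := (norm_add_le _ _).trans (by linarith)
  have h3 : 0 < ‖Q + A‖ := by linarith
  have h4 : ddphi φ ‖Q + A‖ ≤ 1 / c₀ * dphi φ ‖Q + A‖ / ‖Q + A‖ := by
    rw [le_div_iff₀ h3, mul_comm]
    exact hφ.mul_ddphi_le hc₀ h3
  have h5 : dphi φ ‖Q + A‖ ≤ 2 ^ growthExp c₀ * dphi φ ‖Q‖ :=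
    (hφ.dphi_mono h3.le h2).trans (hφ.dphi_mul_le hc₀ (by norm_num) hpos.le)
  have h6 := hφ.dphi_nonneg hpos.le
  calc ‖D2 f (Q + A)‖ ≤ L * ddphi φ ‖Q + A‖ := hf.bound _ (norm_pos_iff.1 h3)
    _ ≤ L * (1 / c₀ * (2 ^ growthExp c₀ * dphi φ ‖Q‖) / (‖Q‖ / 2)) := by
        refine mul_le_mul_of_nonneg_left (h4.trans ?_) hL
        gcongr
    _ = _ := by field_simp; ring

/-- Let `T = |A| + |B|`. The segment from `Q + A` to `Q + B` may meet `0`, so there are two cases.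
If `T ≤ |Q|/2`, it stays in a ball avoiding `0` and the bound for `D²f` applies. If `T ≥ |Q|/2`, the
two values of `Df` are bounded separately by `L φ'(|Q| + T)`, and `T / (|Q| + T) ≥ 1/3` compares
this with `φ_{|Q|}'(T)`. -/
theorem norm_fderiv_sub_fderiv_le (hf : IsIntegrand Ω φ f k K L β)
    (hφ : IsRegularNFunction φ c₀ c₁) (hc₀ : 0 < c₀) (hc₁ : 0 < c₁) {Q : Mat N n} (hQ : Q ≠ 0)
    (A B : Mat N n) :
    ‖fderiv ℝ f (Q + A) - fderiv ℝ f (Q + B)‖ ≤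
      L * (6 + 1 / c₀ * 2 ^ (growthExp c₀ + 2)) * dshift φ ‖Q‖ (‖A‖ + ‖B‖) := by
  have hpos := norm_pos_iff.2 hQ
  have hL := hf.L_nonneg hφ hc₁ hQ
  set T := ‖A‖ + ‖B‖ with hT
  have hT0 : 0 ≤ T := by positivity
  have hA : ‖A‖ ≤ T := by simp [hT]
  have hB : ‖B‖ ≤ T := by simp [hT]
  have hds := hφ.dshift_nonneg hpos.le hT0
  have hd : 0 ≤ dphi φ (‖Q‖ + T) := hφ.dphi_nonneg (by positivity)
  rcases le_total T (‖Q‖ / 2) with hc | hc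
  · have h1 : ‖fderiv ℝ f (Q + A) - fderiv ℝ f (Q + B)‖ ≤
        L * (1 / c₀) * 2 ^ (growthExp c₀ + 1) * (dphi φ ‖Q‖ / ‖Q‖) * ‖(Q + A) - (Q + B)‖ := by
      refine (convex_closedBall Q (‖Q‖ / 2)).norm_image_sub_le_of_norm_hasFDerivWithin_le
        (f' := D2 f) (fun P hP => ?_) (fun P hP => ?_) ?_ ?_
      · refine (hf.hasFDerivAt_fderiv ?_).hasFDerivWithinAt
        rintro rfl
        simp at hP
        linarith
      · have := hf.norm_D2_le hφ hc₀ hc₁ hQ (A := P - Q) (by simpa [dist_eq_norm] using hP)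
        simpa using this
      · simpa using hB.trans hc
      · simpa using hA.trans hc
    have h2 : ‖(Q + A) - (Q + B)‖ ≤ T := by
      rw [add_sub_add_left_eq_sub]; exact norm_sub_le _ _
    have h3 : dphi φ ‖Q‖ / ‖Q‖ * T ≤ 2 * dshift φ ‖Q‖ T := by
      have h4 : dphi φ ‖Q‖ ≤ dphi φ (‖Q‖ + T) := hφ.dphi_mono hpos.le (by linarith)
      have h5 : T / ‖Q‖ ≤ 2 * (T / (‖Q‖ + T)) := by
        rw [← mul_div_assoc, div_le_div_iff₀ hpos (by positivity)]
        nlinarith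
      calc dphi φ ‖Q‖ / ‖Q‖ * T = dphi φ ‖Q‖ * (T / ‖Q‖) := by ring
        _ ≤ dphi φ (‖Q‖ + T) * (2 * (T / (‖Q‖ + T))) := mul_le_mul h4 h5 (by positivity) hd
        _ = _ := by rw [dshift]; ring
    calc _ ≤ L * (1 / c₀) * 2 ^ (growthExp c₀ + 1) * (dphi φ ‖Q‖ / ‖Q‖) * T :=
          h1.trans (mul_le_mul_of_nonneg_left h2 (mul_nonneg (by positivity)
            (div_nonneg (hφ.dphi_nonneg hpos.le) hpos.le)))
      _ = L * (1 / c₀) * 2 ^ (growthExp c₀ + 1) * (dphi φ ‖Q‖ / ‖Q‖ * T) := by ring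
      _ ≤ L * (1 / c₀) * 2 ^ (growthExp c₀ + 1) * (2 * dshift φ ‖Q‖ T) :=
          mul_le_mul_of_nonneg_left h3 (by positivity)
      _ = L * (1 / c₀ * 2 ^ (growthExp c₀ + 2)) * dshift φ ‖Q‖ T := by ring
      _ ≤ _ := by
          refine mul_le_mul_of_nonneg_right (mul_le_mul_of_nonneg_left ?_ hL) hds
          linarith
  · have h1 : ∀ P : Mat N n, ‖P‖ ≤ T → ‖fderiv ℝ f (Q + P)‖ ≤ L * dphi φ (‖Q‖ + T) := by
      intro P hP
      refine (hf.norm_fderiv_le hφ _).trans (mul_le_mul_of_nonneg_left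
        (hφ.dphi_mono (norm_nonneg _) ((norm_add_le _ _).trans (by linarith))) hL)
    have h2 : dphi φ (‖Q‖ + T) ≤ 3 * dshift φ ‖Q‖ T := by
      have h3 : 1 ≤ 3 * (T / (‖Q‖ + T)) := by
        rw [← mul_div_assoc, le_div_iff₀ (by positivity)]; linarith
      calc dphi φ (‖Q‖ + T) ≤ dphi φ (‖Q‖ + T) * (3 * (T / (‖Q‖ + T))) :=
            le_mul_of_one_le_right hd h3
        _ = _ := by rw [dshift]; ring
    calc _ ≤ L * dphi φ (‖Q‖ + T) + L * dphi φ (‖Q‖ + T) :=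
          (norm_sub_le _ _).trans (add_le_add (h1 A hA) (h1 B hB))
      _ ≤ L * 6 * dshift φ ‖Q‖ T := by nlinarith
      _ ≤ _ := by
          refine mul_le_mul_of_nonneg_right (mul_le_mul_of_nonneg_left ?_ hL) hds
          have : 0 ≤ 1 / c₀ * 2 ^ (growthExp c₀ + 2) := by positivity
          linarith

/-- The second order difference of `f` is controlled by the shifted N-function. -/
theorem abs_second_difference_le (hf : IsIntegrand Ω φ f k K L β)
    (hφ : IsRegularNFunction φ c₀ c₁) (hc₀ : 0 < c₀) (hc₁ : 0 < c₁) {Q : Mat N n} (hQ : Q ≠ 0)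
    (W Z : Mat N n) :
    |f (Q + W) - f Q - f (Q + W + Z) + f (Q + Z)| ≤
      L * (6 + 1 / c₀ * 2 ^ (growthExp c₀ + 2)) * 2 ^ (2 * growthExp c₀ + 3) *
        shifted φ ‖Q‖ (‖W‖ + ‖Z‖) := by
  have hpos := norm_pos_iff.2 hQ
  have hL := hf.L_nonneg hφ hc₁ hQ
  set C := L * (6 + 1 / c₀ * 2 ^ (growthExp c₀ + 2)) with hC
  have hC0 : 0 ≤ C := by positivity
  set T := ‖W‖ + ‖Z‖ with hT
  have hT0 : 0 ≤ T := by positivity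
  have hd : ∀ t : ℝ, ∀ P : Mat N n, HasDerivAt (fun t : ℝ => f (P + t • Z))
      (fderiv ℝ f (P + t • Z) Z) t := by
    intro t P
    have h2 : HasDerivAt (fun t : ℝ => P + t • Z) Z t := by
      simpa using ((hasDerivAt_id t).smul_const Z).const_add P
    exact (hf.differentiable _).hasFDerivAt.comp_hasDerivAt t h2
  -- The second difference is the increment over `[0, 1]` of `t ↦ f(Q + tZ) - f(Q + W + tZ)`. Its
  -- derivative is a difference of values of `Df`, whose increments from `Q` have total size at most
  -- `2T`.
  have h1 := (convex_Icc (0 : ℝ) 1).norm_image_sub_le_of_norm_hasDerivWithin_le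
    (f := fun t : ℝ => f (Q + t • Z) - f (Q + W + t • Z))
    (f' := fun t : ℝ => fderiv ℝ f (Q + t • Z) Z - fderiv ℝ f (Q + W + t • Z) Z)
    (C := C * dshift φ ‖Q‖ (2 * T) * ‖Z‖) (x := 0) (y := 1)
    (fun t _ => ((hd t Q).sub (hd t (Q + W))).hasDerivWithinAt) ?_ (by simp) (by simp)
  · have h2 : ‖f (Q + (1 : ℝ) • Z) - f (Q + W + (1 : ℝ) • Z) -
      (f (Q + (0 : ℝ) • Z) - f (Q + W + (0 : ℝ) • Z))‖ ≤ _ := h1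
    rw [Real.norm_eq_abs] at h2
    have h3 : f (Q + (1 : ℝ) • Z) - f (Q + W + (1 : ℝ) • Z) -
        (f (Q + (0 : ℝ) • Z) - f (Q + W + (0 : ℝ) • Z)) =
        f (Q + W) - f Q - f (Q + W + Z) + f (Q + Z) := by
      simp; ring
    rw [h3] at h2
    have h4 := hφ.dshift_mul_le hc₀ hpos.le (l := 2) (by norm_num) hT0
    have h5 := hφ.mul_dshift_le hc₀ hpos.le hT0
    have h6 := hφ.dshift_nonneg hpos.le (t := 2 * T) (by positivity)
    calc _ ≤ C * dshift φ ‖Q‖ (2 * T) * ‖Z‖ := by simpa using h2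
      _ ≤ C * dshift φ ‖Q‖ (2 * T) * T :=
          mul_le_mul_of_nonneg_left (by simp [hT]) (by positivity)
      _ ≤ C * (2 ^ (growthExp c₀ + 1) * dshift φ ‖Q‖ T) * T := by gcongr
      _ = C * 2 ^ (growthExp c₀ + 1) * (T * dshift φ ‖Q‖ T) := by ring
      _ ≤ C * 2 ^ (growthExp c₀ + 1) * (2 ^ (growthExp c₀ + 2) * shifted φ ‖Q‖ T) := by gcongr
      _ = _ := by ring
  · intro t ht
    rw [← _root_.sub_apply, add_assoc Q W]
    refine (ContinuousLinearMap.le_opNorm _ _).trans (mul_le_mul_of_nonneg_right ?_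
      (norm_nonneg Z))
    refine (hf.norm_fderiv_sub_fderiv_le hφ hc₀ hc₁ hQ _ _).trans
      (mul_le_mul_of_nonneg_left ?_ hC0)
    refine hφ.dshift_mono hpos.le (by positivity) ?_
    have h7 : ‖t • Z‖ ≤ ‖Z‖ := by
      rw [norm_smul, Real.norm_of_nonneg ht.1]
      exact mul_le_of_le_one_left (norm_nonneg Z) ht.2
    have := norm_add_le W (t • Z)
    rw [hT]
    linarith [norm_nonneg W]

/-- Linearization of `Df` at `Q` for small increments. -/
theorem norm_linearization_le_of_small (hf : IsIntegrand Ω φ f k K L β)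
    (hφ : IsRegularNFunction φ c₀ c₁) (hc₁ : 0 < c₁) (hβ : 0 < β) {Q : Mat N n} (hQ : Q ≠ 0)
    {σ : ℝ} (hσ0 : 0 < σ) (hσ : σ ≤ 1 / 2) {P : Mat N n} (hP : ‖P‖ ≤ σ * ‖Q‖) :
    ‖fderiv ℝ f (Q + P) - fderiv ℝ f Q - D2 f Q P‖ ≤ L * σ ^ β * ddphi φ ‖Q‖ * ‖P‖ := by
  have hpos := norm_pos_iff.2 hQ
  have hL := hf.L_nonneg hφ hc₁ hQ
  have hdd := hφ.ddphi_pos hc₁ hpos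
  -- Mean value inequality for `Df` minus its linear part on the ball of radius `σ|Q|`, which avoids
  -- `0` because `σ ≤ 1/2`. There the Hölder condition gives `|D²f(R) - D²f(Q)| ≤ L σ^β φ''(|Q|)`.
  have h1 := (convex_closedBall Q (σ * ‖Q‖)).norm_image_sub_le_of_norm_hasFDerivWithin_le'
    (f := fderiv ℝ f) (f' := D2 f) (φ := D2 f Q) (x := Q) (y := Q + P)
    (C := L * σ ^ β * ddphi φ ‖Q‖) (fun R hR => ?_) (fun R hR => ?_)
    (by simpa using by positivity) (by simpa using hP)
  · simpa using h1
  · refine (hf.hasFDerivAt_fderiv ?_).hasFDerivWithinAt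
    rintro rfl
    simp at hR
    nlinarith
  · have hR' : ‖R - Q‖ ≤ σ * ‖Q‖ := by simpa [dist_eq_norm] using hR
    have h2 := hf.holder (R - Q) Q hQ (hR'.trans (by gcongr))
    rw [add_sub_cancel] at h2
    rw [norm_sub_rev (D2 f R)]
    refine h2.trans ?_
    have h3 : ‖R - Q‖ ^ β ≤ σ ^ β * ‖Q‖ ^ β := by
      rw [← Real.mul_rpow hσ0.le hpos.le]
      exact Real.rpow_le_rpow (norm_nonneg _) hR' hβ.le
    calc L * ddphi φ ‖Q‖ * ‖Q‖ ^ (-β) * ‖R - Q‖ ^ β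
        ≤ L * ddphi φ ‖Q‖ * ‖Q‖ ^ (-β) * (σ ^ β * ‖Q‖ ^ β) := by gcongr
      _ = L * σ ^ β * ddphi φ ‖Q‖ * (‖Q‖ ^ (-β) * ‖Q‖ ^ β) := by ring
      _ = L * σ ^ β * ddphi φ ‖Q‖ := by
          rw [← Real.rpow_add hpos]; simp

/-- Linearization of `Df` at `Q` for large increments. -/
theorem norm_linearization_le_of_large (hf : IsIntegrand Ω φ f k K L β)
    (hφ : IsRegularNFunction φ c₀ c₁) (hc₀ : 0 < c₀) (hc₁ : 0 < c₁) {Q : Mat N n} (hQ : Q ≠ 0)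
    {σ : ℝ} (hσ0 : 0 < σ) (hσ : σ ≤ 1) {P : Mat N n} (hP : σ * ‖Q‖ ≤ ‖P‖) :
    ‖fderiv ℝ f (Q + P) - fderiv ℝ f Q - D2 f Q P‖ ≤
      L * (6 + 1 / c₀ * 2 ^ (growthExp c₀ + 2) + 2 / c₀) * 2 ^ (growthExp c₀ + 2) / σ *
        (shifted φ ‖Q‖ ‖P‖ / ‖Q‖) := by
  have hpos := norm_pos_iff.2 hQ
  have hL := hf.L_nonneg hφ hc₁ hQ
  have hP0 : 0 < ‖P‖ := (mul_pos hσ0 hpos).trans_le hP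
  have h1 := hf.norm_fderiv_sub_fderiv_le hφ hc₀ hc₁ hQ P 0
  simp only [add_zero, norm_zero] at h1
  have h2 : ‖D2 f Q P‖ ≤ L * (1 / c₀) * (dphi φ ‖Q‖ / ‖Q‖ * ‖P‖) := by
    have h4 : ddphi φ ‖Q‖ ≤ 1 / c₀ * dphi φ ‖Q‖ / ‖Q‖ := by
      rw [le_div_iff₀ hpos, mul_comm]
      exact hφ.mul_ddphi_le hc₀ hpos
    calc ‖D2 f Q P‖ ≤ ‖D2 f Q‖ * ‖P‖ := ContinuousLinearMap.le_opNorm _ _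
      _ ≤ L * (1 / c₀ * dphi φ ‖Q‖ / ‖Q‖) * ‖P‖ := by
          gcongr
          exact (hf.bound Q hQ).trans (by gcongr)
      _ = _ := by ring
  set g := dshift φ ‖Q‖ ‖P‖ with hg
  have hg0 : 0 ≤ g := hφ.dshift_nonneg hpos.le hP0.le
  have h3 : dphi φ ‖Q‖ * σ ≤ 2 * g := by
    have h4 : dphi φ ‖Q‖ ≤ dphi φ (‖Q‖ + ‖P‖) := hφ.dphi_mono hpos.le (by linarith)
    have h5 : σ ≤ 2 * (‖P‖ / (‖Q‖ + ‖P‖)) := by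
      rw [← mul_div_assoc, le_div_iff₀ (by positivity)]
      nlinarith
    calc dphi φ ‖Q‖ * σ ≤ dphi φ (‖Q‖ + ‖P‖) * (2 * (‖P‖ / (‖Q‖ + ‖P‖))) :=
          mul_le_mul h4 h5 hσ0.le (hφ.dphi_nonneg (by positivity))
      _ = _ := by rw [hg, dshift]; ring
  have h6 := hφ.mul_dshift_le hc₀ hpos.le hP0.le
  rw [← hg] at h6
  -- Since `|P| / (σ|Q|) ≥ 1`, each term may be multiplied by this ratio; the product `|P|
  -- φ_{|Q|}'(|P|)` is then comparable to `φ_{|Q|}(|P|)`.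
  have h7 : g ≤ ‖P‖ * g / (σ * ‖Q‖) := by
    rw [le_div_iff₀ (by positivity), mul_comm]
    exact mul_le_mul_of_nonneg_right hP hg0
  have h8 : dphi φ ‖Q‖ / ‖Q‖ * ‖P‖ ≤ 2 * (‖P‖ * g / (σ * ‖Q‖)) := by
    rw [← mul_div_assoc, le_div_iff₀ (by positivity)]
    calc dphi φ ‖Q‖ / ‖Q‖ * ‖P‖ * (σ * ‖Q‖) = (dphi φ ‖Q‖ * σ) * ‖P‖ := by
          field_simp
      _ ≤ 2 * g * ‖P‖ := by gcongr
      _ = _ := by ring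
  have h9 : ‖P‖ * g / (σ * ‖Q‖) ≤
      2 ^ (growthExp c₀ + 2) / σ * (shifted φ ‖Q‖ ‖P‖ / ‖Q‖) := by
    rw [div_mul_div_comm]
    gcongr
  set C := 6 + 1 / c₀ * 2 ^ (growthExp c₀ + 2) with hC
  have hC0 : 0 ≤ C := by positivity
  calc _ ≤ L * C * g + L * (1 / c₀) * (dphi φ ‖Q‖ / ‖Q‖ * ‖P‖) :=
        (norm_sub_le _ _).trans (add_le_add h1 h2)
    _ ≤ L * C * (‖P‖ * g / (σ * ‖Q‖)) + L * (1 / c₀) * (2 * (‖P‖ * g / (σ * ‖Q‖))) := by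
        gcongr
    _ = L * (C + 2 / c₀) * (‖P‖ * g / (σ * ‖Q‖)) := by ring
    _ ≤ L * (C + 2 / c₀) * (2 ^ (growthExp c₀ + 2) / σ * (shifted φ ‖Q‖ ‖P‖ / ‖Q‖)) := by
        gcongr
    _ = _ := by ring

end IsIntegrand
end OrliczGrowth

/-! ### The map `V` and the shifted distance. -/

namespace OrliczGrowth

variable {N n : ℕ} {φ : ℝ → ℝ} {c₀ c₁ : ℝ}

namespace IsRegularNFunction

theorem norm_V_sq (h : IsRegularNFunction φ c₀ c₁) (Q : Mat N n) :
    ‖V φ Q‖ ^ 2 = dphi φ ‖Q‖ * ‖Q‖ := by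
  have h0 : 0 ≤ dphi φ ‖Q‖ * ‖Q‖ := mul_nonneg (h.dphi_nonneg (norm_nonneg Q)) (norm_nonneg Q)
  rcases eq_or_ne Q 0 with rfl | hQ
  · simp [V]
  · have hpos := norm_pos_iff.2 hQ
    rw [V, norm_smul, Real.norm_of_nonneg (by positivity), div_mul_cancel₀ _ hpos.ne',
      Real.sq_sqrt h0]

/-- The square root `√(φ'(t) t)` has difference quotients comparable to those of a power. -/
theorem sqrt_sub_sqrt_ge (h : IsRegularNFunction φ c₀ c₁) {s t : ℝ} (hs : 0 ≤ s) (hst : s ≤ t)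
    (ht : 0 < t) :
    Real.sqrt (dphi φ t * t) / t * (t - s) ≤
      2 * (Real.sqrt (dphi φ t * t) - Real.sqrt (dphi φ s * s)) := by
  have hds := h.dphi_nonneg hs
  have hdt := h.deriv_pos t ht
  set x := Real.sqrt (dphi φ t * t) with hx
  set y := Real.sqrt (dphi φ s * s) with hy
  have hx2 : x ^ 2 = dphi φ t * t := Real.sq_sqrt (by positivity)
  have hy2 : y ^ 2 = dphi φ s * s := Real.sq_sqrt (by positivity)
  have hxpos : 0 < x := Real.sqrt_pos.2 (by positivity)
  have hmono := h.dphi_mono hs hst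
  have hyx : y ≤ x := Real.sqrt_le_sqrt (mul_le_mul hmono hst hs hdt.le)
  have hy0 : 0 ≤ y := Real.sqrt_nonneg _
  -- Work with squares: monotonicity of `φ'` bounds `x² - y²` from below by `φ'(t)(t - s)`, while
  -- `x² - y² ≤ 2x(x - y)`; then divide by `x`.
  have h1 : dphi φ t * (t - s) ≤ x ^ 2 - y ^ 2 := by
    rw [hx2, hy2]; nlinarith
  have h2 : x ^ 2 - y ^ 2 ≤ 2 * x * (x - y) := by nlinarith
  have h3 : x * (x / t * (t - s)) = dphi φ t * (t - s) := by
    have : x * (x / t * (t - s)) = x ^ 2 / t * (t - s) := by ring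
    rw [this, hx2]; field_simp
  have h4 : x * (x / t * (t - s)) ≤ x * (2 * (x - y)) := by linarith
  exact le_of_mul_le_mul_left h4 hxpos

/-- Radial and angular parts of a distance. The angular defect `|G||P| - ⟨G, P⟩` is nonnegative and
independent of `a` and `b`, so two such distances can be compared part by part. -/
theorem norm_smul_sub_smul_sq (P G : Mat N n) (a b : ℝ) :
    ‖b • G - a • P‖ ^ 2 = (b * ‖G‖ - a * ‖P‖) ^ 2 +
      2 * (a * b) * (‖G‖ * ‖P‖ - inner ℝ G P) := by
  rw [norm_sub_sq_real, norm_smul, norm_smul, mul_pow, mul_pow, real_inner_smul_left,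
    real_inner_smul_right, Real.norm_eq_abs, Real.norm_eq_abs, sq_abs, sq_abs]
  ring

/-- The radial parts compare by `sqrt_sub_sqrt_ge`. If `|P| ≤ |G|/2`, the radial part already
dominates `|G - P|`. Otherwise `|P|` and `|G|` are comparable, and doubling of `φ'` compares the
coefficients of the angular parts. -/
theorem norm_sub_sq_mul_le (h : IsRegularNFunction φ c₀ c₁) (hc₀ : 0 < c₀) {P G : Mat N n}
    (hPG : ‖P‖ ≤ ‖G‖) (hG : G ≠ 0) :
    dphi φ ‖G‖ / ‖G‖ * ‖G - P‖ ^ 2 ≤ (64 * 2 ^ growthExp c₀) * ‖V φ G - V φ P‖ ^ 2 := by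
  have hpos := norm_pos_iff.2 hG
  set a := ‖P‖ with ha
  set b := ‖G‖ with hb
  have ha0 : 0 ≤ a := norm_nonneg _
  have hdb := h.deriv_pos b hpos
  have hda := h.dphi_nonneg ha0
  have hdab := h.dphi_mono ha0 hPG
  set x := Real.sqrt (dphi φ b * b) with hx
  set y := Real.sqrt (dphi φ a * a) with hy
  have hx2 : x ^ 2 = dphi φ b * b := Real.sq_sqrt (by positivity)
  have hy2 : y ^ 2 = dphi φ a * a := Real.sq_sqrt (by positivity)
  have hx0 : 0 ≤ x := Real.sqrt_nonneg _
  have hy0 : 0 ≤ y := Real.sqrt_nonneg _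
  have hyx : y ≤ x := Real.sqrt_le_sqrt (mul_le_mul hdab hPG ha0 hdb.le)
  have hquot : dphi φ b / b = (x / b) ^ 2 := by rw [div_pow, hx2]; field_simp
  have hxb : x / b * (b - a) ≤ 2 * (x - y) := h.sqrt_sub_sqrt_ge ha0 hPG hpos
  set I := b * a - inner ℝ G P with hI
  have hI0 : 0 ≤ I := sub_nonneg.2 (real_inner_le_norm G P)
  have hya : y / a * a = y := by
    rcases ha0.eq_or_lt with h0 | h0
    · rw [hy, ← h0]; simp
    · field_simp
  have hV : ‖V φ G - V φ P‖ ^ 2 = (x - y) ^ 2 + 2 * (y / a * (x / b)) * I := by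
    rw [V, V, norm_smul_sub_smul_sq, ← ha, ← hb, ← hx, ← hy, ← hI, hya,
      div_mul_cancel₀ _ hpos.ne']
  have hD : ‖G - P‖ ^ 2 = (b - a) ^ 2 + 2 * I := by
    have := norm_smul_sub_smul_sq P G 1 1
    rw [one_smul, one_smul] at this
    rw [this, ← ha, ← hb, ← hI]; ring
  have h1 : (x / b) ^ 2 * (b - a) ^ 2 ≤ 4 * (x - y) ^ 2 := by
    rw [← mul_pow, show (4 : ℝ) * (x - y) ^ 2 = (2 * (x - y)) ^ 2 by ring]
    exact pow_le_pow_left₀ (mul_nonneg (by positivity) (by linarith)) hxb 2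
  have hp1 : (1 : ℝ) ≤ 2 ^ growthExp c₀ := one_le_pow₀ (by norm_num)
  have hW : 0 ≤ 2 * (y / a * (x / b)) * I := by positivity
  rw [hV, hquot]
  rcases le_total a (b / 2) with hc | hc
  · have hn : ‖G - P‖ ≤ 2 * b := (norm_sub_le _ _).trans (by linarith)
    have h2 : b ≤ 2 * (b - a) := by linarith
    have h3 : ‖G - P‖ ^ 2 ≤ 16 * (b - a) ^ 2 := by nlinarith [norm_nonneg (G - P)]
    calc (x / b) ^ 2 * ‖G - P‖ ^ 2 ≤ (x / b) ^ 2 * (16 * (b - a) ^ 2) := by gcongr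
      _ ≤ 64 * (x - y) ^ 2 := by linarith
      _ ≤ 64 * 2 ^ growthExp c₀ * ((x - y) ^ 2 + 2 * (y / a * (x / b)) * I) := by
          have : 0 ≤ (x - y) ^ 2 := sq_nonneg _
          nlinarith
  · have ha' : 0 < a := by linarith
    have h2 : dphi φ b ≤ 2 ^ growthExp c₀ * dphi φ a :=
      (h.dphi_mono hpos.le (by linarith)).trans (h.dphi_mul_le hc₀ (by norm_num) ha0)
    have h3 : (x / b) ^ 2 ≤ 2 ^ growthExp c₀ * (y / a) ^ 2 := by
      rw [← hquot, div_pow, hy2]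
      have : dphi φ a * a / a ^ 2 = dphi φ a / a := by field_simp
      rw [this, ← mul_div_assoc]
      exact div_le_div₀ (by positivity) h2 ha' hPG
    have h4 : x / b ≤ 2 ^ growthExp c₀ * (y / a) := by
      refine le_of_sq_le_sq ?_ (by positivity)
      rw [mul_pow]
      refine h3.trans ?_
      gcongr
      exact le_self_pow₀ hp1 two_ne_zero
    rw [hD, mul_add]
    have h5 : (x / b) ^ 2 * (2 * I) ≤ 2 ^ growthExp c₀ * (2 * (y / a * (x / b)) * I) := by
      calc (x / b) ^ 2 * (2 * I) = x / b * (x / b * (2 * I)) := by ring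
        _ ≤ 2 ^ growthExp c₀ * (y / a) * (x / b * (2 * I)) :=
            mul_le_mul_of_nonneg_right h4 (by positivity)
        _ = _ := by ring
    have h6 : 0 ≤ (x - y) ^ 2 := sq_nonneg _
    set W := 2 * (y / a * (x / b)) * I
    set M := (2 : ℝ) ^ growthExp c₀
    have h7 : 4 * (x - y) ^ 2 ≤ 64 * M * (x - y) ^ 2 :=
      mul_le_mul_of_nonneg_right (by linarith) h6
    have h8 : M * W ≤ 64 * M * W := mul_le_mul_of_nonneg_right (by linarith) hW
    calc _ ≤ 4 * (x - y) ^ 2 + M * W := add_le_add h1 h5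
      _ ≤ _ := by rw [mul_add]; exact add_le_add h7 h8

/-- The shifted N-function is controlled by differences of `V`. -/
theorem shifted_norm_sub_le (h : IsRegularNFunction φ c₀ c₁) (hc₀ : 0 < c₀) (P G : Mat N n) :
    shifted φ ‖P‖ ‖G - P‖ ≤ 4096 * 32 ^ growthExp c₀ * ‖V φ G - V φ P‖ ^ 2 := by
  have key : ∀ {P G : Mat N n}, ‖P‖ ≤ ‖G‖ →
      shifted φ ‖P‖ ‖G - P‖ ≤ 256 * 8 ^ growthExp c₀ * ‖V φ G - V φ P‖ ^ 2 := by
    intro P G hPG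
    rcases eq_or_ne G 0 with rfl | hG
    · have : P = 0 := by simpa using hPG
      subst this
      simp [shifted_zero]
    have hpos := norm_pos_iff.2 hG
    have hP0 := norm_nonneg P
    set t := ‖G - P‖ with ht
    have ht0 : 0 ≤ t := norm_nonneg _
    have h1 : t ≤ ‖G‖ + ‖P‖ := norm_sub_le _ _
    have h2 : ‖G‖ ≤ ‖P‖ + t := by
      have := norm_add_le (G - P) P
      rw [sub_add_cancel] at this
      linarith
    have h3 : dphi φ (‖P‖ + t) ≤ 4 ^ growthExp c₀ * dphi φ ‖G‖ :=
      (h.dphi_mono (by positivity) (by linarith)).trans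
        (h.dphi_mul_le hc₀ (l := 4) (by norm_num) hpos.le)
    have h4 : dshift φ ‖P‖ t ≤ (4 ^ growthExp c₀ * dphi φ ‖G‖) * (t / ‖G‖) :=
      mul_le_mul h3 (div_le_div_of_nonneg_left ht0 hpos h2) (by positivity)
        (mul_nonneg (by positivity) (h.dphi_nonneg hpos.le))
    have h5 := h.norm_sub_sq_mul_le hc₀ hPG hG
    calc shifted φ ‖P‖ t ≤ t * ((4 ^ growthExp c₀ * dphi φ ‖G‖) * (t / ‖G‖)) :=
          (h.shifted_le hP0 ht0).trans (mul_le_mul_of_nonneg_left h4 ht0)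
      _ = 4 ^ growthExp c₀ * (dphi φ ‖G‖ / ‖G‖ * t ^ 2) := by ring
      _ ≤ 4 ^ growthExp c₀ * ((64 * 2 ^ growthExp c₀) * ‖V φ G - V φ P‖ ^ 2) := by gcongr
      _ = 64 * (4 * 2) ^ growthExp c₀ * ‖V φ G - V φ P‖ ^ 2 := by rw [mul_pow]; ring
      _ ≤ 256 * 8 ^ growthExp c₀ * ‖V φ G - V φ P‖ ^ 2 := by norm_num; gcongr; norm_num
  have hp : 256 * (8 : ℝ) ^ growthExp c₀ * 4 ^ (growthExp c₀ + 2) =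
      4096 * 32 ^ growthExp c₀ := by
    rw [pow_add, show (32 : ℝ) = 8 * 4 by norm_num, mul_pow]; ring
  rcases le_total ‖P‖ ‖G‖ with hPG | hPG
  · refine (key hPG).trans ?_
    gcongr <;> norm_num
  -- If `|P| ≥ |G|`, exchange the shift `|P|` for `|G|` and apply the first case with the roles of
  -- `P` and `G` reversed.
  · have h1 := h.shifted_le_shifted hc₀ (a := ‖P‖) (b := ‖G‖) (t := ‖G - P‖) (norm_nonneg _)
      (norm_nonneg _) (by rw [norm_sub_rev]; exact abs_norm_sub_norm_le P G)
    have h2 := key hPG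
    rw [norm_sub_rev P G, norm_sub_rev (V φ P)] at h2
    calc _ ≤ 4 ^ (growthExp c₀ + 2) * (256 * 8 ^ growthExp c₀ * ‖V φ G - V φ P‖ ^ 2) :=
          h1.trans (mul_le_mul_of_nonneg_left h2 (by positivity))
      _ = _ := by rw [← hp]; ring

/-- Quasi-triangle inequality for the shifted distance `φ_{|P|}(|G - P|)`. -/
theorem shifted_norm_sub_triangle (h : IsRegularNFunction φ c₀ c₁) (hc₀ : 0 < c₀)
    (P Q G : Mat N n) :
    shifted φ ‖Q‖ ‖G - Q‖ ≤ 16 ^ (growthExp c₀ + 2) *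
      (shifted φ ‖P‖ ‖G - P‖ + shifted φ ‖P‖ ‖Q - P‖) := by
  have hPQ : |‖Q‖ - ‖P‖| ≤ ‖Q - P‖ := abs_norm_sub_norm_le Q P
  have hs1 := h.shifted_nonneg (norm_nonneg P) (norm_nonneg (G - P))
  have hs2 := h.shifted_nonneg (norm_nonneg P) (norm_nonneg (Q - P))
  -- With the maximum as argument one has `||Q| - |P|| ≤ T`, as the change of shift requires.
  set T := max ‖G - P‖ ‖Q - P‖ with hT
  have hT0 : 0 ≤ T := le_max_of_le_left (norm_nonneg _)
  have h1 : ‖G - Q‖ ≤ 2 * T := by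
    have := norm_sub_le (G - P) (Q - P)
    rw [sub_sub_sub_cancel_right] at this
    have h2 := le_max_left ‖G - P‖ ‖Q - P‖
    have h3 := le_max_right ‖G - P‖ ‖Q - P‖
    linarith
  have h2 : shifted φ ‖P‖ T ≤ shifted φ ‖P‖ ‖G - P‖ + shifted φ ‖P‖ ‖Q - P‖ := by
    rcases max_choice ‖G - P‖ ‖Q - P‖ with hm | hm <;> rw [hT, hm] <;> linarith
  calc shifted φ ‖Q‖ ‖G - Q‖ ≤ shifted φ ‖Q‖ (2 * T) :=
        h.shifted_mono (norm_nonneg _) (norm_nonneg _) h1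
    _ ≤ 2 ^ (growthExp c₀ + 2) * 2 ^ (growthExp c₀ + 2) * shifted φ ‖Q‖ T :=
        h.shifted_mul_le hc₀ (norm_nonneg _) (by norm_num) hT0
    _ ≤ 2 ^ (growthExp c₀ + 2) * 2 ^ (growthExp c₀ + 2) *
        (4 ^ (growthExp c₀ + 2) * shifted φ ‖P‖ T) := by
        gcongr
        exact h.shifted_le_shifted hc₀ (norm_nonneg _) (norm_nonneg _)
          (hPQ.trans (le_max_right _ _))
    _ = 16 ^ (growthExp c₀ + 2) * shifted φ ‖P‖ T := by
        rw [← mul_assoc, ← mul_pow, ← mul_pow]; norm_num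
    _ ≤ _ := by gcongr

theorem norm_V_sq_le (h : IsRegularNFunction φ c₀ c₁) (hc₀ : 0 < c₀) (Q : Mat N n) :
    ‖V φ Q‖ ^ 2 ≤ 2 ^ (growthExp c₀ + 2) * φ ‖Q‖ := by
  rw [h.norm_V_sq, mul_comm]
  exact h.mul_dphi_le hc₀ (norm_nonneg Q)

theorem continuous_dphi_norm (h : IsRegularNFunction φ c₀ c₁) :
    Continuous fun Q : Mat N n => dphi φ ‖Q‖ :=
  h.dphi_continuousOn.comp_continuous continuous_norm fun Q => norm_nonneg Q

theorem continuous_shifted_norm (h : IsRegularNFunction φ c₀ c₁) {a : ℝ} (ha : 0 ≤ a)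
    {E : Type*} [SeminormedAddCommGroup E] :
    Continuous fun Q : E => shifted φ a ‖Q‖ :=
  (h.shifted_continuousOn ha).comp_continuous continuous_norm fun Q => norm_nonneg Q

theorem continuous_phi_norm (h : IsRegularNFunction φ c₀ c₁)
    {E : Type*} [SeminormedAddCommGroup E] :
    Continuous fun Q : E => φ ‖Q‖ :=
  h.continuousOn.comp_continuous continuous_norm fun Q => norm_nonneg Q

theorem continuous_V (h : IsRegularNFunction φ c₀ c₁) :
    Continuous (V φ : Mat N n → Mat N n) := by
  rw [continuous_iff_continuousAt]
  intro Q
  have hs : Continuous fun Q : Mat N n => Real.sqrt (dphi φ ‖Q‖ * ‖Q‖) :=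
    (h.continuous_dphi_norm.mul continuous_norm).sqrt
  rcases eq_or_ne Q 0 with rfl | hQ
  · have h0 : V φ (0 : Mat N n) = 0 := by simp [V]
    rw [ContinuousAt, h0]
    refine squeeze_zero_norm (a := fun Q : Mat N n => Real.sqrt (dphi φ ‖Q‖ * ‖Q‖))
      (fun Q => ?_) ?_
    · refine Real.le_sqrt_of_sq_le ?_
      rw [h.norm_V_sq]
    · have := hs.tendsto 0
      simpa using this
  · exact (hs.continuousAt.div continuous_norm.continuousAt (norm_ne_zero_iff.2 hQ)).smul
      continuousAt_id

theorem V_eq_zero (h : IsRegularNFunction φ c₀ c₁) {Q : Mat N n} (hV : V φ Q = 0) : Q = 0 := by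
  by_contra hQ
  have h1 := h.norm_V_sq Q
  rw [hV] at h1
  have h2 := norm_pos_iff.2 hQ
  have := mul_pos (h.deriv_pos _ h2) h2
  simp at h1
  rcases h1 with h1 | h1 <;> simp_all

end IsRegularNFunction
end OrliczGrowth

/-! ### From small excess of `V(G)` to small oscillation of `G`. -/

namespace OrliczGrowth

variable {N n : ℕ} {φ : ℝ → ℝ} {c₀ c₁ : ℝ}

namespace IsRegularNFunction

variable {X : Type*} [MeasurableSpace X] {μ : Measure X}

/-- For `t ≤ a` simply `φ(t) ≤ φ(a)`; for `t ≥ a` the shift `0` may be exchanged for `a`. It lets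
`φ(|G|)` be absorbed by `φ(|Q|)` and the oscillation around `Q`. -/
theorem phi_add_le_shifted (h : IsRegularNFunction φ c₀ c₁) (hc₀ : 0 < c₀) {a t : ℝ} (ha : 0 ≤ a)
    (ht : 0 ≤ t) : φ (a + t) ≤ 16 ^ (growthExp c₀ + 2) * (2 * φ a + shifted φ a t) := by
  have h1 := h.add_le hc₀ ha ht
  have hs := h.shifted_nonneg ha ht
  have hφa := h.nonneg ha
  have hq : (1 : ℝ) ≤ 4 ^ (growthExp c₀ + 2) := one_le_pow₀ (by norm_num)
  have h2 : φ t ≤ φ a + 4 ^ (growthExp c₀ + 2) * shifted φ a t := by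
    rcases le_total t a with hta | hta
    · have := h.mono ht hta
      have h3 : 0 ≤ 4 ^ (growthExp c₀ + 2) * shifted φ a t := by positivity
      linarith
    · have := h.shifted_le_shifted hc₀ (a := 0) (b := a) (t := t) le_rfl ha
        (by rwa [zero_sub, abs_neg, abs_of_nonneg ha])
      rw [h.shifted_zero_left ht] at this
      linarith
  have e16 : (16 : ℝ) ^ (growthExp c₀ + 2) = 4 ^ (growthExp c₀ + 2) * 4 ^ (growthExp c₀ + 2) := by
    rw [← mul_pow]; norm_num
  rw [e16]
  refine h1.trans ?_
  rw [mul_assoc]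
  refine mul_le_mul_of_nonneg_left ?_ (by positivity)
  nlinarith

theorem integrable_phi_add (h : IsRegularNFunction φ c₀ c₁) (hc₀ : 0 < c₀) [IsFiniteMeasure μ]
    {E : Type*} [NormedAddCommGroup E] {G : X → E} (hG : AEStronglyMeasurable G μ)
    (hφG : Integrable (fun x => φ ‖G x‖) μ) {b : ℝ} (hb : 0 ≤ b) :
    Integrable (fun x => φ (b + ‖G x‖)) μ := by
  refine Integrable.mono' (((integrable_const (φ b)).add hφG).const_mul (4 ^ (growthExp c₀ + 2)))
    ?_ (Eventually.of_forall fun x => ?_)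
  · have : Continuous fun Q : E => φ (b + ‖Q‖) :=
      h.continuousOn.comp_continuous (by fun_prop) fun Q => mem_Ici.2 (by positivity)
    exact this.comp_aestronglyMeasurable hG
  · rw [Real.norm_of_nonneg (h.nonneg (by positivity))]
    exact h.add_le hc₀ hb (norm_nonneg _)

theorem integrable_shifted_norm_sub (h : IsRegularNFunction φ c₀ c₁) (hc₀ : 0 < c₀)
    [IsFiniteMeasure μ] {E : Type*} [NormedAddCommGroup E] {G : X → E}
    (hG : AEStronglyMeasurable G μ) (hφG : Integrable (fun x => φ ‖G x‖) μ) {a : ℝ} (ha : 0 ≤ a)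
    (P : E) : Integrable (fun x => shifted φ a ‖G x - P‖) μ := by
  refine Integrable.mono' ((h.integrable_phi_add hc₀ hG hφG
    (b := a + ‖P‖) (by positivity)).const_mul (2 ^ (growthExp c₀ + 2)))
    ((h.continuous_shifted_norm ha).comp_aestronglyMeasurable
      (hG.sub aestronglyMeasurable_const)) (Eventually.of_forall fun x => ?_)
  rw [Real.norm_of_nonneg (h.shifted_nonneg ha (norm_nonneg _))]
  refine (h.shifted_le_phi hc₀ ha (norm_nonneg _)).trans ?_
  refine mul_le_mul_of_nonneg_left (h.mono (by positivity) ?_) (by positivity)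
  have := norm_sub_le (G x) P
  linarith

theorem memLp_V (h : IsRegularNFunction φ c₀ c₁) (hc₀ : 0 < c₀)
    {G : X → Mat N n} (hG : AEStronglyMeasurable G μ) (hφG : Integrable (fun x => φ ‖G x‖) μ) :
    MemLp (fun x => V φ (G x)) 2 μ := by
  have hm : AEStronglyMeasurable (fun x => V φ (G x)) μ :=
    h.continuous_V.comp_aestronglyMeasurable hG
  rw [memLp_two_iff_integrable_sq_norm hm]
  refine Integrable.mono' (hφG.const_mul (2 ^ (growthExp c₀ + 2))) (hm.norm.pow 2)
    (Eventually.of_forall fun x => ?_)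
  rw [Real.norm_of_nonneg (by positivity)]
  exact h.norm_V_sq_le hc₀ _

theorem shifted_norm_integral_le (h : IsRegularNFunction φ c₀ c₁) [IsProbabilityMeasure μ]
    {E : Type*} [NormedAddCommGroup E] [NormedSpace ℝ E] {G : X → E} {a : ℝ} (ha : 0 ≤ a)
    (hG : Integrable G μ) (hs : Integrable (fun x => shifted φ a ‖G x‖) μ) :
    shifted φ a (∫ x, ‖G x‖ ∂μ) ≤ ∫ x, shifted φ a ‖G x‖ ∂μ :=
  (h.shifted_convexOn ha).map_integral_le (h.shifted_continuousOn ha) isClosed_Ici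
    (Eventually.of_forall fun _ => norm_nonneg _) hG.norm hs

/-- The mean of `V(G)` is replaced by a value `V(P)`, where `P = G(y)` and `y` is a point at which
`|V(G) - ⟨V(G)⟩|²` does not exceed its mean `D`. Then `φ_{|P|}(|G - P|)` has mean at most a multiple
of `D`, Jensen's inequality gives the same bound for `φ_{|P|}(|Q - P|)`, and the quasi-triangle
inequality passes from `P` to `Q`. -/
theorem integral_shifted_norm_sub_le (h : IsRegularNFunction φ c₀ c₁) (hc₀ : 0 < c₀)
    [IsProbabilityMeasure μ] {G : X → Mat N n} (hG : Integrable G μ)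
    (hφG : Integrable (fun x => φ ‖G x‖) μ) :
    ∫ x, shifted φ ‖∫ y, G y ∂μ‖ ‖G x - ∫ y, G y ∂μ‖ ∂μ ≤
      16 ^ (growthExp c₀ + 2) * (8 * (4096 * 32 ^ growthExp c₀)) *
        ∫ x, ‖V φ (G x) - ∫ y, V φ (G y) ∂μ‖ ^ 2 ∂μ := by
  set Q := ∫ y, G y ∂μ with hQ
  set W := ∫ y, V φ (G y) ∂μ with hW
  set c := 4096 * (32 : ℝ) ^ growthExp c₀ with hc
  have hV := h.memLp_V hc₀ hG.1 hφG
  have hF : Integrable (fun x => ‖V φ (G x) - W‖ ^ 2) μ :=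
    (memLp_two_iff_integrable_sq_norm (hV.sub (memLp_const W)).1).1 (hV.sub (memLp_const W))
  set D := ∫ x, ‖V φ (G x) - W‖ ^ 2 ∂μ with hD
  obtain ⟨y, hy⟩ := exists_le_integral hF
  set P := G y with hP
  have hsP : Integrable (fun x => shifted φ ‖P‖ ‖G x - P‖) μ :=
    h.integrable_shifted_norm_sub hc₀ hG.1 hφG (norm_nonneg P) P
  have h1 : ∫ x, shifted φ ‖P‖ ‖G x - P‖ ∂μ ≤ 4 * c * D := by
    have : ∫ x, shifted φ ‖P‖ ‖G x - P‖ ∂μ ≤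
        ∫ x, c * (2 * ‖V φ (G x) - W‖ ^ 2 + 2 * D) ∂μ := by
      refine integral_mono hsP
        (((hF.const_mul 2).add (integrable_const (2 * D))).const_mul c) fun x => ?_
      refine (h.shifted_norm_sub_le hc₀ P (G x)).trans
        (mul_le_mul_of_nonneg_left ?_ (by positivity))
      have h2 : ‖V φ (G x) - V φ P‖ ≤ ‖V φ (G x) - W‖ + ‖V φ P - W‖ := by
        have := norm_sub_le (V φ (G x) - W) (V φ P - W)
        rwa [sub_sub_sub_cancel_right] at this
      have h3 : ‖V φ P - W‖ ^ 2 ≤ D := hy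
      have h4 := norm_nonneg (V φ (G x) - V φ P)
      nlinarith [sq_nonneg (‖V φ (G x) - W‖ - ‖V φ P - W‖)]
    refine this.trans (le_of_eq ?_)
    rw [integral_const_mul, integral_add (hF.const_mul 2) (integrable_const _),
      integral_const_mul, ← hD]
    simp
    ring
  have h2 : shifted φ ‖P‖ ‖Q - P‖ ≤ 4 * c * D := by
    have e1 : Q - P = ∫ x, (G x - P) ∂μ := by
      rw [integral_sub hG (integrable_const P)]; simp [hQ]
    have e2 : ‖Q - P‖ ≤ ∫ x, ‖G x - P‖ ∂μ := by
      rw [e1]; exact norm_integral_le_integral_norm _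
    exact ((h.shifted_mono (norm_nonneg P) (norm_nonneg _) e2).trans
      (h.shifted_norm_integral_le (norm_nonneg P) (hG.sub (integrable_const P)) hsP)).trans h1
  have h3 : ∫ x, shifted φ ‖Q‖ ‖G x - Q‖ ∂μ ≤
      ∫ x, 16 ^ (growthExp c₀ + 2) * (shifted φ ‖P‖ ‖G x - P‖ + shifted φ ‖P‖ ‖Q - P‖) ∂μ :=
    integral_mono (h.integrable_shifted_norm_sub hc₀ hG.1 hφG (norm_nonneg Q) Q)
      ((hsP.add (integrable_const _)).const_mul _)
      fun x => h.shifted_norm_sub_triangle hc₀ P Q (G x)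
  rw [integral_const_mul, integral_add hsP (integrable_const _), integral_const] at h3
  simp only [probReal_univ, smul_eq_mul, one_mul] at h3
  calc _ ≤ _ := h3
    _ ≤ 16 ^ (growthExp c₀ + 2) * (4 * c * D + 4 * c * D) := by gcongr
    _ = _ := by ring

/-- If the excess of `V(G)` is small compared to `⨍ |V(G)|²`, then the oscillation of `G` around its
mean value `Q` is small compared to `φ(|Q|)`. -/
theorem small_excess (h : IsRegularNFunction φ c₀ c₁) (hc₀ : 0 < c₀)
    [IsProbabilityMeasure μ] {G : X → Mat N n} (hG : Integrable G μ)
    (hφG : Integrable (fun x => φ ‖G x‖) μ) {A δ : ℝ} (hδ0 : 0 ≤ δ)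
    (hA : A = 512 ^ (growthExp c₀ + 2) * (16 * (4096 * 32 ^ growthExp c₀)))
    (hδ : 32 ^ (growthExp c₀ + 2) * A * δ ≤ 1)
    (hexc : ∫ x, ‖V φ (G x) - ∫ y, V φ (G y) ∂μ‖ ^ 2 ∂μ ≤ δ * ∫ x, ‖V φ (G x)‖ ^ 2 ∂μ) :
    ∫ x, ‖V φ (G x)‖ ^ 2 ∂μ ≤ 4 * 32 ^ (growthExp c₀ + 2) * φ ‖∫ y, G y ∂μ‖ ∧
      ∫ x, shifted φ ‖∫ y, G y ∂μ‖ ‖G x - ∫ y, G y ∂μ‖ ∂μ ≤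
        4 * 32 ^ (growthExp c₀ + 2) * A * δ * φ ‖∫ y, G y ∂μ‖ := by
  have hosc := h.integral_shifted_norm_sub_le hc₀ hG hφG
  set Q := ∫ y, G y ∂μ with hQ
  set D := ∫ x, ‖V φ (G x) - ∫ y, V φ (G y) ∂μ‖ ^ 2 ∂μ with hD
  set S := ∫ x, ‖V φ (G x)‖ ^ 2 ∂μ with hS
  set I := ∫ x, shifted φ ‖Q‖ ‖G x - Q‖ ∂μ with hI
  have hS0 : 0 ≤ S := integral_nonneg fun x => by positivity
  have hD0 : 0 ≤ D := integral_nonneg fun x => by positivity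
  have hφQ := h.nonneg (norm_nonneg Q)
  have hsQ := h.integrable_shifted_norm_sub hc₀ hG.1 hφG (norm_nonneg Q) Q
  set q := (32 : ℝ) ^ (growthExp c₀ + 2) with hq
  have hq0 : 0 < q := by positivity
  have hA0 : 0 ≤ A := by rw [hA]; positivity
  have hIA : 2 * I ≤ A * (δ * S) := by
    have h1 : 16 ^ (growthExp c₀ + 2) * (8 * (4096 * (32 : ℝ) ^ growthExp c₀)) * 2 ≤ A := by
      rw [hA, mul_assoc]
      refine mul_le_mul (pow_le_pow_left₀ (by norm_num) (by norm_num) _) ?_ (by positivity)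
        (by positivity)
      linarith
    calc 2 * I ≤ 2 * (16 ^ (growthExp c₀ + 2) * (8 * (4096 * (32 : ℝ) ^ growthExp c₀)) * D) := by
          linarith
      _ = 16 ^ (growthExp c₀ + 2) * (8 * (4096 * (32 : ℝ) ^ growthExp c₀)) * 2 * D := by ring
      _ ≤ A * D := mul_le_mul_of_nonneg_right h1 hD0
      _ ≤ _ := mul_le_mul_of_nonneg_left hexc hA0
  -- Here `|V(G)|² ≤ C φ(|G|)`, and `φ(|G|)` is split into a part at `|Q|` and the oscillation
  -- around `Q`.
  have hSI : S ≤ q * (2 * φ ‖Q‖ + I) := by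
    have h1 : S ≤ ∫ x, q * (2 * φ ‖Q‖ + shifted φ ‖Q‖ ‖G x - Q‖) ∂μ := by
      refine integral_mono ((memLp_two_iff_integrable_sq_norm (h.memLp_V hc₀ hG.1 hφG).1).1
        (h.memLp_V hc₀ hG.1 hφG)) (((integrable_const _).add hsQ).const_mul q) fun x => ?_
      have h2 : ‖G x‖ ≤ ‖Q‖ + ‖G x - Q‖ := by
        have := norm_add_le Q (G x - Q)
        rwa [add_sub_cancel] at this
      calc ‖V φ (G x)‖ ^ 2 ≤ 2 ^ (growthExp c₀ + 2) * φ ‖G x‖ := h.norm_V_sq_le hc₀ _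
        _ ≤ 2 ^ (growthExp c₀ + 2) * (16 ^ (growthExp c₀ + 2) *
            (2 * φ ‖Q‖ + shifted φ ‖Q‖ ‖G x - Q‖)) := by
            gcongr
            exact (h.mono (norm_nonneg _) h2).trans
              (h.phi_add_le_shifted hc₀ (norm_nonneg _) (norm_nonneg _))
        _ = q * (2 * φ ‖Q‖ + shifted φ ‖Q‖ ‖G x - Q‖) := by
            rw [← mul_assoc, ← mul_pow, hq]; norm_num
    refine h1.trans (le_of_eq ?_)
    rw [integral_const_mul, integral_add (integrable_const _) hsQ, integral_const]
    simp [hI]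
  -- The smallness of `δ` gives `qI ≤ S/2`, so that `S ≤ 2qφ(|Q|) + qI` can be solved for `S`.
  have h3 : 2 * (q * I) ≤ S := by
    calc 2 * (q * I) = q * (2 * I) := by ring
      _ ≤ q * (A * (δ * S)) := mul_le_mul_of_nonneg_left hIA hq0.le
      _ = q * A * δ * S := by ring
      _ ≤ 1 * S := mul_le_mul_of_nonneg_right hδ hS0
      _ = S := one_mul S
  have h4 : S ≤ 4 * q * φ ‖Q‖ := by linarith
  refine ⟨h4, ?_⟩
  have hI0 : 0 ≤ I := integral_nonneg fun x => h.shifted_nonneg (norm_nonneg _) (norm_nonneg _)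
  calc I ≤ 2 * I := by linarith
    _ ≤ A * (δ * S) := hIA
    _ ≤ A * (δ * (4 * q * φ ‖Q‖)) := by gcongr
    _ = _ := by ring

end IsRegularNFunction
end OrliczGrowth

/-! ### Smooth approximation of vector fields with weak gradient. -/

namespace OrliczGrowth

open scoped Convolution

variable {N n : ℕ} {φ : ℝ → ℝ} {c₀ c₁ : ℝ}

/-! ### Gradients -/

theorem grad_apply (w : Vec n → Vec N) (x : Vec n) (i : Fin N) (j : Fin n) :
    grad w x (i, j) = fderiv ℝ w x (EuclideanSpace.single j 1) i := rfl

/-- The linear map sending a derivative to the matrix of its partial derivatives. -/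
noncomputable def toMat (N n : ℕ) : (Vec n →L[ℝ] Vec N) →L[ℝ] Mat N n :=
  LinearMap.toContinuousLinearMap
    { toFun := fun T => WithLp.toLp 2 fun p => T (EuclideanSpace.single p.2 1) p.1
      map_add' := fun S T => by ext p; simp
      map_smul' := fun c T => by ext p; simp }

theorem toMat_apply (T : Vec n →L[ℝ] Vec N) (i : Fin N) (j : Fin n) :
    toMat N n T (i, j) = T (EuclideanSpace.single j 1) i := rfl

theorem grad_eq_toMat (w : Vec n → Vec N) (x : Vec n) : grad w x = toMat N n (fderiv ℝ w x) := rfl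

/-- Cauchy–Schwarz in each row: the operator norm is at most the Euclidean norm of the matrix. -/
theorem norm_apply_le_norm_toMat (T : Vec n →L[ℝ] Vec N) (y : Vec n) :
    ‖T y‖ ≤ ‖toMat N n T‖ * ‖y‖ := by
  have h1 : ∀ i, T y i = ∑ j, toMat N n T (i, j) * y j := by
    intro i
    have hy : y = ∑ j, y j • EuclideanSpace.single j (1 : ℝ) := by
      ext k
      simp [Pi.single_apply]
    conv_lhs => rw [hy]
    simp only [map_sum, map_smul, toMat_apply]
    simp [mul_comm]
  refine le_of_sq_le_sq ?_ (by positivity)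
  rw [mul_pow, EuclideanSpace.norm_sq_eq, EuclideanSpace.norm_sq_eq, EuclideanSpace.norm_sq_eq,
    Fintype.sum_prod_type, Finset.sum_mul]
  refine Finset.sum_le_sum fun i _ => ?_
  rw [h1]
  simp only [Real.norm_eq_abs, sq_abs]
  exact Finset.sum_mul_sq_le_sq_mul_sq _ _ _

theorem norm_fderiv_apply_le (w : Vec n → Vec N) (x y : Vec n) :
    ‖fderiv ℝ w x y‖ ≤ ‖grad w x‖ * ‖y‖ :=
  norm_apply_le_norm_toMat _ _

theorem continuous_grad {w : Vec n → Vec N} (hw : ContDiff ℝ 1 w) : Continuous (grad w) :=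
  (toMat N n).continuous.comp (hw.continuous_fderiv (by norm_num))

/-! ### Jensen's inequality -/

namespace IsRegularNFunction

/-- In this form Jensen's inequality needs no integrability: if `g` is not integrable, the left-hand
side is `φ_a(0) = 0`; if `φ_a(|g|)` is not, the right-hand side is infinite. -/
theorem ofReal_shifted_integral_le (h : IsRegularNFunction φ c₀ c₁) {a : ℝ} (ha : 0 ≤ a)
    {S : Type*} [MeasurableSpace S] {μ : Measure S} [IsProbabilityMeasure μ]
    {E : Type*} [NormedAddCommGroup E] [NormedSpace ℝ E] {g : S → E}
    (hg : AEStronglyMeasurable g μ) :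
    ENNReal.ofReal (shifted φ a (∫ o, ‖g o‖ ∂μ)) ≤
      ∫⁻ o, ENNReal.ofReal (shifted φ a ‖g o‖) ∂μ := by
  by_cases hi : Integrable g μ
  · by_cases hs : Integrable (fun o => shifted φ a ‖g o‖) μ
    · rw [← ofReal_integral_eq_lintegral_ofReal hs
        (Eventually.of_forall fun _ => h.shifted_nonneg ha (norm_nonneg _))]
      exact ENNReal.ofReal_le_ofReal (h.shifted_norm_integral_le ha hi hs)
    · have hm : AEStronglyMeasurable (fun o => shifted φ a ‖g o‖) μ :=
        (h.continuous_shifted_norm ha).comp_aestronglyMeasurable hg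
      have : ∫⁻ o, ENNReal.ofReal (shifted φ a ‖g o‖) ∂μ = ⊤ := by
        by_contra hne
        refine hs ⟨hm, ?_⟩
        rw [hasFiniteIntegral_iff_ofReal
          (Eventually.of_forall fun _ => h.shifted_nonneg ha (norm_nonneg _))]
        exact lt_top_iff_ne_top.2 hne
      rw [this]; exact le_top
  · rw [integral_undef (by rwa [integrable_norm_iff hg]), shifted_zero]
    simp

theorem measurable_ofReal_shifted_norm (h : IsRegularNFunction φ c₀ c₁) {a : ℝ} (ha : 0 ≤ a)
    {S : Type*} [MeasurableSpace S] {E : Type*} [NormedAddCommGroup E] {g : S → E}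
    (hg : StronglyMeasurable g) : Measurable fun o => ENNReal.ofReal (shifted φ a ‖g o‖) :=
  ((h.continuous_shifted_norm ha).comp_stronglyMeasurable hg).measurable.ennreal_ofReal

theorem lintegral_ball_sub_le (F : Vec n → ℝ≥0∞) (x₀ v : Vec n) {t κ : ℝ} (hv : ‖v‖ ≤ κ) :
    ∫⁻ x in Metric.ball x₀ t, F (x - v) ≤ ∫⁻ x in Metric.ball x₀ (t + κ), F x := by
  rw [← lintegral_indicator Metric.isOpen_ball.measurableSet,
    ← lintegral_indicator Metric.isOpen_ball.measurableSet,
    ← lintegral_sub_right_eq_self ((Metric.ball x₀ (t + κ)).indicator F) v]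
  refine lintegral_mono fun x => ?_
  by_cases hx : x ∈ Metric.ball x₀ t
  swap
  · rw [indicator_of_notMem hx]; exact zero_le
  rw [indicator_of_mem hx, indicator_of_mem]
  rw [Metric.mem_ball, dist_eq_norm] at hx ⊢
  calc ‖x - v - x₀‖ = ‖(x - x₀) - v‖ := by congr 1; abel
    _ ≤ ‖x - x₀‖ + ‖v‖ := norm_sub_le _ _
    _ < t + κ := by linarith

/-- Averages of translates: Jensen's inequality and Tonelli's theorem. -/
theorem lintegral_shifted_average_le (h : IsRegularNFunction φ c₀ c₁) {a : ℝ} (ha : 0 ≤ a)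
    {S : Type*} [MeasurableSpace S] {μ : Measure S} [IsProbabilityMeasure μ]
    {E : Type*} [NormedAddCommGroup E] [NormedSpace ℝ E] {G : Vec n → E}
    (hG : StronglyMeasurable G) {T : S → Vec n} (hT : Measurable T) {κ : ℝ}
    (hκ : ∀ᵐ o ∂μ, ‖T o‖ ≤ κ) (x₀ : Vec n) (t : ℝ) :
    ∫⁻ x in Metric.ball x₀ t, ENNReal.ofReal (shifted φ a (∫ o, ‖G (x - T o)‖ ∂μ)) ≤
      ∫⁻ x in Metric.ball x₀ (t + κ), ENNReal.ofReal (shifted φ a ‖G x‖) := by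
  have hm : Measurable fun p : Vec n × S => p.1 - T p.2 :=
    measurable_fst.sub (hT.comp measurable_snd)
  calc _ ≤ ∫⁻ x in Metric.ball x₀ t, ∫⁻ o, ENNReal.ofReal (shifted φ a ‖G (x - T o)‖) ∂μ :=
        lintegral_mono fun x => h.ofReal_shifted_integral_le ha
          (hG.comp_measurable (measurable_const.sub hT)).aestronglyMeasurable
    _ = ∫⁻ o, (∫⁻ x in Metric.ball x₀ t, ENNReal.ofReal (shifted φ a ‖G (x - T o)‖)) ∂μ :=
        lintegral_lintegral_swap
          (h.measurable_ofReal_shifted_norm ha (hG.comp_measurable hm)).aemeasurable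
    _ ≤ ∫⁻ _, (∫⁻ x in Metric.ball x₀ (t + κ), ENNReal.ofReal (shifted φ a ‖G x‖)) ∂μ :=
        lintegral_mono_ae (hκ.mono fun o ho =>
          lintegral_ball_sub_le (fun x => ENNReal.ofReal (shifted φ a ‖G x‖)) x₀ (T o) ho)
    _ = _ := by simp

/-- Difference quotients of a `C¹` function. -/
theorem lintegral_shifted_sub_translate_le (h : IsRegularNFunction φ c₀ c₁) {a : ℝ} (ha : 0 ≤ a)
    {w : Vec n → Vec N} (hw : ContDiff ℝ 1 w) {κ : ℝ} (hκ : 0 < κ) {y : Vec n} (hy : ‖y‖ ≤ κ)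
    (x₀ : Vec n) (t : ℝ) :
    ∫⁻ x in Metric.ball x₀ t, ENNReal.ofReal (shifted φ a (‖w x - w (x - y)‖ / κ)) ≤
      ∫⁻ x in Metric.ball x₀ (t + κ), ENNReal.ofReal (shifted φ a ‖grad w x‖) := by
  have : IsProbabilityMeasure (volume.restrict (Ioc (0 : ℝ) 1)) := ⟨by simp⟩
  have hgc := continuous_grad hw
  -- By the fundamental theorem of calculus, `|w(x) - w(x - y)| / κ` is at most the average over `s
  -- ∈ (0, 1]` of `|∇w(x - sy)|`, an average of translates by vectors of length at most `κ`.
  refine le_trans (lintegral_mono fun x => ENNReal.ofReal_le_ofReal ?_)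
    (h.lintegral_shifted_average_le ha (μ := volume.restrict (Ioc (0 : ℝ) 1))
      (G := grad w) hgc.stronglyMeasurable (T := fun s : ℝ => s • y) (by fun_prop) (κ := κ) ?_ x₀ t)
  · refine h.shifted_mono ha (by positivity) ?_
    rw [div_le_iff₀ hκ]
    have hd : ∀ s : ℝ, HasDerivAt (fun s : ℝ => w (x - s • y)) (fderiv ℝ w (x - s • y) (-y)) s := by
      intro s
      have h2 : HasDerivAt (fun s : ℝ => x - s • y) (-y) s := by
        simpa using ((hasDerivAt_id s).smul_const y).const_sub x
      exact ((hw.differentiable (by norm_num)) _).hasFDerivAt.comp_hasDerivAt s h2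
    have hc : Continuous fun s : ℝ => fderiv ℝ w (x - s • y) (-y) :=
      ((hw.continuous_fderiv (by norm_num)).comp (by fun_prop)).clm_apply continuous_const
    have h3 := intervalIntegral.integral_eq_sub_of_hasDerivAt (a := 0) (b := 1)
      (fun s _ => hd s) (hc.intervalIntegrable _ _)
    simp only [one_smul, zero_smul, sub_zero] at h3
    rw [norm_sub_rev, ← h3, intervalIntegral.integral_of_le zero_le_one]
    calc ‖∫ s in Ioc (0 : ℝ) 1, fderiv ℝ w (x - s • y) (-y)‖
        ≤ ∫ s in Ioc (0 : ℝ) 1, ‖grad w (x - s • y)‖ * κ := by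
          have hcg : Continuous fun s : ℝ => ‖grad w (x - s • y)‖ * κ :=
            (hgc.comp (by fun_prop)).norm.mul continuous_const
          refine norm_integral_le_of_norm_le
            ((hcg.integrableOn_Icc (a := 0) (b := 1)).mono_set Ioc_subset_Icc_self)
            (Eventually.of_forall fun s => ?_)
          refine (norm_fderiv_apply_le w _ _).trans ?_
          rw [norm_neg]
          gcongr
      _ = (∫ s in Ioc (0 : ℝ) 1, ‖grad w (x - s • y)‖) * κ := integral_mul_const _ _
  · filter_upwards [ae_restrict_mem measurableSet_Ioc] with s hs
    rw [norm_smul, Real.norm_of_nonneg hs.1.le]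
    nlinarith [norm_nonneg y, hs.2]

end IsRegularNFunction

/-! ### Mollification -/

/-- Convolution with a normalized bump function. -/
noncomputable def mollify {E : Type*} [NormedAddCommGroup E] [NormedSpace ℝ E]
    (ψ : ContDiffBump (0 : Vec n)) (g : Vec n → E) : Vec n → E :=
  ψ.normed volume ⋆[ContinuousLinearMap.lsmul ℝ ℝ, volume] g

section Mollify

variable {E : Type*} [NormedAddCommGroup E] [NormedSpace ℝ E]

theorem mollify_apply (ψ : ContDiffBump (0 : Vec n)) (g : Vec n → E) (x : Vec n) :
    mollify ψ g x = ∫ y, ψ.normed volume y • g (x - y) := rfl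

theorem mollify_apply' (ψ : ContDiffBump (0 : Vec n)) (g : Vec n → E) (x : Vec n) :
    mollify ψ g x = ∫ y, ψ.normed volume (x - y) • g y := by
  rw [mollify_apply, ← integral_sub_left_eq_self _ _ x]
  simp

/-- The probability measure with density `ψ.normed`. -/
noncomputable def bumpMeasure (ψ : ContDiffBump (0 : Vec n)) : Measure (Vec n) :=
  volume.withDensity fun y => ENNReal.ofReal (ψ.normed volume y)

instance (ψ : ContDiffBump (0 : Vec n)) : IsProbabilityMeasure (bumpMeasure ψ) := by
  refine ⟨?_⟩
  rw [bumpMeasure, withDensity_apply _ MeasurableSet.univ, Measure.restrict_univ,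
    ← ofReal_integral_eq_lintegral_ofReal ψ.integrable_normed
      (Eventually.of_forall fun y => ψ.nonneg_normed y), ψ.integral_normed, ENNReal.ofReal_one]

theorem integral_bumpMeasure (ψ : ContDiffBump (0 : Vec n)) (g : Vec n → E) :
    ∫ y, g y ∂(bumpMeasure ψ) = ∫ y, ψ.normed volume y • g y := by
  rw [bumpMeasure, integral_withDensity_eq_integral_toReal_smul
    ψ.continuous_normed.measurable.ennreal_ofReal (Eventually.of_forall fun y => by simp)]
  simp only [ENNReal.toReal_ofReal (ψ.nonneg_normed _)]

theorem ae_bumpMeasure_norm_le (ψ : ContDiffBump (0 : Vec n)) :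
    ∀ᵐ y ∂(bumpMeasure ψ), ‖y‖ ≤ ψ.rOut := by
  rw [bumpMeasure, ae_withDensity_iff ψ.continuous_normed.measurable.ennreal_ofReal]
  refine Eventually.of_forall fun y hy => ?_
  have : y ∈ Function.support (ψ.normed volume) := fun h0 => hy (by simp [h0])
  rw [ψ.support_normed_eq] at this
  exact (mem_ball_zero_iff.1 this).le

theorem mollify_eq_integral_bumpMeasure (ψ : ContDiffBump (0 : Vec n)) (g : Vec n → E)
    (x : Vec n) : mollify ψ g x = ∫ y, g (x - y) ∂(bumpMeasure ψ) := by
  rw [integral_bumpMeasure, mollify_apply]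

theorem norm_mollify_le (ψ : ContDiffBump (0 : Vec n)) (g : Vec n → E) (x : Vec n) :
    ‖mollify ψ g x‖ ≤ ∫ y, ‖g (x - y)‖ ∂(bumpMeasure ψ) := by
  rw [mollify_eq_integral_bumpMeasure]
  exact norm_integral_le_integral_norm _

/-- The kernel is bounded by the inverse volume of its inner ball. Applied to a gradient, this is
where the `L¹` mean enters the reverse Hölder inequality. -/
theorem norm_mollify_le_setIntegral (ψ : ContDiffBump (0 : Vec n)) {g : Vec n → E} {x : Vec n}
    {A : Set (Vec n)} (hA : Metric.ball x ψ.rOut ⊆ A) (hAm : MeasurableSet A)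
    (hg : IntegrableOn g A) :
    ‖mollify ψ g x‖ ≤ (volume.real (Metric.closedBall (0 : Vec n) ψ.rIn))⁻¹ * ∫ y in A, ‖g y‖ := by
  rw [mollify_apply', ← integral_const_mul, ← integral_indicator hAm]
  refine norm_integral_le_of_norm_le ((integrable_indicator_iff hAm).2 (hg.norm.const_mul _))
    (Eventually.of_forall fun y => ?_)
  by_cases hy : y ∈ A
  · rw [indicator_of_mem hy, norm_smul, Real.norm_of_nonneg (ψ.nonneg_normed _)]
    refine mul_le_mul_of_nonneg_right ?_ (norm_nonneg _)
    rw [← one_div]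
    exact ψ.normed_le_div_measure_closedBall_rIn volume _
  · rw [indicator_of_notMem hy]
    have : x - y ∉ Function.support (ψ.normed volume) := by
      rw [ψ.support_normed_eq]
      intro h
      refine hy (hA ?_)
      rw [Metric.mem_ball, dist_eq_norm] at h ⊢
      rwa [sub_zero, norm_sub_rev] at h
    rw [Function.notMem_support.1 this]
    simp

theorem contDiff_mollify (ψ : ContDiffBump (0 : Vec n)) [CompleteSpace E] {g : Vec n → E}
    (hg : LocallyIntegrable g) : ContDiff ℝ ∞ (mollify ψ g) :=
  ψ.hasCompactSupport_normed.contDiff_convolution_left _ ψ.contDiff_normed hg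

/-- A sequence of mollifiers. -/
noncomputable def bumpSeq (n : ℕ) (κ : ℝ) (hκ : 0 < κ) (i : ℕ) : ContDiffBump (0 : Vec n) where
  rIn := κ / 2 / (i + 1)
  rOut := κ / (i + 1)
  rIn_pos := by positivity
  rIn_lt_rOut := by gcongr; linarith

theorem bumpSeq_rOut_le (n : ℕ) {κ : ℝ} (hκ : 0 < κ) (i : ℕ) : (bumpSeq n κ hκ i).rOut ≤ κ :=
  div_le_self hκ.le (by simp)

theorem ae_tendsto_mollify [CompleteSpace E] {κ : ℝ} (hκ : 0 < κ) {g : Vec n → E}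
    (hg : LocallyIntegrable g) :
    ∀ᵐ x, Tendsto (fun i => mollify (bumpSeq n κ hκ i) g x) atTop (𝓝 (g x)) := by
  refine ContDiffBump.ae_convolution_tendsto_right_of_locallyIntegrable (K := 2) ?_ ?_ hg
  · have h := (tendsto_one_div_add_atTop_nhds_zero_nat (𝕜 := ℝ)).const_mul κ
    rw [mul_zero] at h
    exact h.congr fun i => mul_one_div _ _
  · refine Eventually.of_forall fun i => le_of_eq ?_
    show κ / (i + 1) = 2 * (κ / 2 / (i + 1))
    ring

end Mollify

/-! ### Weak gradients and mollification -/

namespace HasWeakGradient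

variable {v : Vec n → Vec N} {H : Vec n → Mat N n}

/-- The derivative falls on the kernel, and `y ↦ ψ(x - y)` is a test function for the weak gradient.
The sign from differentiating `x - y` cancels the one in the weak formulation. -/
theorem grad_mollify (hv : HasWeakGradient univ v H) (ψ : ContDiffBump (0 : Vec n)) :
    grad (mollify ψ v) = mollify ψ H := by
  have hvl : LocallyIntegrable v := locallyIntegrableOn_univ.1 hv.locInt
  have hHl : LocallyIntegrable H := locallyIntegrableOn_univ.1 hv.locInt_grad
  have hψ : ContDiff ℝ ∞ (ψ.normed volume) := ψ.contDiff_normed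
  have hψ1 : ContDiff ℝ 1 (ψ.normed volume) := ψ.contDiff_normed
  ext x p
  obtain ⟨i, j⟩ := p
  have h1 := ψ.hasCompactSupport_normed.hasFDerivAt_convolution_left (μ := volume)
    (ContinuousLinearMap.lsmul ℝ ℝ) hψ1 hvl x
  rw [grad_apply]
  have h2 : fderiv ℝ (mollify ψ v) x = _ := h1.fderiv
  rw [h2]
  set e := EuclideanSpace.single j (1 : ℝ)
  have hex := (ψ.hasCompactSupport_normed (μ := volume)).fderiv (𝕜 := ℝ) |>.convolutionExists_left
    ((ContinuousLinearMap.lsmul ℝ ℝ).precompL (Vec n)) (hψ1.continuous_fderiv (by norm_num)) hvl x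
  have hex2 := (ψ.hasCompactSupport_normed (μ := volume)).convolutionExists_left
    (ContinuousLinearMap.lsmul ℝ ℝ : ℝ →L[ℝ] Mat N n →L[ℝ] Mat N n) ψ.continuous_normed hHl x
  have e1 : ((fderiv ℝ (ψ.normed volume) ⋆[(ContinuousLinearMap.lsmul ℝ ℝ).precompL (Vec n),
      volume] v) x) e i = ∫ y, fderiv ℝ (ψ.normed volume) y e * v (x - y) i := by
    set ℓ : (Vec n →L[ℝ] Vec N) →L[ℝ] ℝ :=
      (EuclideanSpace.proj i).comp (ContinuousLinearMap.apply ℝ (Vec N) e)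
    have := ℓ.integral_comp_comm hex
    rw [convolution_def]
    exact this.symm
  have e2 : mollify ψ H x (i, j) = ∫ y, ψ.normed volume y * H (x - y) (i, j) := by
    have := (EuclideanSpace.proj (i, j) : Mat N n →L[ℝ] ℝ).integral_comp_comm
      hex2
    exact this.symm
  have e3 : ∫ y, fderiv ℝ (ψ.normed volume) y e * v (x - y) i =
      ∫ y, fderiv ℝ (ψ.normed volume) (x - y) e * v y i := by
    rw [← integral_sub_left_eq_self _ _ x]
    refine integral_congr_ae (Eventually.of_forall fun y => ?_)
    change _ * v (x - (x - y)) i = _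
    rw [sub_sub_cancel]
  have e4 : ∫ y, ψ.normed volume y * H (x - y) (i, j) =
      ∫ y, ψ.normed volume (x - y) * H y (i, j) := by
    rw [← integral_sub_left_eq_self _ _ x]
    refine integral_congr_ae (Eventually.of_forall fun y => ?_)
    change _ * H (x - (x - y)) (i, j) = _
    rw [sub_sub_cancel]
  rw [e1, e2, e3, e4]
  have hη : ContDiff ℝ ∞ fun y => ψ.normed volume (x - y) := hψ.comp (by fun_prop)
  have hηc : HasCompactSupport fun y => ψ.normed volume (x - y) :=
    (ψ.hasCompactSupport_normed (μ := volume)).comp_homeomorph (Homeomorph.subLeft x)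
  have h3 := hv.weak _ hη hηc (subset_univ _) i j
  rw [setIntegral_univ, setIntegral_univ] at h3
  have h4 : ∀ y, fderiv ℝ (fun y => ψ.normed volume (x - y)) y (EuclideanSpace.single j 1) =
      - fderiv ℝ (ψ.normed volume) (x - y) e := by
    intro y
    have h5 : HasFDerivAt (fun y : Vec n => x - y) (-ContinuousLinearMap.id ℝ (Vec n)) y := by
      simpa using (hasFDerivAt_id y).const_sub x
    have h6 := ((hψ1.differentiable (by norm_num)) (x - y)).hasFDerivAt.comp y h5
    have h7 : fderiv ℝ (fun y => ψ.normed volume (x - y)) y = _ := h6.fderiv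
    rw [h7]
    simp [e]
  simp only [h4, mul_neg, integral_neg] at h3
  rw [neg_inj] at h3
  simpa [mul_comm] using h3

end HasWeakGradient
end OrliczGrowth

/-! ### Modular estimates for mollified Sobolev functions. -/

namespace OrliczGrowth

open scoped Convolution

variable {N n : ℕ} {φ : ℝ → ℝ} {c₀ c₁ : ℝ}

section Mollify
variable {E : Type*} [NormedAddCommGroup E] [NormedSpace ℝ E]

theorem integrable_comp_sub_bumpMeasure (ψ : ContDiffBump (0 : Vec n)) {g : Vec n → E}
    (hg : LocallyIntegrable g) (x : Vec n) : Integrable (fun y => g (x - y)) (bumpMeasure ψ) := by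
  rw [bumpMeasure, integrable_withDensity_iff_integrable_smul'
    ψ.continuous_normed.measurable.ennreal_ofReal (Eventually.of_forall fun y => by simp)]
  simp only [ENNReal.toReal_ofReal (ψ.nonneg_normed _)]
  exact (ψ.hasCompactSupport_normed (μ := volume)).convolutionExists_left
    (ContinuousLinearMap.lsmul ℝ ℝ) ψ.continuous_normed hg x

theorem mollify_eq_zero (ψ : ContDiffBump (0 : Vec n)) {g : Vec n → E} {x₀ : Vec n} {s κ : ℝ}
    (hg : ∀ x, x ∉ Metric.closedBall x₀ s → g x = 0) (hκ : ψ.rOut ≤ κ) {x : Vec n}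
    (hx : x ∉ Metric.closedBall x₀ (s + κ)) : mollify ψ g x = 0 := by
  rw [mollify_eq_integral_bumpMeasure]
  refine integral_eq_zero_of_ae ((ae_bumpMeasure_norm_le ψ).mono fun y hy => hg _ fun h => hx ?_)
  rw [Metric.mem_closedBall, dist_eq_norm] at h ⊢
  calc ‖x - x₀‖ = ‖(x - y - x₀) + y‖ := by congr 1; abel
    _ ≤ ‖x - y - x₀‖ + ‖y‖ := norm_add_le _ _
    _ ≤ s + κ := by linarith

end Mollify

namespace IsRegularNFunction

theorem lintegral_shifted_mollify_le (h : IsRegularNFunction φ c₀ c₁) {a : ℝ} (ha : 0 ≤ a)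
    {E : Type*} [NormedAddCommGroup E] [NormedSpace ℝ E] {G : Vec n → E}
    (hG : StronglyMeasurable G) (ψ : ContDiffBump (0 : Vec n)) {κ : ℝ} (hκ : ψ.rOut ≤ κ)
    (x₀ : Vec n) (t : ℝ) :
    ∫⁻ x in Metric.ball x₀ t, ENNReal.ofReal (shifted φ a ‖mollify ψ G x‖) ≤
      ∫⁻ x in Metric.ball x₀ (t + κ), ENNReal.ofReal (shifted φ a ‖G x‖) :=
  (lintegral_mono fun x => ENNReal.ofReal_le_ofReal
    (h.shifted_mono ha (norm_nonneg _) (norm_mollify_le ψ G x))).trans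
    (h.lintegral_shifted_average_le ha (μ := bumpMeasure ψ) hG (T := id) measurable_id
      ((ae_bumpMeasure_norm_le ψ).mono fun _ hy => hy.trans hκ) x₀ t)

/-- Difference quotients of a Sobolev function. -/
theorem lintegral_shifted_weak_sub_translate_le (h : IsRegularNFunction φ c₀ c₁) {a : ℝ}
    (ha : 0 ≤ a) {v : Vec n → Vec N} {H : Vec n → Mat N n} (hv : HasWeakGradient univ v H)
    (hH : StronglyMeasurable H) {κ : ℝ} (hκ : 0 < κ) {y : Vec n} (hy : ‖y‖ ≤ κ)
    (x₀ : Vec n) (t : ℝ) :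
    ∫⁻ x in Metric.ball x₀ t, ENNReal.ofReal (shifted φ a (‖v x - v (x - y)‖ / κ)) ≤
      ∫⁻ x in Metric.ball x₀ (t + 2 * κ), ENNReal.ofReal (shifted φ a ‖H x‖) := by
  have hvl : LocallyIntegrable v := locallyIntegrableOn_univ.1 hv.locInt
  have hsm : ∀ i, ContDiff ℝ 1 (mollify (bumpSeq n κ hκ i) v) := fun i =>
    (contDiff_mollify _ hvl).of_le (by exact_mod_cast le_top)
  set F : ℕ → Vec n → ℝ≥0∞ := fun i x => ENNReal.ofReal (shifted φ a
    (‖mollify (bumpSeq n κ hκ i) v x - mollify (bumpSeq n κ hκ i) v (x - y)‖ / κ)) with hF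
  have hnorm : ∀ z : Vec N, ‖z‖ / κ = ‖κ⁻¹ • z‖ := fun z => by
    rw [norm_smul, Real.norm_of_nonneg (by positivity), div_eq_inv_mul]
  have hcont : Continuous fun z : Vec N => ENNReal.ofReal (shifted φ a (‖z‖ / κ)) := by
    simp_rw [hnorm]
    exact ENNReal.continuous_ofReal.comp ((h.continuous_shifted_norm ha).comp
      (continuous_const_smul κ⁻¹))
  have hFm : ∀ i, Measurable (F i) := fun i =>
    (hcont.comp ((hsm i).continuous.sub
      ((hsm i).continuous.comp (continuous_id.sub continuous_const)))).measurable
  have h1 : ∀ᵐ x, Tendsto (fun i => mollify (bumpSeq n κ hκ i) v x) atTop (𝓝 (v x)) :=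
    ae_tendsto_mollify hκ hvl
  have h2 : ∀ᵐ x, Tendsto (fun i => mollify (bumpSeq n κ hκ i) v (x - y)) atTop
      (𝓝 (v (x - y))) :=
    (measurePreserving_sub_right volume y).quasiMeasurePreserving.ae h1
  have hlim : ∀ᵐ x, ENNReal.ofReal (shifted φ a (‖v x - v (x - y)‖ / κ)) =
      liminf (fun i => F i x) atTop := by
    filter_upwards [h1, h2] with x hx1 hx2
    exact (((hcont.tendsto _).comp (hx1.sub hx2)).liminf_eq).symm
  -- Fatou's lemma along the mollifications. The radius grows by `κ` for the translation and by
  -- another `κ` for the mollification.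
  rw [lintegral_congr_ae (ae_restrict_of_ae hlim)]
  refine (lintegral_liminf_le hFm).trans (liminf_le_of_frequently_le' (Eventually.frequently
    (Eventually.of_forall fun i => ?_)))
  refine (h.lintegral_shifted_sub_translate_le ha (hsm i) hκ hy x₀ t).trans ?_
  rw [hv.grad_mollify]
  refine (h.lintegral_shifted_mollify_le ha hH _ (bumpSeq_rOut_le n hκ i) x₀ _).trans
    (le_of_eq ?_)
  rw [add_assoc, two_mul]

/-- Distance of a Sobolev function to its mollification. -/
theorem lintegral_shifted_sub_mollify_le (h : IsRegularNFunction φ c₀ c₁) {a : ℝ} (ha : 0 ≤ a)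
    {v : Vec n → Vec N} {H : Vec n → Mat N n} (hv : HasWeakGradient univ v H)
    (hvm : StronglyMeasurable v) (hH : StronglyMeasurable H) {κ : ℝ} (hκ : 0 < κ)
    (ψ : ContDiffBump (0 : Vec n)) (hψ : ψ.rOut ≤ κ) (x₀ : Vec n) (t : ℝ) :
    ∫⁻ x in Metric.ball x₀ t, ENNReal.ofReal (shifted φ a (‖v x - mollify ψ v x‖ / κ)) ≤
      ∫⁻ x in Metric.ball x₀ (t + 2 * κ), ENNReal.ofReal (shifted φ a ‖H x‖) := by
  have hvl : LocallyIntegrable v := locallyIntegrableOn_univ.1 hv.locInt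
  have hnorm : ∀ z : Vec N, ‖z‖ / κ = ‖κ⁻¹ • z‖ := fun z => by
    rw [norm_smul, Real.norm_of_nonneg (by positivity), div_eq_inv_mul]
  -- The difference is an average of `v(x) - v(x - y)` with `|y| ≤ κ`; Jensen's inequality and
  -- Tonelli's theorem reduce the claim to a single translation.
  have hpt : ∀ x, ‖v x - mollify ψ v x‖ / κ ≤
      ∫ y, ‖κ⁻¹ • (v x - v (x - y))‖ ∂(bumpMeasure ψ) := by
    intro x
    have h1 : v x - mollify ψ v x = ∫ y, (v x - v (x - y)) ∂(bumpMeasure ψ) := by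
      rw [integral_sub (integrable_const _) (integrable_comp_sub_bumpMeasure ψ hvl x),
        mollify_eq_integral_bumpMeasure]
      simp
    rw [hnorm, h1, ← integral_smul]
    exact norm_integral_le_integral_norm _
  have hm : StronglyMeasurable fun p : Vec n × Vec n => κ⁻¹ • (v p.1 - v (p.1 - p.2)) :=
    ((hvm.comp_measurable measurable_fst).sub
      (hvm.comp_measurable (measurable_fst.sub measurable_snd))).const_smul κ⁻¹
  calc _ ≤ ∫⁻ x in Metric.ball x₀ t, ∫⁻ y,
        ENNReal.ofReal (shifted φ a ‖κ⁻¹ • (v x - v (x - y))‖) ∂(bumpMeasure ψ) :=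
        lintegral_mono fun x => (ENNReal.ofReal_le_ofReal
          (h.shifted_mono ha (by positivity) (hpt x))).trans
          (h.ofReal_shifted_integral_le ha
            (hm.comp_measurable measurable_prodMk_left).aestronglyMeasurable)
    _ = ∫⁻ y, (∫⁻ x in Metric.ball x₀ t,
        ENNReal.ofReal (shifted φ a ‖κ⁻¹ • (v x - v (x - y))‖)) ∂(bumpMeasure ψ) :=
        lintegral_lintegral_swap (h.measurable_ofReal_shifted_norm ha hm).aemeasurable
    _ ≤ ∫⁻ _, (∫⁻ x in Metric.ball x₀ (t + 2 * κ),
        ENNReal.ofReal (shifted φ a ‖H x‖)) ∂(bumpMeasure ψ) := by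
        refine lintegral_mono_ae ((ae_bumpMeasure_norm_le ψ).mono fun y hy => ?_)
        simp_rw [← hnorm]
        exact h.lintegral_shifted_weak_sub_translate_le ha hv hH hκ (hy.trans hψ) x₀ t
    _ = _ := by simp

/-- Jensen's inequality for the bump measure. The mollification of `φ(|G|)` serves as a convergent
majorant when smooth competitors approximate a Sobolev one. -/
theorem phi_norm_mollify_le (h : IsRegularNFunction φ c₀ c₁)
    {E : Type*} [NormedAddCommGroup E] [NormedSpace ℝ E] {G : Vec n → E}
    (hG : LocallyIntegrable G) (hφG : LocallyIntegrable fun x => φ ‖G x‖)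
    (ψ : ContDiffBump (0 : Vec n)) (x : Vec n) :
    φ ‖mollify ψ G x‖ ≤ mollify ψ (fun x => φ ‖G x‖) x := by
  refine (h.mono (norm_nonneg _) (norm_mollify_le ψ G x)).trans ?_
  rw [mollify_eq_integral_bumpMeasure]
  exact h.convexOn.map_integral_le h.continuousOn isClosed_Ici
    (Eventually.of_forall fun _ => norm_nonneg _)
    (integrable_comp_sub_bumpMeasure ψ hG x).norm (integrable_comp_sub_bumpMeasure ψ hφG x)

end IsRegularNFunction

theorem integrableOn_ball_of_continuous {g : Vec n → ℝ} (hg : Continuous g) (x₀ : Vec n) (ρ : ℝ) :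
    IntegrableOn g (Metric.ball x₀ ρ) :=
  (hg.continuousOn.integrableOn_compact (isCompact_closedBall x₀ ρ)).mono_set
    Metric.ball_subset_closedBall

theorem integral_const_add_add_sub {X : Type*} [MeasurableSpace X] {μ : Measure X}
    [IsFiniteMeasure μ] (C : ℝ) {g₁ g₂ g₃ : X → ℝ} (h₁ : Integrable g₁ μ) (h₂ : Integrable g₂ μ)
    (h₃ : Integrable g₃ μ) : ∫ x, (C + g₁ x + g₂ x - g₃ x) ∂μ =
      C * μ.real univ + ∫ x, g₁ x ∂μ + ∫ x, g₂ x ∂μ - ∫ x, g₃ x ∂μ := by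
  have h₀ : Integrable (fun _ : X => C) μ := integrable_const C
  have h₀₁ : Integrable (fun x => C + g₁ x) μ := h₀.add h₁
  have h₀₁₂ : Integrable (fun x => C + g₁ x + g₂ x) μ := h₀₁.add h₂
  rw [integral_sub h₀₁₂ h₃, integral_add h₀₁ h₂, integral_add h₀ h₁, integral_const, smul_eq_mul,
    mul_comm C]

/-! ### Quasiconvexity for Sobolev–Orlicz competitors. -/

namespace IsIntegrand

variable {Ω : Set (Vec n)} {f : Mat N n → ℝ} {k K L β : ℝ}

theorem abs_le_phi_add (hf : IsIntegrand Ω φ f k K L β) (hφ : IsRegularNFunction φ c₀ c₁)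
    (hc₀ : 0 < c₀) (Q A : Mat N n) :
    |f (Q + A)| ≤ |K| * 4 ^ (growthExp c₀ + 2) * (φ ‖Q‖ + φ ‖A‖) := by
  have h1 : φ ‖Q + A‖ ≤ φ (‖Q‖ + ‖A‖) := hφ.mono (norm_nonneg _) (norm_add_le _ _)
  calc |f (Q + A)| ≤ K * φ ‖Q + A‖ := hf.growth _
    _ ≤ |K| * φ ‖Q + A‖ := mul_le_mul_of_nonneg_right (le_abs_self K) (hφ.nonneg (norm_nonneg _))
    _ ≤ |K| * (4 ^ (growthExp c₀ + 2) * (φ ‖Q‖ + φ ‖A‖)) := by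
        gcongr
        exact h1.trans (hφ.add_le hc₀ (norm_nonneg _) (norm_nonneg _))
    _ = _ := by ring

theorem integrable_comp_add (hf : IsIntegrand Ω φ f k K L β) (hφ : IsRegularNFunction φ c₀ c₁)
    (hc₀ : 0 < c₀) {X : Type*} [MeasurableSpace X] {μ : Measure X} [IsFiniteMeasure μ]
    {H : X → Mat N n} (hH : AEStronglyMeasurable H μ) (hφH : Integrable (fun x => φ ‖H x‖) μ)
    (Q : Mat N n) : Integrable (fun x => f (Q + H x)) μ := by
  refine Integrable.mono' (((integrable_const (φ ‖Q‖)).add hφH).const_mul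
    (|K| * 4 ^ (growthExp c₀ + 2))) ?_ (Eventually.of_forall fun x => ?_)
  · exact hf.contDiff_one.continuous.comp_aestronglyMeasurable (aestronglyMeasurable_const.add hH)
  · exact hf.abs_le_phi_add hφ hc₀ Q (H x)

/-- Strict quasiconvexity extends to Sobolev–Orlicz functions with compact support. -/
theorem quasiconvex_sobolev (hf : IsIntegrand Ω φ f k K L β) (hφ : IsRegularNFunction φ c₀ c₁)
    (hc₀ : 0 < c₀) (hk : 0 ≤ k) {x₀ : Vec n} {s ρ : ℝ} (hs : 0 < s) (hsρ : s < ρ)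
    (hρ : Metric.ball x₀ ρ ⊆ Ω) (Q : Mat N n) {w : Vec n → Vec N} {H : Vec n → Mat N n}
    (hw : HasWeakGradient univ w H) (hw0 : ∀ x, x ∉ Metric.closedBall x₀ s → w x = 0)
    (hH0 : ∀ x, x ∉ Metric.closedBall x₀ s → H x = 0)
    (hφH : IntegrableOn (fun x => φ ‖H x‖) (Metric.ball x₀ ρ)) :
    k * ∫ x in Metric.ball x₀ ρ, shifted φ ‖Q‖ ‖H x‖ ≤
      ∫ x in Metric.ball x₀ ρ, (f (Q + H x) - f Q) := by
  set B := Metric.ball x₀ ρ with hB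
  have : IsFiniteMeasure (volume.restrict B) :=
    ⟨by rw [Measure.restrict_apply_univ]; exact measure_ball_lt_top⟩
  have hwl : LocallyIntegrable w := locallyIntegrableOn_univ.1 hw.locInt
  have hHl : LocallyIntegrable H := locallyIntegrableOn_univ.1 hw.locInt_grad
  have hHB : ∀ x, x ∉ B → H x = 0 := fun x hx => hH0 x fun h' =>
    hx (Metric.closedBall_subset_ball hsρ h')
  have hφHi : Integrable fun x => φ ‖H x‖ := by
    refine (integrableOn_iff_integrable_of_support_subset fun x hx => ?_).1 hφH
    by_contra hxB
    exact hx (by simp [hHB x hxB, hφ.map_zero])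
  have hφHB : ∫ x, φ ‖H x‖ = ∫ x in B, φ ‖H x‖ := by
    refine (setIntegral_eq_integral_of_forall_compl_eq_zero fun x hx => ?_).symm
    simp [hHB x hx, hφ.map_zero]
  -- With this width the mollified competitors are supported in the closed ball of radius `s + κ <
  -- ρ` and are admissible in the definition of quasiconvexity.
  set κ := (ρ - s) / 2 with hκdef
  have hκ : 0 < κ := by rw [hκdef]; linarith
  set ψ := bumpSeq n κ hκ with hψ
  have hHc : ∀ i, Continuous (mollify (ψ i) H) := fun i => (contDiff_mollify _ hHl).continuous
  have hgc : ∀ i, Continuous (mollify (ψ i) fun x => φ ‖H x‖) := fun i =>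
    (contDiff_mollify _ hφHi.locallyIntegrable).continuous
  have hfc := hf.contDiff_one.continuous
  set M := |K| * 4 ^ (growthExp c₀ + 2) with hM
  have hM0 : 0 ≤ M := by positivity
  set C := M * φ ‖Q‖ + |f Q| with hC
  have hC0 : 0 ≤ C := add_nonneg (mul_nonneg hM0 (hφ.nonneg (norm_nonneg Q))) (abs_nonneg _)
  -- the nonnegative functions to which Fatou's lemma is applied
  set F : ℕ → Vec n → ℝ := fun i x => C + M * mollify (ψ i) (fun x => φ ‖H x‖) x +
    k * shifted φ ‖Q‖ ‖mollify (ψ i) H x‖ - (f (Q + mollify (ψ i) H x) - f Q) with hF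
  set F₀ : Vec n → ℝ := fun x => C + M * φ ‖H x‖ + k * shifted φ ‖Q‖ ‖H x‖ -
    (f (Q + H x) - f Q) with hF₀
  -- The growth condition bounds `f(Q + A) - f(Q)` by `C + M φ(|A|)`; the added terms therefore make
  -- the integrands nonnegative.
  have hbase : ∀ A : Mat N n, ∀ b : ℝ, φ ‖A‖ ≤ b →
      0 ≤ C + M * b + k * shifted φ ‖Q‖ ‖A‖ - (f (Q + A) - f Q) := by
    intro A b hb
    have h1 := (le_abs_self _).trans (hf.abs_le_phi_add hφ hc₀ Q A)
    have h2 := mul_le_mul_of_nonneg_left hb hM0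
    have h3 := mul_nonneg hk (hφ.shifted_nonneg (norm_nonneg Q) (norm_nonneg A))
    have h4 := neg_abs_le (f Q)
    have h4' := le_abs_self (f Q)
    rw [← hM, mul_add] at h1
    rw [hC]
    linarith
  have hFpos : ∀ i x, 0 ≤ F i x := fun i x =>
    hbase _ _ (hφ.phi_norm_mollify_le hHl hφHi.locallyIntegrable (ψ i) x)
  have hF₀pos : ∀ x, 0 ≤ F₀ x := fun x => hbase _ _ le_rfl
  have hsc : Continuous fun A : Mat N n => shifted φ ‖Q‖ ‖A‖ :=
    hφ.continuous_shifted_norm (norm_nonneg Q)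
  have hFc : ∀ i, Continuous (F i) := fun i =>
    ((continuous_const.add (continuous_const.mul (hgc i))).add
      (continuous_const.mul (hsc.comp (hHc i)))).sub
      ((hfc.comp (continuous_const.add (hHc i))).sub continuous_const)
  have hlim : ∀ᵐ x, Tendsto (fun i => F i x) atTop (𝓝 (F₀ x)) := by
    filter_upwards [ae_tendsto_mollify hκ hHl, ae_tendsto_mollify hκ hφHi.locallyIntegrable]
      with x hx1 hx2
    exact ((tendsto_const_nhds.add (hx2.const_mul M)).add
      (((hsc.tendsto _).comp hx1).const_mul k)).sub
      (((hfc.tendsto _).comp (tendsto_const_nhds.add hx1)).sub tendsto_const_nhds)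
  -- integrals along the sequence
  set T := C * volume.real B + M * ∫ x in B, φ ‖H x‖ with hT
  have hT0 : 0 ≤ T := add_nonneg (mul_nonneg hC0 measureReal_nonneg)
    (mul_nonneg hM0 (integral_nonneg fun x => hφ.nonneg (norm_nonneg _)))
  -- Quasiconvexity for the smooth competitor discards the last two terms of `F i`, and
  -- mollification preserves the whole-space integral of `φ(|H|)`.
  have hFi : ∀ i, ∫ x in B, F i x ≤ T := by
    intro i
    have hqc := hf.quasiconvex x₀ ρ (hs.trans hsρ) hρ Q (mollify (ψ i) w)
      ((contDiff_mollify _ hwl).of_le (by exact_mod_cast le_top)) ?_ ?_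
    · rw [hw.grad_mollify] at hqc
      have hg : ∫ x in B, mollify (ψ i) (fun x => φ ‖H x‖) x ≤ ∫ x in B, φ ‖H x‖ := by
        rw [← hφHB]
        have hint : Integrable (mollify (ψ i) fun x => φ ‖H x‖) :=
          (ψ i).integrable_normed.integrable_convolution _ hφHi
        have h1 : ∫ x, mollify (ψ i) (fun x => φ ‖H x‖) x = ∫ x, φ ‖H x‖ := by
          have := integral_convolution (ContinuousLinearMap.lsmul ℝ ℝ)
            ((ψ i).integrable_normed (μ := (volume : Measure (Vec n)))) hφHi
          rw [(ψ i).integral_normed] at this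
          simpa [mollify] using this
        rw [← h1]
        refine setIntegral_le_integral hint (Eventually.of_forall fun x => ?_)
        exact (hφ.nonneg (norm_nonneg _)).trans
          (hφ.phi_norm_mollify_le hHl hφHi.locallyIntegrable (ψ i) x)
      have i1 : IntegrableOn (fun x => M * mollify (ψ i) (fun x => φ ‖H x‖) x) B :=
        integrableOn_ball_of_continuous (continuous_const.mul (hgc i)) _ _
      have i2 : IntegrableOn (fun x => k * shifted φ ‖Q‖ ‖mollify (ψ i) H x‖) B :=
        integrableOn_ball_of_continuous (continuous_const.mul (hsc.comp (hHc i))) _ _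
      have i3 : IntegrableOn (fun x => f (Q + mollify (ψ i) H x) - f Q) B :=
        integrableOn_ball_of_continuous
          ((hfc.comp (continuous_const.add (hHc i))).sub continuous_const) _ _
      have e : ∫ x in B, F i x = C * volume.real B +
          M * (∫ x in B, mollify (ψ i) (fun x => φ ‖H x‖) x) +
          k * (∫ x in B, shifted φ ‖Q‖ ‖mollify (ψ i) H x‖) -
          ∫ x in B, (f (Q + mollify (ψ i) H x) - f Q) := by
        simp only [hF]
        rw [integral_const_add_add_sub C i1 i2 i3, integral_const_mul, integral_const_mul,
          measureReal_restrict_apply_univ]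
      rw [e, hT]
      have := mul_le_mul_of_nonneg_left hg hM0
      linarith
    · refine HasCompactSupport.intro (isCompact_closedBall x₀ (s + κ)) fun x hx =>
        mollify_eq_zero _ hw0 (bumpSeq_rOut_le n hκ i) hx
    · refine (closure_minimal (fun x hx => ?_) Metric.isClosed_closedBall).trans
        (Metric.closedBall_subset_ball (ε₁ := s + κ) (by rw [hκdef]; linarith))
      by_contra hx'
      exact hx (mollify_eq_zero _ hw0 (bumpSeq_rOut_le n hκ i) hx')
  have hHm : AEStronglyMeasurable H (volume.restrict B) := hHl.aestronglyMeasurable.restrict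
  have j1 : IntegrableOn (fun x => M * φ ‖H x‖) B := hφH.const_mul M
  have j2 : IntegrableOn (fun x => shifted φ ‖Q‖ ‖H x‖) B := by
    have := hφ.integrable_shifted_norm_sub hc₀ hHm hφH (norm_nonneg Q) 0
    simp only [sub_zero] at this
    exact this
  have j3 : IntegrableOn (fun x => f (Q + H x) - f Q) B :=
    (hf.integrable_comp_add hφ hc₀ hHm hφH Q).sub (integrable_const _)
  have j0 : IntegrableOn (fun _ : Vec n => C) B := integrable_const C
  have hF₀i : IntegrableOn F₀ B := ((j0.add j1).add (j2.const_mul k)).sub j3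
  have hfatou : ∫⁻ x in B, ENNReal.ofReal (F₀ x) ≤ ENNReal.ofReal T := by
    have hl : ∀ᵐ x, ENNReal.ofReal (F₀ x) = liminf (fun i => ENNReal.ofReal (F i x)) atTop := by
      filter_upwards [hlim] with x hx
      exact ((ENNReal.continuous_ofReal.tendsto _).comp hx).liminf_eq.symm
    rw [lintegral_congr_ae (ae_restrict_of_ae hl)]
    refine (lintegral_liminf_le fun i => (hFc i).measurable.ennreal_ofReal).trans
      (liminf_le_of_frequently_le' (Eventually.frequently (Eventually.of_forall fun i => ?_)))
    rw [← ofReal_integral_eq_lintegral_ofReal (integrableOn_ball_of_continuous (hFc i) _ _)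
      (Eventually.of_forall (hFpos i))]
    exact ENNReal.ofReal_le_ofReal (hFi i)
  rw [← ofReal_integral_eq_lintegral_ofReal hF₀i (Eventually.of_forall hF₀pos),
    ENNReal.ofReal_le_ofReal_iff hT0] at hfatou
  have e : ∫ x in B, F₀ x = C * volume.real B + M * (∫ x in B, φ ‖H x‖) +
      k * (∫ x in B, shifted φ ‖Q‖ ‖H x‖) - ∫ x in B, (f (Q + H x) - f Q) := by
    simp only [hF₀]
    rw [integral_const_add_add_sub C j1 (j2.const_mul k) j3, integral_const_mul,
      integral_const_mul, measureReal_restrict_apply_univ]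
  -- The first two terms of `∫ F₀` add up to exactly `T` and cancel; what remains is the claim.
  rw [e] at hfatou
  linarith

end IsIntegrand
end OrliczGrowth

namespace OrliczGrowth

variable {N n : ℕ} {φ : ℝ → ℝ} {c₀ c₁ : ℝ}

/-! ### Cut-off functions -/

theorem exists_bound_deriv_smoothTransition :
    ∃ M : ℝ, 0 ≤ M ∧ ∀ t, |deriv Real.smoothTransition t| ≤ M := by
  have hc : Continuous (deriv Real.smoothTransition) :=
    (Real.smoothTransition.contDiff (n := 1)).continuous_deriv (by norm_num)
  obtain ⟨M, hM⟩ := isCompact_Icc.exists_bound_of_continuousOn (s := Icc (0 : ℝ) 1)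
    hc.continuousOn
  have hM0 : 0 ≤ M := (norm_nonneg _).trans (hM 0 (by simp))
  refine ⟨M, hM0, fun t => ?_⟩
  by_cases ht : t ∈ Icc (0 : ℝ) 1
  · exact hM t ht
  · have h0 : deriv Real.smoothTransition t = 0 := by
      rcases lt_or_ge t 0 with h | h
      · have : Real.smoothTransition =ᶠ[𝓝 t] fun _ => 0 := by
          filter_upwards [Iio_mem_nhds h] with s hs
          exact Real.smoothTransition.zero_of_nonpos (le_of_lt hs)
        rw [this.deriv_eq]; simp
      · have h1 : 1 < t := by
          by_contra! h'
          exact ht ⟨h, h'⟩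
        have : Real.smoothTransition =ᶠ[𝓝 t] fun _ => 1 := by
          filter_upwards [Ioi_mem_nhds h1] with s hs
          exact Real.smoothTransition.one_of_one_le (le_of_lt hs)
        rw [this.deriv_eq]; simp
    rw [h0]; simpa using hM0

/-- `η` is a smooth cut-off function between concentric balls of radii `s` and `s + d`. -/
structure IsCutoff (M : ℝ) (x₀ : Vec n) (s d : ℝ) (η : Vec n → ℝ) : Prop where
  contDiff : ContDiff ℝ ∞ η
  nonneg : ∀ x, 0 ≤ η x
  le_one : ∀ x, η x ≤ 1
  eq_one : ∀ x ∈ Metric.closedBall x₀ s, η x = 1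
  eq_zero : ∀ x, x ∉ Metric.closedBall x₀ (s + d) → η x = 0
  norm_fderiv_le : ∀ x, ‖fderiv ℝ η x‖ ≤ M / d

/-- A smooth step is applied to an affine function of `|x - x₀|²`, smooth at the centre too, equal
to `1` at distance `s` and to `0` at distance `s + d`. With `D = d(2s + d) ≥ d(s + d)` the gradient
is at most a constant times `(s + d) / D ≤ 1 / d`. -/
theorem exists_cutoff (n : ℕ) : ∃ M : ℝ, 0 ≤ M ∧ ∀ (x₀ : Vec n) (s d : ℝ), 0 ≤ s → 0 < d →
    ∃ η, IsCutoff M x₀ s d η := by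
  obtain ⟨M, hM0, hM⟩ := exists_bound_deriv_smoothTransition
  refine ⟨2 * M, by positivity, fun x₀ s d hs hd => ?_⟩
  have hD : 0 < (s + d) ^ 2 - s ^ 2 := by nlinarith
  set D := (s + d) ^ 2 - s ^ 2 with hDdef
  have hθ : ContDiff ℝ ∞ fun x : Vec n => ((s + d) ^ 2 - ‖x - x₀‖ ^ 2) / D :=
    (contDiff_const.sub ((contDiff_id.sub contDiff_const).norm_sq ℝ)).div_const D
  have hzero : ∀ x : Vec n, x ∉ Metric.closedBall x₀ (s + d) →
      Real.smoothTransition (((s + d) ^ 2 - ‖x - x₀‖ ^ 2) / D) = 0 := by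
    intro x hx
    rw [Metric.mem_closedBall, dist_eq_norm, not_le] at hx
    refine Real.smoothTransition.zero_of_nonpos (div_nonpos_of_nonpos_of_nonneg ?_ hD.le)
    nlinarith
  refine ⟨fun x => Real.smoothTransition (((s + d) ^ 2 - ‖x - x₀‖ ^ 2) / D),
    Real.smoothTransition.contDiff.comp hθ, fun x => Real.smoothTransition.nonneg _,
    fun x => Real.smoothTransition.le_one _, fun x hx => ?_, hzero, fun x => ?_⟩
  · rw [Metric.mem_closedBall, dist_eq_norm] at hx
    refine Real.smoothTransition.one_of_one_le ?_
    rw [le_div_iff₀ hD]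
    nlinarith [norm_nonneg (x - x₀)]
  · by_cases hx : x ∈ Metric.closedBall x₀ (s + d)
    · rw [Metric.mem_closedBall, dist_eq_norm] at hx
      have h1 : HasFDerivAt (fun x : Vec n => ((s + d) ^ 2 - ‖x - x₀‖ ^ 2) / D)
          (D⁻¹ • (-((2 : ℝ) • innerSL ℝ (x - x₀))) : Vec n →L[ℝ] ℝ) x := by
        have h2 : HasFDerivAt (fun x : Vec n => x - x₀) (ContinuousLinearMap.id ℝ (Vec n)) x :=
          (hasFDerivAt_id x).sub_const x₀
        have h3 := (h2.norm_sq.const_sub ((s + d) ^ 2)).const_mul D⁻¹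
        refine (h3.congr_of_eventuallyEq (Eventually.of_forall fun y => ?_)).congr_fderiv ?_
        · simp only
          rw [div_eq_inv_mul]
        · ext y
          simp [two_mul]
      have h4 : HasDerivAt Real.smoothTransition _ (((s + d) ^ 2 - ‖x - x₀‖ ^ 2) / D) :=
        ((Real.smoothTransition.contDiff (n := 1)).differentiable (by norm_num) _).hasDerivAt
      have h5 := h4.comp_hasFDerivAt x h1
      have h6 : fderiv ℝ (fun x : Vec n =>
          Real.smoothTransition (((s + d) ^ 2 - ‖x - x₀‖ ^ 2) / D)) x = _ := h5.fderiv
      rw [h6]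
      refine ContinuousLinearMap.opNorm_le_bound _ (by positivity) fun y => ?_
      have h7 : |inner ℝ (x - x₀) y| ≤ (s + d) * ‖y‖ :=
        (abs_real_inner_le_norm _ _).trans (mul_le_mul_of_nonneg_right hx (norm_nonneg y))
      have h8 : (s + d) / D ≤ 1 / d := by
        rw [div_le_div_iff₀ hD hd]
        nlinarith
      set m := deriv Real.smoothTransition (((s + d) ^ 2 - ‖x - x₀‖ ^ 2) / D)
      have hm : |m| ≤ M := hM _
      have e : ‖(m • (D⁻¹ • (-((2 : ℝ) • innerSL ℝ (x - x₀))) : Vec n →L[ℝ] ℝ)) y‖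
          = |m| * (D⁻¹ * (2 * |inner ℝ (x - x₀) y|)) := by
        simp only [map_sub, smul_neg, _root_.neg_apply, _root_.smul_apply, smul_eq_mul, norm_neg,
          norm_mul, Real.norm_eq_abs, abs_inv, abs_of_pos hD, Nat.abs_ofNat]
        rw [← map_sub, innerSL_apply_apply]
      rw [e]
      calc |m| * (D⁻¹ * (2 * |inner ℝ (x - x₀) y|)) ≤ M * (D⁻¹ * (2 * ((s + d) * ‖y‖))) := by
            gcongr
        _ = 2 * M * ((s + d) / D) * ‖y‖ := by ring
        _ ≤ 2 * M * (1 / d) * ‖y‖ := by gcongr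
        _ = 2 * M / d * ‖y‖ := by ring
    · have : (fun x : Vec n => Real.smoothTransition (((s + d) ^ 2 - ‖x - x₀‖ ^ 2) / D))
          =ᶠ[𝓝 x] fun _ => 0 := by
        filter_upwards [Metric.isClosed_closedBall.isOpen_compl.mem_nhds hx] with y hy
        exact hzero y hy
      rw [this.fderiv_eq]
      simp
      positivity

namespace IsCutoff

variable {M s d : ℝ} {x₀ : Vec n} {η : Vec n → ℝ}

theorem tsupport_subset (h : IsCutoff M x₀ s d η) : tsupport η ⊆ Metric.closedBall x₀ (s + d) :=
  closure_minimal (fun x hx => by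
    by_contra hx'
    exact hx (h.eq_zero x hx')) Metric.isClosed_closedBall

theorem hasCompactSupport (h : IsCutoff M x₀ s d η) : HasCompactSupport η :=
  HasCompactSupport.intro (isCompact_closedBall x₀ (s + d)) h.eq_zero

theorem fderiv_eq_zero_of_mem (h : IsCutoff M x₀ s d η) {x : Vec n}
    (hx : x ∈ Metric.ball x₀ s) : fderiv ℝ η x = 0 := by
  have : η =ᶠ[𝓝 x] fun _ => 1 := by
    filter_upwards [Metric.isOpen_ball.mem_nhds hx] with y hy
    exact h.eq_one y (Metric.ball_subset_closedBall hy)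
  rw [this.fderiv_eq]; simp

theorem fderiv_eq_zero_of_notMem (h : IsCutoff M x₀ s d η) {x : Vec n}
    (hx : x ∉ Metric.closedBall x₀ (s + d)) : fderiv ℝ η x = 0 := by
  have : η =ᶠ[𝓝 x] fun _ => 0 := by
    filter_upwards [Metric.isClosed_closedBall.isOpen_compl.mem_nhds hx] with y hy
    exact h.eq_zero y hy
  rw [this.fderiv_eq]; simp

end IsCutoff

/-! ### Calculus of weak gradients -/

theorem integrable_smul_of_locallyIntegrableOn {E : Type*} [NormedAddCommGroup E] [NormedSpace ℝ E]
    {Ω : Set (Vec n)} {u : Vec n → E} (hu : LocallyIntegrableOn u Ω) {g : Vec n → ℝ}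
    (hg : Continuous g) (hgc : HasCompactSupport g) (hgΩ : tsupport g ⊆ Ω) :
    Integrable fun x => g x • u x := by
  have h1 : IntegrableOn (fun x => g x • u x) (tsupport g) :=
    (hu.integrableOn_compact_subset hgΩ hgc).continuousOn_smul hg.continuousOn hgc
  refine (integrableOn_iff_integrable_of_support_subset fun x hx => ?_).1 h1
  refine subset_tsupport g fun h0 => hx ?_
  simp [h0]

theorem continuous_fderiv_apply {η : Vec n → ℝ} (hη : ContDiff ℝ ∞ η) (e : Vec n) :
    Continuous fun x => fderiv ℝ η x e :=
  (hη.continuous_fderiv (by simp)).clm_apply continuous_const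

theorem tsupport_fderiv_apply_subset' (η : Vec n → ℝ) (e : Vec n) :
    tsupport (fun x => fderiv ℝ η x e) ⊆ tsupport η :=
  (closure_mono fun x hx h0 => by
    simp only [Function.mem_support] at hx
    exact hx (by simp [h0])).trans (tsupport_fderiv_subset ℝ (f := η))

namespace HasWeakGradient

variable {Ω : Set (Vec n)} {u v : Vec n → Vec N} {G H : Vec n → Mat N n}

/-- The integrals in the definition can be taken over the whole space. -/
theorem integral_eq (hu : HasWeakGradient Ω u G) {η : Vec n → ℝ} (hη : ContDiff ℝ ∞ η)
    (hηc : HasCompactSupport η) (hηΩ : tsupport η ⊆ Ω) (i : Fin N) (j : Fin n) :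
    ∫ x, u x i * fderiv ℝ η x (EuclideanSpace.single j 1) = - ∫ x, G x (i, j) * η x := by
  rw [← setIntegral_eq_integral_of_forall_compl_eq_zero (s := Ω) (fun x hx => ?_), hu.weak η hη hηc hηΩ i j,
    setIntegral_eq_integral_of_forall_compl_eq_zero (s := Ω) (fun x hx => ?_)]
  · rw [image_eq_zero_of_notMem_tsupport fun h => hx (hηΩ h), mul_zero]
  · have : x ∉ tsupport (fderiv ℝ η) := fun h => hx (hηΩ (tsupport_fderiv_subset ℝ h))
    rw [image_eq_zero_of_notMem_tsupport this]
    simp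

theorem of_integral_eq (hu : LocallyIntegrableOn u Ω) (hG : LocallyIntegrableOn G Ω)
    (h : ∀ η : Vec n → ℝ, ContDiff ℝ ∞ η → HasCompactSupport η → tsupport η ⊆ Ω →
      ∀ (i : Fin N) (j : Fin n),
        ∫ x, u x i * fderiv ℝ η x (EuclideanSpace.single j 1) = - ∫ x, G x (i, j) * η x) :
    HasWeakGradient Ω u G := by
  refine ⟨hu, hG, fun η hη hηc hηΩ i j => ?_⟩
  rw [setIntegral_eq_integral_of_forall_compl_eq_zero (s := Ω) (fun x hx => ?_), h η hη hηc hηΩ i j,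
    setIntegral_eq_integral_of_forall_compl_eq_zero (s := Ω) (fun x hx => ?_)]
  · rw [image_eq_zero_of_notMem_tsupport fun h => hx (hηΩ h), mul_zero]
  · have : x ∉ tsupport (fderiv ℝ η) := fun h => hx (hηΩ (tsupport_fderiv_subset ℝ h))
    rw [image_eq_zero_of_notMem_tsupport this]
    simp

theorem mono (hu : HasWeakGradient Ω u G) {Ω' : Set (Vec n)} (h : Ω' ⊆ Ω) :
    HasWeakGradient Ω' u G :=
  of_integral_eq (hu.locInt.mono_set h) (hu.locInt_grad.mono_set h)
    fun _ hη hηc hηΩ i j => hu.integral_eq hη hηc (hηΩ.trans h) i j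

theorem integrable_apply_mul (hu : LocallyIntegrableOn u Ω) {g : Vec n → ℝ}
    (hg : Continuous g) (hgc : HasCompactSupport g) (hgΩ : tsupport g ⊆ Ω) (i : Fin N) :
    Integrable fun x => u x i * g x := by
  have := (EuclideanSpace.proj i : Vec N →L[ℝ] ℝ).integrable_comp
    (integrable_smul_of_locallyIntegrableOn hu hg hgc hgΩ)
  refine this.congr (Eventually.of_forall fun x => ?_)
  simp [mul_comm]

theorem integrable_grad_apply_mul (hG : LocallyIntegrableOn G Ω) {g : Vec n → ℝ}
    (hg : Continuous g) (hgc : HasCompactSupport g) (hgΩ : tsupport g ⊆ Ω) (i : Fin N)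
    (j : Fin n) : Integrable fun x => G x (i, j) * g x := by
  have := (EuclideanSpace.proj (i, j) : Mat N n →L[ℝ] ℝ).integrable_comp
    (integrable_smul_of_locallyIntegrableOn hG hg hgc hgΩ)
  refine this.congr (Eventually.of_forall fun x => ?_)
  simp [mul_comm]

theorem hasCompactSupport_fderiv_apply {η : Vec n → ℝ} (hηc : HasCompactSupport η) (e : Vec n) :
    HasCompactSupport fun x => fderiv ℝ η x e :=
  hηc.mono' ((subset_tsupport _).trans (tsupport_fderiv_apply_subset' η e))

protected theorem sub (hu : HasWeakGradient Ω u G) (hv : HasWeakGradient Ω v H) :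
    HasWeakGradient Ω (fun x => u x - v x) (fun x => G x - H x) := by
  refine of_integral_eq (hu.locInt.sub hv.locInt) (hu.locInt_grad.sub hv.locInt_grad)
    fun η hη hηc hηΩ i j => ?_
  set e := EuclideanSpace.single j (1 : ℝ) with he
  have hc := continuous_fderiv_apply hη e
  have hs := hasCompactSupport_fderiv_apply hηc e
  have hsub := (tsupport_fderiv_apply_subset' η e).trans hηΩ
  simp only [PiLp.sub_apply, sub_mul]
  rw [integral_sub (integrable_apply_mul hu.locInt hc hs hsub i)
    (integrable_apply_mul hv.locInt hc hs hsub i),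
    integral_sub (integrable_grad_apply_mul hu.locInt_grad hη.continuous hηc hηΩ i j)
    (integrable_grad_apply_mul hv.locInt_grad hη.continuous hηc hηΩ i j),
    hu.integral_eq hη hηc hηΩ i j, hv.integral_eq hη hηc hηΩ i j]
  ring

theorem of_contDiff {w : Vec n → Vec N} (hw : ContDiff ℝ 1 w) :
    HasWeakGradient univ w (grad w) := by
  have hl : LocallyIntegrableOn w univ := hw.continuous.locallyIntegrable.locallyIntegrableOn _
  have hl' : LocallyIntegrableOn (grad w) univ :=
    (continuous_grad hw).locallyIntegrable.locallyIntegrableOn _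
  refine of_integral_eq hl hl' fun η hη hηc hηΩ i j => ?_
  have hp : ∀ x, HasFDerivAt (fun x => w x i)
      ((EuclideanSpace.proj i : Vec N →L[ℝ] ℝ).comp (fderiv ℝ w x)) x := fun x =>
    (EuclideanSpace.proj i : Vec N →L[ℝ] ℝ).hasFDerivAt.comp x
      ((hw.differentiable (by norm_num)) x).hasFDerivAt
  have hp' : ∀ x, fderiv ℝ (fun x => w x i) x (EuclideanSpace.single j 1) = grad w x (i, j) := by
    intro x
    rw [(hp x).fderiv]
    rfl
  have := integral_mul_fderiv_eq_neg_fderiv_mul_of_integrable (μ := (volume : Measure (Vec n)))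
    (f := fun x => w x i) (g := η) (v := EuclideanSpace.single j 1) ?_
    (integrable_apply_mul hl (continuous_fderiv_apply hη _)
      (hasCompactSupport_fderiv_apply hηc _) (subset_univ _) i)
    (integrable_apply_mul hl hη.continuous hηc hηΩ i)
    (fun x _ => (hp x).differentiableAt) (fun x _ => (hη.differentiable (by simp)) x)
  · simpa only [hp'] using this
  · simp only [hp']
    exact integrable_grad_apply_mul hl' hη.continuous hηc hηΩ i j

/-- The gradient of a product with a smooth cut-off function. -/
theorem cutoff_smul (hu : HasWeakGradient Ω u G) {η : Vec n → ℝ} (hη : ContDiff ℝ ∞ η)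
    (hηc : HasCompactSupport η) (hηΩ : tsupport η ⊆ Ω) :
    HasWeakGradient univ (fun x => η x • u x)
      (fun x => η x • G x + toMat N n ((fderiv ℝ η x).smulRight (u x))) := by
  have hI1 : Integrable fun x => η x • u x :=
    integrable_smul_of_locallyIntegrableOn hu.locInt hη.continuous hηc hηΩ
  have hI2 : Integrable fun x => η x • G x :=
    integrable_smul_of_locallyIntegrableOn hu.locInt_grad hη.continuous hηc hηΩ
  have hcoord : ∀ (i : Fin N) (j : Fin n),
      Integrable fun x => u x i * fderiv ℝ η x (EuclideanSpace.single j 1) := fun i j =>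
    integrable_apply_mul hu.locInt (continuous_fderiv_apply hη _)
      (hasCompactSupport_fderiv_apply hηc _) ((tsupport_fderiv_apply_subset' η _).trans hηΩ) i
  have hT : ∀ x i j, toMat N n ((fderiv ℝ η x).smulRight (u x)) (i, j) =
      u x i * fderiv ℝ η x (EuclideanSpace.single j 1) := by
    intro x i j
    rw [toMat_apply]
    simp [mul_comm]
  have hI3 : Integrable fun x => toMat N n ((fderiv ℝ η x).smulRight (u x)) := by
    have h1 : Integrable fun x => (PiLp.continuousLinearEquiv 2 ℝ fun _ : Fin N × Fin n => ℝ)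
        (toMat N n ((fderiv ℝ η x).smulRight (u x))) := by
      refine Integrable.of_eval fun p => ?_
      refine (hcoord p.1 p.2).congr (Eventually.of_forall fun x => ?_)
      exact (hT x p.1 p.2).symm
    have h2 := (PiLp.continuousLinearEquiv 2 ℝ
      fun _ : Fin N × Fin n => ℝ).symm.toContinuousLinearMap.integrable_comp h1
    refine h2.congr (Eventually.of_forall fun x => ?_)
    simp
  refine of_integral_eq (hI1.locallyIntegrable.locallyIntegrableOn _)
    ((hI2.add hI3).locallyIntegrable.locallyIntegrableOn _) fun ζ hζ hζc _ i j => ?_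
  set e := EuclideanSpace.single j (1 : ℝ) with he
  -- The product `ηζ` is an admissible test function for `u`; the term with `∇η` from the product
  -- rule becomes part of the new gradient.
  have hηζ : ContDiff ℝ ∞ fun x => η x * ζ x := hη.mul hζ
  have hηζc : HasCompactSupport fun x => η x * ζ x := hηc.mul_right
  have hηζs : tsupport (fun x => η x * ζ x) ⊆ Ω := (tsupport_mul_subset_left).trans hηΩ
  have h1 := hu.integral_eq hηζ hηζc hηζs i j
  have hd : ∀ x, fderiv ℝ (fun x => η x * ζ x) x e = η x * fderiv ℝ ζ x e + ζ x * fderiv ℝ η x e := by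
    intro x
    have := ((hη.differentiable (by simp)) x).hasFDerivAt.mul
      ((hζ.differentiable (by simp)) x).hasFDerivAt
    have h2 : fderiv ℝ (fun x => η x * ζ x) x = _ := this.fderiv
    rw [h2]
    simp
  have k1 : Integrable fun x => u x i * fderiv ℝ (fun x => η x * ζ x) x e :=
    integrable_apply_mul hu.locInt (continuous_fderiv_apply hηζ _)
      (hasCompactSupport_fderiv_apply hηζc _) ((tsupport_fderiv_apply_subset' _ _).trans hηζs) i
  have k2 : Integrable fun x => u x i * (fderiv ℝ η x e * ζ x) :=
    integrable_apply_mul hu.locInt ((continuous_fderiv_apply hη _).mul hζ.continuous)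
      (hasCompactSupport_fderiv_apply hηc _).mul_right
      ((tsupport_mul_subset_left).trans ((tsupport_fderiv_apply_subset' η _).trans hηΩ)) i
  have k3 : Integrable fun x => G x (i, j) * (η x * ζ x) :=
    integrable_grad_apply_mul hu.locInt_grad hηζ.continuous hηζc hηζs i j
  calc ∫ x, (η x • u x) i * fderiv ℝ ζ x e
      = ∫ x, (u x i * fderiv ℝ (fun x => η x * ζ x) x e - u x i * (fderiv ℝ η x e * ζ x)) := by
        refine integral_congr_ae (Eventually.of_forall fun x => ?_)
        simp only [hd, PiLp.smul_apply, smul_eq_mul]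
        ring
    _ = -(∫ x, G x (i, j) * (η x * ζ x)) - ∫ x, u x i * (fderiv ℝ η x e * ζ x) := by
        rw [integral_sub k1 k2, h1]
    _ = -(∫ x, (G x (i, j) * (η x * ζ x) + u x i * (fderiv ℝ η x e * ζ x))) := by
        rw [integral_add k3 k2]; ring
    _ = _ := by
        congr 1
        refine integral_congr_ae (Eventually.of_forall fun x => ?_)
        simp only [PiLp.add_apply, PiLp.smul_apply, smul_eq_mul, hT]
        ring

/-- The weak gradient vanishes off the support. -/
theorem ae_eq_zero_of_notMem_tsupport (hu : HasWeakGradient univ u G) :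
    ∀ᵐ x, x ∉ tsupport u → G x = 0 := by
  refine ((isClosed_tsupport u).isOpen_compl).ae_eq_zero_of_integral_contDiff_smul_eq_zero
    (hu.locInt_grad.mono_set (subset_univ _)) fun η hη hηc hηs => ?_
  have hint : Integrable fun x => η x • G x :=
    integrable_smul_of_locallyIntegrableOn hu.locInt_grad hη.continuous hηc (subset_univ _)
  ext p
  obtain ⟨i, j⟩ := p
  have h1 := (EuclideanSpace.proj (i, j) : Mat N n →L[ℝ] ℝ).integral_comp_comm hint
  have h2 := hu.integral_eq hη hηc (subset_univ _) i j
  have h3 : ∫ x, u x i * fderiv ℝ η x (EuclideanSpace.single j 1) = 0 := by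
    refine integral_eq_zero_of_ae (Eventually.of_forall fun x => ?_)
    by_cases hx : x ∈ tsupport u
    · have : x ∉ tsupport (fderiv ℝ η) := fun h => hηs (tsupport_fderiv_subset ℝ h) hx
      simp [image_eq_zero_of_notMem_tsupport this]
    · simp [image_eq_zero_of_notMem_tsupport hx]
  rw [h3] at h2
  have h4 : (∫ x, η x • G x) (i, j) = ∫ x, G x (i, j) * η x := by
    refine h1.symm.trans (integral_congr_ae (Eventually.of_forall fun x => ?_))
    simp [mul_comm]
  rw [h4]
  simp only [PiLp.zero_apply]
  linarith

theorem congr_ae (hu : HasWeakGradient univ u G) (hv : u =ᵐ[volume] v) (hH : G =ᵐ[volume] H) :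
    HasWeakGradient univ v H := by
  have h1 : LocallyIntegrable v := (locallyIntegrableOn_univ.1 hu.locInt).congr hv
  have h2 : LocallyIntegrable H := (locallyIntegrableOn_univ.1 hu.locInt_grad).congr hH
  refine of_integral_eq (h1.locallyIntegrableOn _) (h2.locallyIntegrableOn _)
    fun η hη hηc hηΩ i j => ?_
  have := hu.integral_eq hη hηc hηΩ i j
  rw [integral_congr_ae (g := fun x => u x i * fderiv ℝ η x (EuclideanSpace.single j 1)) ?_, this,
    integral_congr_ae (f := fun x => G x (i, j) * η x) ?_]
  · filter_upwards [hH] with x hx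
    simp [hx]
  · filter_upwards [hv] with x hx
    simp [hx]

end HasWeakGradient

theorem norm_toMat_smulRight_le (ℓ : Vec n →L[ℝ] ℝ) (a : Vec N) :
    ‖toMat N n (ℓ.smulRight a)‖ ≤ ‖toMat N n‖ * (‖ℓ‖ * ‖a‖) := by
  refine ((toMat N n).le_opNorm _).trans ?_
  rw [ContinuousLinearMap.norm_smulRight_apply]

/-- Matrix-vector multiplication. -/
noncomputable def ofMat (Q : Mat N n) : Vec n →L[ℝ] Vec N :=
  ∑ j, (EuclideanSpace.proj j : Vec n →L[ℝ] ℝ).smulRight (WithLp.toLp 2 fun i => Q (i, j))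

theorem grad_ofMat (Q : Mat N n) (x : Vec n) : grad (ofMat Q) x = Q := by
  ext p
  obtain ⟨i, j⟩ := p
  rw [grad_apply, (ofMat Q).fderiv]
  simp [ofMat]

end OrliczGrowth

/-! ### Localization, minimality and the Caccioppoli inequality. -/

namespace OrliczGrowth

variable {N n : ℕ} {φ : ℝ → ℝ} {c₀ c₁ : ℝ} {Ω : Set (Vec n)} {f : Mat N n → ℝ}
  {k K L β : ℝ} {u : Vec n → Vec N} {G : Vec n → Mat N n}

theorem isFiniteMeasure_restrict_ball (x₀ : Vec n) (ρ : ℝ) :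
    IsFiniteMeasure (volume.restrict (Metric.ball x₀ ρ)) :=
  ⟨by rw [Measure.restrict_apply_univ]; exact measure_ball_lt_top⟩

protected theorem HasWeakGradient.neg {v : Vec n → Vec N} {H : Vec n → Mat N n}
    (hv : HasWeakGradient Ω v H) : HasWeakGradient Ω (fun x => - v x) (fun x => - H x) := by
  refine HasWeakGradient.of_integral_eq hv.locInt.neg hv.locInt_grad.neg
    fun η hη hηc hηΩ i j => ?_
  have := hv.integral_eq hη hηc hηΩ i j
  simp only [PiLp.neg_apply, neg_mul, integral_neg, this]

theorem HasWeakGradient.sub_const {v : Vec n → Vec N} {H : Vec n → Mat N n}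
    (hv : HasWeakGradient univ v H) (q : Vec N) : HasWeakGradient univ (fun x => v x - q) H := by
  have h1 := hv.sub (HasWeakGradient.of_contDiff (w := fun _ : Vec n => q) contDiff_const)
  refine h1.congr_ae (Eventually.of_forall fun x => rfl) (Eventually.of_forall fun x => ?_)
  have : grad (fun _ : Vec n => q) x = 0 := by
    rw [grad_eq_toMat]; simp
  simp [this]

theorem IsRegularNFunction.integrable_shifted_mul_norm_sub (h : IsRegularNFunction φ c₀ c₁)
    (hc₀ : 0 < c₀) {X : Type*} [MeasurableSpace X] {μ : Measure X} [IsFiniteMeasure μ]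
    {E : Type*} [NormedAddCommGroup E] [NormedSpace ℝ E] {g : X → E}
    (hg : AEStronglyMeasurable g μ) (hφg : Integrable (fun x => φ ‖g x‖) μ) {a c : ℝ}
    (ha : 0 ≤ a) (hc : 0 ≤ c) (q : E) :
    Integrable (fun x => shifted φ a (c * ‖g x - q‖)) μ := by
  have h1 := h.integrable_shifted_norm_sub hc₀ hg hφg ha q
  have hmeas : AEStronglyMeasurable (fun x => shifted φ a (c * ‖g x - q‖)) μ := by
    have := (h.continuous_shifted_norm ha (E := E)).comp_aestronglyMeasurable
      ((hg.sub (aestronglyMeasurable_const (b := q))).const_smul c)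
    simpa [norm_smul, abs_of_nonneg hc] using this
  refine Integrable.mono' (h1.const_mul (2 ^ (growthExp c₀ + 2) * (1 + c) ^ (growthExp c₀ + 2)))
    hmeas (Eventually.of_forall fun x => ?_)
  rw [Real.norm_of_nonneg (h.shifted_nonneg ha (by positivity))]
  refine (h.shifted_mono ha (by positivity) ?_).trans
    (h.shifted_mul_le hc₀ ha (l := 1 + c) (by linarith) (norm_nonneg _))
  nlinarith [norm_nonneg (g x - q)]

/-- `v` is a globally defined Sobolev function with weak gradient `H`, and `v`, `H` belong to the
Orlicz space on `B`. -/
structure IsLocalized (φ : ℝ → ℝ) (B : Set (Vec n)) (v : Vec n → Vec N) (H : Vec n → Mat N n) :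
    Prop where
  weakGrad : HasWeakGradient univ v H
  meas : StronglyMeasurable v
  meas_grad : StronglyMeasurable H
  integrableOn : IntegrableOn (fun x => φ ‖v x‖) B
  integrableOn_grad : IntegrableOn (fun x => φ ‖H x‖) B

/-- Multiply `u - Qx` by a cut-off that equals `1` on the ball and whose support still lies in `Ω`,
and pass to strongly measurable representatives. The result lives on the whole space, where it can
be mollified, and has gradient `∇u - Q` on the ball. -/
theorem MemSobolevLoc.exists_localized (hu : MemSobolevLoc φ Ω u G)
    (hφ : IsRegularNFunction φ c₀ c₁) (hc₀ : 0 < c₀) (hΩ : IsOpen Ω) {x₀ : Vec n} {R : ℝ}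
    (hR : 0 < R) (hB : Metric.closedBall x₀ R ⊆ Ω) (Q : Mat N n) :
    ∃ (v : Vec n → Vec N) (H : Vec n → Mat N n), IsLocalized φ (Metric.ball x₀ R) v H ∧
      ∀ᵐ x, x ∈ Metric.ball x₀ R → H x = G x - Q := by
  have := isFiniteMeasure_restrict_ball x₀ R
  obtain ⟨d, hd, hdΩ⟩ := (isCompact_closedBall x₀ R).exists_cthickening_subset_open hΩ hB
  rw [cthickening_closedBall hd.le hR.le, add_comm] at hdΩ
  obtain ⟨M, hM, hcut⟩ := exists_cutoff n
  obtain ⟨η, hη⟩ := hcut x₀ R d hR.le hd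
  have hw := (hu.weakGrad.sub
    ((HasWeakGradient.of_contDiff (ofMat Q).contDiff).mono (subset_univ Ω))).cutoff_smul
    hη.contDiff hη.hasCompactSupport (hη.tsupport_subset.trans hdΩ)
  simp only [grad_ofMat] at hw
  have hvm := (locallyIntegrableOn_univ.1 hw.locInt).aestronglyMeasurable
  have hHm := (locallyIntegrableOn_univ.1 hw.locInt_grad).aestronglyMeasurable
  have hu1 := hu.mem _ (isCompact_closedBall x₀ R) hB
  have hu2 := hu.mem_grad _ (isCompact_closedBall x₀ R) hB
  have hsub : Metric.ball x₀ R ⊆ Metric.closedBall x₀ R := Metric.ball_subset_closedBall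
  have hvB : ∀ᵐ x ∂(volume.restrict (Metric.ball x₀ R)), hvm.mk _ x = u x - ofMat Q x := by
    filter_upwards [ae_restrict_of_ae hvm.ae_eq_mk, ae_restrict_mem measurableSet_ball]
      with x hx hxB
    rw [← hx, hη.eq_one x (hsub hxB), one_smul]
  have hHB : ∀ᵐ x, x ∈ Metric.ball x₀ R → hHm.mk _ x = G x - Q := by
    filter_upwards [hHm.ae_eq_mk] with x hx hxB
    rw [← hx, hη.eq_one x (hsub hxB), hη.fderiv_eq_zero_of_mem hxB]
    simp
  have hm1 : AEStronglyMeasurable u (volume.restrict (Metric.ball x₀ R)) :=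
    hu1.1.mono_measure (Measure.restrict_mono hsub le_rfl)
  have hm2 : AEStronglyMeasurable G (volume.restrict (Metric.ball x₀ R)) :=
    hu2.1.mono_measure (Measure.restrict_mono hsub le_rfl)
  refine ⟨hvm.mk _, hHm.mk _, ⟨hw.congr_ae hvm.ae_eq_mk hHm.ae_eq_mk, hvm.stronglyMeasurable_mk,
    hHm.stronglyMeasurable_mk, ?_, ?_⟩, hHB⟩
  · obtain ⟨C, hC⟩ := (isCompact_closedBall x₀ R).exists_bound_of_continuousOn
      (ofMat Q).continuous.continuousOn
    have hC0 : 0 ≤ C := (norm_nonneg _).trans (hC x₀ (Metric.mem_closedBall_self hR.le))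
    refine Integrable.mono' (hφ.integrable_phi_add hc₀ hm1 (hu1.2.mono_set hsub) hC0)
      (hφ.continuous_phi_norm.comp_aestronglyMeasurable
        hvm.stronglyMeasurable_mk.aestronglyMeasurable) ?_
    filter_upwards [hvB, ae_restrict_mem measurableSet_ball] with x hx hxB
    rw [hx, Real.norm_of_nonneg (hφ.nonneg (norm_nonneg _))]
    refine hφ.mono (norm_nonneg _) ?_
    have h1 := norm_sub_le (u x) (ofMat Q x)
    have h2 := hC x (hsub hxB)
    linarith
  · refine Integrable.mono' (hφ.integrable_phi_add hc₀ hm2 (hu2.2.mono_set hsub) (norm_nonneg Q))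
      (hφ.continuous_phi_norm.comp_aestronglyMeasurable
        hHm.stronglyMeasurable_mk.aestronglyMeasurable) ?_
    filter_upwards [ae_restrict_of_ae hHB, ae_restrict_mem measurableSet_ball] with x hx hxB
    rw [hx hxB, Real.norm_of_nonneg (hφ.nonneg (norm_nonneg _))]
    refine hφ.mono (norm_nonneg _) ?_
    have h1 := norm_sub_le (G x) Q
    linarith

/-- Minimality tested with a competitor supported in a ball, where `∇u = Q + H`. -/
theorem IsLocalMinimizer.integral_nonneg (hmin : IsLocalMinimizer φ f Ω u G)
    (hf : IsIntegrand Ω φ f k K L β) (hφ : IsRegularNFunction φ c₀ c₁) (hc₀ : 0 < c₀)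
    {x₀ : Vec n} {s ρ : ℝ} (hsρ : s < ρ) (hρ : Metric.ball x₀ ρ ⊆ Ω) {Q : Mat N n}
    {H : Vec n → Mat N n} (hHG : ∀ᵐ x, x ∈ Metric.ball x₀ ρ → H x = G x - Q)
    (hHm : StronglyMeasurable H)
    (hφH : IntegrableOn (fun x => φ ‖H x‖) (Metric.ball x₀ ρ)) {w : Vec n → Vec N}
    {W : Vec n → Mat N n} (hw : HasWeakGradient univ w W)
    (hw0 : ∀ x, x ∉ Metric.closedBall x₀ s → w x = 0)
    (hW0 : ∀ x, x ∉ Metric.closedBall x₀ s → W x = 0)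
    (hφw : IntegrableOn (fun x => φ ‖w x‖) (Metric.ball x₀ ρ))
    (hφW : IntegrableOn (fun x => φ ‖W x‖) (Metric.ball x₀ ρ))
    (hφHW : IntegrableOn (fun x => φ ‖H x - W x‖) (Metric.ball x₀ ρ)) :
    0 ≤ ∫ x in Metric.ball x₀ ρ, (f (Q + (H x - W x)) - f (Q + H x)) := by
  have := isFiniteMeasure_restrict_ball x₀ ρ
  have hsub : Metric.closedBall x₀ s ⊆ Metric.ball x₀ ρ := Metric.closedBall_subset_ball hsρ
  have hsupp : tsupport (fun x => - w x) ⊆ Metric.closedBall x₀ s :=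
    closure_minimal (fun x hx => by
      by_contra hx'
      simp only [Function.mem_support] at hx
      exact hx (by simp [hw0 x hx'])) Metric.isClosed_closedBall
  have hcs : HasCompactSupport fun x => - w x :=
    HasCompactSupport.intro (isCompact_closedBall x₀ s) fun x hx => by simp [hw0 x hx]
  have hext : ∀ g : Vec n → ℝ, (∀ x, x ∉ Metric.closedBall x₀ s → g x = 0) →
      IntegrableOn g (Metric.ball x₀ ρ) → IntegrableOn g Ω := fun g hg hgi => by
    refine ((integrableOn_iff_integrable_of_support_subset fun x hx => ?_).1 hgi).integrableOn
    by_contra hx'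
    exact hx (hg x fun h => hx' (hsub h))
  have hmem : MemSobolev φ Ω (fun x => - w x) (fun x => - W x) := by
    refine ⟨hw.neg.mono (subset_univ _), ⟨?_, ?_⟩, ⟨?_, ?_⟩⟩
    · exact (locallyIntegrableOn_univ.1 hw.neg.locInt).aestronglyMeasurable.restrict
    · simp only [norm_neg]
      exact hext _ (fun x hx => by simp [hw0 x hx, hφ.map_zero]) hφw
    · exact (locallyIntegrableOn_univ.1 hw.neg.locInt_grad).aestronglyMeasurable.restrict
    · simp only [norm_neg]
      exact hext _ (fun x hx => by simp [hW0 x hx, hφ.map_zero]) hφW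
  have hle := hmin.le _ _ hmem hcs (hsupp.trans (hsub.trans hρ))
  set S := tsupport fun x => - w x with hS
  have hSB : S ⊆ Metric.ball x₀ ρ := hsupp.trans hsub
  have hWm : AEStronglyMeasurable W volume :=
    (locallyIntegrableOn_univ.1 hw.locInt_grad).aestronglyMeasurable
  have i1 : IntegrableOn (fun x => f (Q + (H x - W x))) (Metric.ball x₀ ρ) :=
    hf.integrable_comp_add hφ hc₀ (hHm.aestronglyMeasurable.sub hWm).restrict hφHW Q
  have i2 : IntegrableOn (fun x => f (Q + H x)) (Metric.ball x₀ ρ) :=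
    hf.integrable_comp_add hφ hc₀ hHm.aestronglyMeasurable hφH Q
  have hSm : MeasurableSet S := (isClosed_tsupport _).measurableSet
  have e1 : ∫ x in S, f (G x) = ∫ x in S, f (Q + H x) := by
    refine setIntegral_congr_ae hSm ?_
    filter_upwards [hHG] with x hx hxS
    rw [hx (hSB hxS), add_sub_cancel]
  have e2 : ∫ x in S, f (G x + - W x) = ∫ x in S, f (Q + (H x - W x)) := by
    refine setIntegral_congr_ae hSm ?_
    filter_upwards [hHG] with x hx hxS
    rw [hx (hSB hxS)]
    congr 1
    abel
  rw [e1, e2] at hle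
  -- Minimality is stated on the support of the competitor; off that support `W = 0` almost
  -- everywhere, so the integrand vanishes and the ball may be used instead.
  rw [setIntegral_eq_of_subset_of_ae_sdiff_eq_zero measurableSet_ball.nullMeasurableSet hSB ?_,
    integral_sub (i1.mono_set hSB) (i2.mono_set hSB)]
  · linarith
  · filter_upwards [hw.neg.ae_eq_zero_of_notMem_tsupport] with x hx hxS
    have : W x = 0 := by simpa using hx hxS.2
    simp [this]

/-- Caccioppoli inequality before filling the hole. -/
theorem exists_caccioppoli (n N : ℕ) (c₀ c₁ L : ℝ) (hc₀ : 0 < c₀) (hc₁ : 0 < c₁) :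
    ∃ C : ℝ, 0 < C ∧ ∀ {φ : ℝ → ℝ} {Ω : Set (Vec n)} {f : Mat N n → ℝ} {k K β : ℝ}
      {u : Vec n → Vec N} {G : Vec n → Mat N n}, IsRegularNFunction φ c₀ c₁ →
      IsIntegrand Ω φ f k K L β → 0 ≤ k → IsLocalMinimizer φ f Ω u G →
      ∀ {x₀ : Vec n} {s d : ℝ}, 0 < s → 0 < d → Metric.ball x₀ (s + 2 * d) ⊆ Ω →
      ∀ {Q : Mat N n}, Q ≠ 0 → ∀ {v : Vec n → Vec N} {H : Vec n → Mat N n},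
      IsLocalized φ (Metric.ball x₀ (s + 2 * d)) v H →
      (∀ᵐ x, x ∈ Metric.ball x₀ (s + 2 * d) → H x = G x - Q) → ∀ q : Vec N,
      k * ∫ x in Metric.ball x₀ s, shifted φ ‖Q‖ ‖H x‖ ≤
        C * ∫ x in Metric.ball x₀ (s + 2 * d) \ Metric.ball x₀ s,
          (shifted φ ‖Q‖ ‖H x‖ + shifted φ ‖Q‖ (‖v x - q‖ / d)) := by
  obtain ⟨M, hM, hcut⟩ := exists_cutoff n
  set m := ‖toMat N n‖ * M with hm
  have hm0 : 0 ≤ m := by positivity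
  set p := growthExp c₀ with hp
  set C₁ := |L| * (6 + 1 / c₀ * 2 ^ (p + 2)) * 2 ^ (2 * p + 3) with hC₁
  have hC₁0 : 0 ≤ C₁ := by positivity
  set C₂ := 2 ^ (p + 2) * (1 + 2 * m) ^ (p + 2) with hC₂
  have hC₂1 : 1 ≤ C₂ := by
    have h1 : (1 : ℝ) ≤ 2 ^ (p + 2) := one_le_pow₀ (by norm_num)
    have h2 : (1 : ℝ) ≤ (1 + 2 * m) ^ (p + 2) := one_le_pow₀ (by linarith)
    nlinarith
  -- The summand `1` keeps the constant positive even when `C₁` vanishes.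
  refine ⟨C₁ * (4 ^ (p + 2) * C₂) + 1, by positivity, ?_⟩
  intro φ Ω f k K β u G hφ hf hk hmin x₀ s d hs hd hB Q hQ v H hloc hHG q
  set ρ := s + 2 * d with hρ
  set a := ‖Q‖ with ha
  have ha0 : 0 ≤ a := norm_nonneg Q
  have := isFiniteMeasure_restrict_ball x₀ ρ
  obtain ⟨η, hη⟩ := hcut x₀ s d hs.le hd
  have hvq := hloc.weakGrad.sub_const q
  have hw := hvq.cutoff_smul hη.contDiff hη.hasCompactSupport (subset_univ _)
  set w := fun x => η x • (v x - q) with hwdef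
  set T := fun x => toMat N n ((fderiv ℝ η x).smulRight (v x - q)) with hT
  set W := fun x => η x • H x + T x with hW
  have hw' : HasWeakGradient univ w W := hw
  have hTn : ∀ x, ‖T x‖ ≤ m * (‖v x - q‖ / d) := by
    intro x
    refine (norm_toMat_smulRight_le _ _).trans ?_
    calc ‖toMat N n‖ * (‖fderiv ℝ η x‖ * ‖v x - q‖) ≤ ‖toMat N n‖ * (M / d * ‖v x - q‖) := by
          gcongr
          exact hη.norm_fderiv_le x
      _ = _ := by rw [hm]; ring
  have hw0 : ∀ x, x ∉ Metric.closedBall x₀ (s + d) → w x = 0 := fun x hx => by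
    simp [hwdef, hη.eq_zero x hx]
  have hW0 : ∀ x, x ∉ Metric.closedBall x₀ (s + d) → W x = 0 := fun x hx => by
    simp [hW, hT, hη.eq_zero x hx, hη.fderiv_eq_zero_of_notMem hx]
  have hWm : AEStronglyMeasurable W volume :=
    (locallyIntegrableOn_univ.1 hw'.locInt_grad).aestronglyMeasurable
  have hwm : AEStronglyMeasurable w volume :=
    (locallyIntegrableOn_univ.1 hw'.locInt).aestronglyMeasurable
  have hηH : ∀ x, ‖η x • H x‖ = η x * ‖H x‖ := fun x => by
    rw [norm_smul, Real.norm_of_nonneg (hη.nonneg x)]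
  have hZ : ∀ x, H x - W x = (1 - η x) • H x - T x := fun x => by
    simp only [hW, sub_smul, one_smul]; abel
  have hZn : ∀ x, ‖H x - W x‖ ≤ (1 - η x) * ‖H x‖ + ‖T x‖ := fun x => by
    rw [hZ]
    refine (norm_sub_le _ _).trans (le_of_eq ?_)
    rw [norm_smul, Real.norm_of_nonneg (sub_nonneg.2 (hη.le_one x))]
  have hWn : ∀ x, ‖W x‖ ≤ η x * ‖H x‖ + ‖T x‖ := fun x =>
    (norm_add_le _ _).trans (le_of_eq (by rw [hηH]))
  -- The weights `η` and `1 - η` add up to one, so `H` is counted once and the cut-off term twice.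
  have hsum : ∀ x, ‖W x‖ + ‖H x - W x‖ ≤ ‖H x‖ + 2 * m * (‖v x - q‖ / d) := fun x => by
    have h1 := hWn x
    have h2 := hZn x
    have h3 := hTn x
    nlinarith
  -- integrability
  set b := fun x => ‖H x‖ + 2 * m * (‖v x - q‖ / d) with hb
  have hb0 : ∀ x, 0 ≤ b x := fun x => by positivity
  have hvqm : AEStronglyMeasurable (fun x => v x - q) volume :=
    hloc.meas.aestronglyMeasurable.sub aestronglyMeasurable_const
  have hSv : ∀ {a c : ℝ}, 0 ≤ a → 0 ≤ c →
      IntegrableOn (fun x => shifted φ a (c * ‖v x - q‖)) (Metric.ball x₀ ρ) := by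
    intro a c ha hc
    exact hφ.integrable_shifted_mul_norm_sub hc₀ hloc.meas.aestronglyMeasurable
      hloc.integrableOn ha hc q
  have hSH : ∀ {a : ℝ}, 0 ≤ a →
      IntegrableOn (fun x => shifted φ a ‖H x‖) (Metric.ball x₀ ρ) := by
    intro a ha
    have h1 := hφ.integrable_shifted_norm_sub hc₀ hloc.meas_grad.aestronglyMeasurable
      hloc.integrableOn_grad ha 0
    simp only [sub_zero] at h1
    exact h1
  have hdiv : ∀ x, ‖v x - q‖ / d = d⁻¹ * ‖v x - q‖ := fun x => div_eq_inv_mul _ _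
  have hSb : IntegrableOn (fun x => shifted φ 0 (b x)) (Metric.ball x₀ ρ) := by
    have h1 := ((hSH (a := 0) le_rfl).add (hSv (a := 0) (c := 2 * m * d⁻¹) le_rfl
      (by positivity))).const_mul (4 ^ (p + 2))
    refine Integrable.mono' h1 ?_ (Eventually.of_forall fun x => ?_)
    · have : AEStronglyMeasurable b volume := hloc.meas_grad.aestronglyMeasurable.norm.add
        ((hvqm.norm.mul_const d⁻¹).const_mul (2 * m))
      have := (hφ.continuous_shifted_norm le_rfl (E := ℝ)).comp_aestronglyMeasurable this
      simp only [Real.norm_of_nonneg (hb0 _)] at this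
      exact this.restrict
    · rw [Real.norm_of_nonneg (hφ.shifted_nonneg le_rfl (hb0 x))]
      have := hφ.shifted_add_le hc₀ le_rfl (s := ‖H x‖) (t := 2 * m * d⁻¹ * ‖v x - q‖)
        (norm_nonneg _) (by positivity)
      simpa [hb, hdiv, mul_assoc] using this
  have hφle : ∀ {E : Type} [NormedAddCommGroup E] {g : Vec n → E},
      AEStronglyMeasurable g volume → (∀ x, ‖g x‖ ≤ b x) →
      IntegrableOn (fun x => φ ‖g x‖) (Metric.ball x₀ ρ) := by
    intro E _ g hg hgb
    refine Integrable.mono' hSb (hφ.continuous_phi_norm.comp_aestronglyMeasurable hg).restrict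
      (Eventually.of_forall fun x => ?_)
    rw [Real.norm_of_nonneg (hφ.nonneg (norm_nonneg _)), hφ.shifted_zero_left (hb0 x)]
    exact hφ.mono (norm_nonneg _) (hgb x)
  have hφW := hφle hWm fun x => by linarith [hsum x, norm_nonneg (H x - W x)]
  have hφHW := hφle (hloc.meas_grad.aestronglyMeasurable.sub hWm)
    fun x => by
      have := hsum x
      have := norm_nonneg (W x)
      simp only [Pi.sub_apply]
      linarith
  have hφw : IntegrableOn (fun x => φ ‖w x‖) (Metric.ball x₀ ρ) := by
    have h1 := hSv (a := 0) (c := 1) le_rfl zero_le_one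
    refine Integrable.mono' h1 (hφ.continuous_phi_norm.comp_aestronglyMeasurable hwm).restrict
      (Eventually.of_forall fun x => ?_)
    rw [Real.norm_of_nonneg (hφ.nonneg (norm_nonneg _)), one_mul,
      hφ.shifted_zero_left (norm_nonneg _)]
    refine hφ.mono (norm_nonneg _) ?_
    simp only [hwdef]
    rw [norm_smul, Real.norm_of_nonneg (hη.nonneg x)]
    exact mul_le_of_le_one_left (norm_nonneg _) (hη.le_one x)
  -- quasiconvexity and minimality
  have hsd : 0 < s + d := by linarith
  have hsdρ : s + d < ρ := by rw [hρ]; linarith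
  have hqc := hf.quasiconvex_sobolev hφ hc₀ hk hsd hsdρ hB Q hw' hw0 hW0 hφW
  have hmi := hmin.integral_nonneg hf hφ hc₀ hsdρ hB hHG hloc.meas_grad hloc.integrableOn_grad
    hw' hw0 hW0 hφw hφW hφHW
  have i1 : IntegrableOn (fun x => f (Q + W x) - f Q) (Metric.ball x₀ ρ) :=
    (hf.integrable_comp_add hφ hc₀ hWm.restrict hφW Q).sub (integrable_const _)
  have i2 : IntegrableOn (fun x => f (Q + (H x - W x)) - f (Q + H x)) (Metric.ball x₀ ρ) :=
    (hf.integrable_comp_add hφ hc₀ (hloc.meas_grad.aestronglyMeasurable.sub hWm).restrict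
      hφHW Q).sub
    (hf.integrable_comp_add hφ hc₀ hloc.meas_grad.aestronglyMeasurable hloc.integrableOn_grad Q)
  -- Quasiconvexity for `η(v - q)` and minimality against subtracting it from `u` add up to `k ∫
  -- φ_a(|W|) ≤ ∫ D`. The integrand `D` is the second difference of `f` at `Q` with increments `W`
  -- and `H - W`. It vanishes on the inner ball, where `W = H`, so only the annulus contributes.
  set D := fun x => f (Q + W x) - f Q + (f (Q + (H x - W x)) - f (Q + H x)) with hD
  have hkD : k * ∫ x in Metric.ball x₀ ρ, shifted φ a ‖W x‖ ≤ ∫ x in Metric.ball x₀ ρ, D x := by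
    simp only [hD]
    rw [integral_add i1 i2]
    linarith
  have hsρ : Metric.ball x₀ s ⊆ Metric.ball x₀ ρ := Metric.ball_subset_ball (by linarith)
  have hWs : ∀ x ∈ Metric.ball x₀ s, W x = H x := fun x hx => by
    simp [hW, hT, hη.eq_one x (Metric.ball_subset_closedBall hx), hη.fderiv_eq_zero_of_mem hx]
  have hleft : ∫ x in Metric.ball x₀ s, shifted φ a ‖H x‖ ≤
      ∫ x in Metric.ball x₀ ρ, shifted φ a ‖W x‖ := by
    have h1 : ∫ x in Metric.ball x₀ s, shifted φ a ‖H x‖ =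
        ∫ x in Metric.ball x₀ s, shifted φ a ‖W x‖ :=
      setIntegral_congr_fun measurableSet_ball fun x hx => by simp only [hWs x hx]
    rw [h1]
    refine setIntegral_mono_set ?_ (Eventually.of_forall fun x =>
      hφ.shifted_nonneg ha0 (norm_nonneg _)) hsρ.eventuallyLE
    have := hφ.integrable_shifted_norm_sub hc₀ hWm.restrict hφW ha0 0
    simp only [sub_zero] at this
    exact this
  have hDs : ∀ x ∈ Metric.ball x₀ s, D x = 0 := fun x hx => by
    simp only [hD, hWs x hx]
    simp
  have hDle : ∀ x, D x ≤ (C₁ * (4 ^ (p + 2) * C₂)) *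
      (shifted φ a ‖H x‖ + shifted φ a (‖v x - q‖ / d)) := by
    intro x
    have h1 := hf.abs_second_difference_le hφ hc₀ hc₁ hQ (W x) (H x - W x)
    have h2 : D x = f (Q + W x) - f Q - f (Q + W x + (H x - W x)) + f (Q + (H x - W x)) := by
      simp only [hD]
      rw [show Q + W x + (H x - W x) = Q + H x by abel]
      ring
    have hq0 : 0 ≤ ‖v x - q‖ / d := by positivity
    have h3 : shifted φ a (‖W x‖ + ‖H x - W x‖) ≤
        4 ^ (p + 2) * C₂ * (shifted φ a ‖H x‖ + shifted φ a (‖v x - q‖ / d)) := by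
      have h4 := (hφ.shifted_mono ha0 (by positivity) (hsum x)).trans
        (hφ.shifted_add_le hc₀ ha0 (norm_nonneg (H x)) (by positivity))
      have h5 : shifted φ a (2 * m * (‖v x - q‖ / d)) ≤ C₂ * shifted φ a (‖v x - q‖ / d) := by
        refine (hφ.shifted_mono ha0 (by positivity) ?_).trans
          (hφ.shifted_mul_le hc₀ ha0 (l := 1 + 2 * m) (by linarith) hq0)
        nlinarith
      have h6 : shifted φ a ‖H x‖ ≤ C₂ * shifted φ a ‖H x‖ :=
        le_mul_of_one_le_left (hφ.shifted_nonneg ha0 (norm_nonneg _)) hC₂1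
      calc _ ≤ _ := h4
        _ ≤ 4 ^ (p + 2) * (C₂ * shifted φ a ‖H x‖ + C₂ * shifted φ a (‖v x - q‖ / d)) := by
            gcongr
        _ = _ := by ring
    have h7 : 0 ≤ shifted φ a (‖W x‖ + ‖H x - W x‖) := hφ.shifted_nonneg ha0 (by positivity)
    have h8 : L * (6 + 1 / c₀ * 2 ^ (p + 2)) * 2 ^ (2 * p + 3) ≤ C₁ := by
      rw [hC₁]
      gcongr
      exact le_abs_self L
    calc D x ≤ |D x| := le_abs_self _
      _ ≤ L * (6 + 1 / c₀ * 2 ^ (p + 2)) * 2 ^ (2 * p + 3) *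
          shifted φ a (‖W x‖ + ‖H x - W x‖) := by rw [h2]; exact h1
      _ ≤ C₁ * shifted φ a (‖W x‖ + ‖H x - W x‖) := mul_le_mul_of_nonneg_right h8 h7
      _ ≤ C₁ * (4 ^ (p + 2) * C₂ * (shifted φ a ‖H x‖ + shifted φ a (‖v x - q‖ / d))) :=
          mul_le_mul_of_nonneg_left h3 hC₁0
      _ = _ := by ring
  have iS : IntegrableOn (fun x => shifted φ a ‖H x‖ + shifted φ a (‖v x - q‖ / d))
      (Metric.ball x₀ ρ) := by
    have h1 := hSv (a := a) (c := d⁻¹) ha0 (by positivity)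
    simp only [← hdiv] at h1
    exact (hSH ha0).add h1
  have hS0 : 0 ≤ ∫ x in Metric.ball x₀ ρ \ Metric.ball x₀ s,
      (shifted φ a ‖H x‖ + shifted φ a (‖v x - q‖ / d)) :=
    MeasureTheory.integral_nonneg fun x => add_nonneg (hφ.shifted_nonneg ha0 (norm_nonneg _))
      (hφ.shifted_nonneg ha0 (by positivity))
  have hDm : IntegrableOn D (Metric.ball x₀ ρ) := i1.add i2
  have e1 : ∫ x in Metric.ball x₀ ρ, D x = ∫ x in Metric.ball x₀ ρ \ Metric.ball x₀ s, D x := by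
    refine setIntegral_eq_of_subset_of_forall_sdiff_eq_zero measurableSet_ball sdiff_subset
      fun x hx => hDs x ?_
    by_contra hx'
    exact hx.2 ⟨hx.1, hx'⟩
  calc k * ∫ x in Metric.ball x₀ s, shifted φ a ‖H x‖
      ≤ k * ∫ x in Metric.ball x₀ ρ, shifted φ a ‖W x‖ := mul_le_mul_of_nonneg_left hleft hk
    _ ≤ ∫ x in Metric.ball x₀ ρ \ Metric.ball x₀ s, D x := by rw [← e1]; exact hkD
    _ ≤ ∫ x in Metric.ball x₀ ρ \ Metric.ball x₀ s, (C₁ * (4 ^ (p + 2) * C₂)) *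
      (shifted φ a ‖H x‖ + shifted φ a (‖v x - q‖ / d)) :=
        setIntegral_mono (hDm.mono_set sdiff_subset)
          ((iS.mono_set sdiff_subset).const_mul _) hDle
    _ = (C₁ * (4 ^ (p + 2) * C₂)) * ∫ x in Metric.ball x₀ ρ \ Metric.ball x₀ s,
      (shifted φ a ‖H x‖ + shifted φ a (‖v x - q‖ / d)) := integral_const_mul _ _
    _ ≤ _ := by
        refine mul_le_mul_of_nonneg_right ?_ hS0
        linarith

end OrliczGrowth

/-! ### Iteration, oscillation and the reverse Hölder inequality. -/

namespace OrliczGrowth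

variable {N n : ℕ} {φ : ℝ → ℝ} {c₀ c₁ : ℝ}

theorem volume_real_ball (x : Vec n) {R : ℝ} (hR : 0 < R) :
    volume.real (Metric.ball x R) = R ^ n * volume.real (Metric.ball (0 : Vec n) 1) := by
  rw [measureReal_def, Measure.addHaar_ball_of_pos _ _ hR, ENNReal.toReal_mul,
    ENNReal.toReal_ofReal (by positivity), finrank_euclideanSpace, Fintype.card_fin,
    measureReal_def]

/-- The standard iteration lemma. -/
theorem exists_iteration (θ : ℝ) (hθ0 : 0 ≤ θ) (hθ1 : θ < 1) (m : ℕ) :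
    ∃ C : ℝ, 0 < C ∧ ∀ (X : ℝ → ℝ) (r A M : ℝ), 0 < r → 0 ≤ A →
      (∀ s ∈ Icc r (2 * r), 0 ≤ X s) → (∀ s ∈ Icc r (2 * r), X s ≤ M) →
      (∀ s ∈ Icc r (2 * r), ∀ t ∈ Icc r (2 * r), s < t →
        X s ≤ θ * X t + A * (r / (t - s)) ^ m) → X r ≤ C * A := by
  -- Choose `e` so small that `θ < (1 + θ)/2 · (1 - e)^m`: the weight lost between a radius and the
  -- next one still leaves a contraction factor below `1`.
  have htend : Tendsto (fun e : ℝ => (1 + θ) / 2 * (1 - e) ^ m) (𝓝[>] 0)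
      (𝓝 ((1 + θ) / 2 * (1 - 0) ^ m)) := by
    have : Continuous fun e : ℝ => (1 + θ) / 2 * (1 - e) ^ m := by fun_prop
    exact (this.tendsto 0).mono_left nhdsWithin_le_nhds
  have hlt : θ < (1 + θ) / 2 * (1 - 0) ^ m := by simp; linarith
  obtain ⟨e, he, he01⟩ := ((htend.eventually (lt_mem_nhds hlt)).and
    (Ioo_mem_nhdsGT (zero_lt_one' ℝ))).exists
  obtain ⟨he0, he1⟩ := he01
  refine ⟨2 * (1 / e) ^ m / (1 - θ), div_pos (by positivity) (by linarith), ?_⟩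
  intro X r A M hr hA hX0 hXM hX
  -- The weight compensates the blow-up of `(t - s)^(-m)`. With `t = s + e(2r - s)` the supremum `S`
  -- of `Y` satisfies `S ≤ (1 + θ)/2 · S + A e^(-m)`, and `S` is finite thanks to the a priori bound
  -- `M`.
  set Y : ℝ → ℝ := fun s => ((2 * r - s) / r) ^ m * X s with hY
  have hYbdd : BddAbove (Y '' Ico r (2 * r)) := by
    refine ⟨M, ?_⟩
    rintro _ ⟨s, hs, rfl⟩
    have hs' : s ∈ Icc r (2 * r) := ⟨hs.1, hs.2.le⟩
    have h1 : ((2 * r - s) / r) ^ m ≤ 1 := by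
      refine pow_le_one₀ (div_nonneg (by linarith [hs.2]) hr.le) ?_
      rw [div_le_one hr]; linarith [hs.1]
    exact (mul_le_of_le_one_left (hX0 s hs') h1).trans (hXM s hs')
  have hne : (Y '' Ico r (2 * r)).Nonempty := ⟨_, r, ⟨le_rfl, by linarith⟩, rfl⟩
  set S := sSup (Y '' Ico r (2 * r)) with hS
  have hYS : ∀ s ∈ Ico r (2 * r), Y s ≤ S := fun s hs => le_csSup hYbdd ⟨s, hs, rfl⟩
  have hS0 : 0 ≤ S := by
    refine le_trans ?_ (hYS r ⟨le_rfl, by linarith⟩)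
    exact mul_nonneg (pow_nonneg (div_nonneg (by linarith) hr.le) _) (hX0 r ⟨le_rfl, by linarith⟩)
  have hstep : S ≤ (1 + θ) / 2 * S + A * (1 / e) ^ m := by
    refine csSup_le hne ?_
    rintro _ ⟨s, hs, rfl⟩
    set z := 2 * r - s with hz
    have hz0 : 0 < z := by rw [hz]; linarith [hs.2]
    set t := s + e * z with ht
    have hst : s < t := by rw [ht]; nlinarith
    have h2t : 2 * r - t = (1 - e) * z := by rw [ht, hz]; ring
    have ht2 : t < 2 * r := by nlinarith
    have htm : t ∈ Ico r (2 * r) := ⟨hs.1.trans hst.le, ht2⟩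
    have h1 := hX s ⟨hs.1, hs.2.le⟩ t ⟨htm.1, htm.2.le⟩ hst
    have hts : t - s = e * z := by rw [ht]; ring
    rw [hts] at h1
    have hYt := hYS t htm
    simp only [hY, h2t] at hYt
    have hXt := hX0 t ⟨htm.1, htm.2.le⟩
    have h2 : θ * ((z / r) ^ m * X t) ≤ (1 + θ) / 2 * S := by
      have h3 : (1 - e) ^ m * ((z / r) ^ m * X t) ≤ S := by
        refine le_trans (le_of_eq ?_) hYt
        rw [mul_div_assoc, mul_pow]; ring
      calc θ * ((z / r) ^ m * X t) ≤ (1 + θ) / 2 * (1 - e) ^ m * ((z / r) ^ m * X t) := by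
            gcongr
        _ = (1 + θ) / 2 * ((1 - e) ^ m * ((z / r) ^ m * X t)) := by ring
        _ ≤ _ := by gcongr
    have h4 : (z / r) ^ m * (r / (e * z)) ^ m = (1 / e) ^ m := by
      rw [← mul_pow]; congr 1; field_simp
    calc Y s = (z / r) ^ m * X s := rfl
      _ ≤ (z / r) ^ m * (θ * X t + A * (r / (e * z)) ^ m) := by gcongr
      _ = θ * ((z / r) ^ m * X t) + A * ((z / r) ^ m * (r / (e * z)) ^ m) := by ring
      _ ≤ _ := by rw [h4]; gcongr
  have hXr : X r ≤ S := by
    have := hYS r ⟨le_rfl, by linarith⟩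
    have h1 : (2 * r - r) / r = 1 := by field_simp; ring
    simpa [hY, h1] using this
  refine hXr.trans ?_
  rw [div_mul_eq_mul_div, le_div_iff₀ (by linarith)]
  linarith

/-- Oscillation of a Sobolev function at scale `d`, in terms of a small multiple of the energy of its
gradient and of the mean value of its gradient. -/
theorem IsLocalized.exists_oscillation_le (h : IsRegularNFunction φ c₀ c₁) (hc₀ : 0 < c₀)
    {a : ℝ} (ha : 0 ≤ a) {x₀ : Vec n} {R : ℝ} {v : Vec n → Vec N} {H : Vec n → Mat N n}
    (hloc : IsLocalized φ (Metric.ball x₀ R) v H) {μ d ρ : ℝ} (hμ : 0 < μ) (hμ1 : μ ≤ 1)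
    (hd : 0 < d) (hρ : 0 < ρ) (hρR : ρ + 2 * (μ * d) ≤ R) :
    ∃ q : Vec N, ∫ x in Metric.ball x₀ ρ, shifted φ a (‖v x - q‖ / d) ≤
      4 ^ (growthExp c₀ + 2) * (μ * ∫ x in Metric.ball x₀ (ρ + 2 * (μ * d)), shifted φ a ‖H x‖) +
        4 ^ (growthExp c₀ + 2) * (volume.real (Metric.ball x₀ R) *
          shifted φ a (R / d * (2 * R / (μ * d)) ^ n * ⨍ x in Metric.ball x₀ R, ‖H x‖)) := by
  set κ := μ * d with hκdef
  have hκ : 0 < κ := by positivity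
  have hR : 0 < R := by linarith
  have := isFiniteMeasure_restrict_ball x₀ ρ
  have := isFiniteMeasure_restrict_ball x₀ R
  have hvl : LocallyIntegrable v := locallyIntegrableOn_univ.1 hloc.weakGrad.locInt
  have hHl : LocallyIntegrable H := locallyIntegrableOn_univ.1 hloc.weakGrad.locInt_grad
  set ψ : ContDiffBump (0 : Vec n) := bumpSeq n κ hκ 0 with hψ
  have hrOut : ψ.rOut = κ := by show κ / ((0 : ℕ) + 1) = κ; simp
  have hrIn : ψ.rIn = κ / 2 := by show κ / 2 / ((0 : ℕ) + 1) = κ / 2; simp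
  have hsm : ContDiff ℝ 1 (mollify ψ v) :=
    (contDiff_mollify _ hvl).of_le (by exact_mod_cast le_top)
  -- Split `v - q` into the distance to the mollification at scale `κ = μd` and the oscillation of
  -- the mollification around its value at the centre.
  set q := mollify ψ v x₀ with hq
  set t₀ := ⨍ x in Metric.ball x₀ R, ‖H x‖ with ht₀
  have ht₀0 : 0 ≤ t₀ := by
    rw [ht₀, setAverage_eq]
    exact mul_nonneg (by positivity) (integral_nonneg fun x => norm_nonneg _)
  have hHint : IntegrableOn H (Metric.ball x₀ R) :=
    (hHl.integrableOn_isCompact (isCompact_closedBall x₀ R)).mono_set Metric.ball_subset_closedBall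
  -- The factor `(2R/κ)^n` is the ratio of the volumes of the balls of radius `R` and `κ/2`, the
  -- latter being the inner ball of the kernel.
  have hg : ∀ x ∈ Metric.ball x₀ ρ, ‖mollify ψ H x‖ ≤ (2 * R / κ) ^ n * t₀ := by
    intro x hx
    refine (norm_mollify_le_setIntegral ψ (A := Metric.ball x₀ R) ?_ measurableSet_ball
      hHint).trans (le_of_eq ?_)
    · rw [hrOut]
      refine Metric.ball_subset_ball' ?_
      have := Metric.mem_ball.1 hx
      linarith
    · have hvol : 0 < volume.real (Metric.ball (0 : Vec n) 1) :=
        ENNReal.toReal_pos (Metric.measure_ball_pos _ _ one_pos).ne' measure_ball_lt_top.ne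
      rw [ht₀, setAverage_eq, hrIn, Measure.addHaar_real_closedBall _ _ (by positivity),
        volume_real_ball _ hR, smul_eq_mul, finrank_euclideanSpace, Fintype.card_fin,
        div_pow, mul_pow, div_pow]
      field_simp
      rw [hκdef]
      ring
  have hdiff : ∀ x ∈ Metric.ball x₀ ρ, ‖mollify ψ v x - q‖ ≤ (2 * R / κ) ^ n * t₀ * R := by
    intro x hx
    have h1 := (convex_ball x₀ ρ).norm_image_sub_le_of_norm_hasFDerivWithin_le
      (f := mollify ψ v) (f' := fderiv ℝ (mollify ψ v)) (C := (2 * R / κ) ^ n * t₀)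
      (fun y _ => ((hsm.differentiable (by norm_num)) y).hasFDerivAt.hasFDerivWithinAt)
      (fun y hy => ContinuousLinearMap.opNorm_le_bound _ (by positivity) fun z => ?_)
      (Metric.mem_ball_self hρ) hx
    · refine h1.trans (mul_le_mul_of_nonneg_left ?_ (by positivity))
      have := Metric.mem_ball.1 hx
      rw [dist_eq_norm] at this
      linarith
    · refine (norm_fderiv_apply_le _ _ _).trans (mul_le_mul_of_nonneg_right ?_ (norm_nonneg z))
      rw [hloc.weakGrad.grad_mollify]
      exact hg y hy
  have hSH : IntegrableOn (fun x => shifted φ a ‖H x‖) (Metric.ball x₀ R) := by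
    have h1 := h.integrable_shifted_norm_sub hc₀ hloc.meas_grad.aestronglyMeasurable
      hloc.integrableOn_grad ha 0
    simp only [sub_zero] at h1
    exact h1
  -- the distance to the mollification
  have hmol := h.lintegral_shifted_sub_mollify_le ha hloc.weakGrad hloc.meas hloc.meas_grad hκ ψ
    hrOut.le x₀ ρ
  have hmeas : AEStronglyMeasurable (fun x => shifted φ a (‖v x - mollify ψ v x‖ / κ))
      (volume.restrict (Metric.ball x₀ ρ)) := by
    have := (h.continuous_shifted_norm ha (E := Vec N)).comp_aestronglyMeasurable
      ((hloc.meas.sub hsm.continuous.stronglyMeasurable).const_smul κ⁻¹).aestronglyMeasurable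
      (μ := volume.restrict (Metric.ball x₀ ρ))
    simpa [norm_smul, abs_of_pos hκ, div_eq_inv_mul] using this
  have hSt : IntegrableOn (fun x => shifted φ a ‖H x‖) (Metric.ball x₀ (ρ + 2 * κ)) :=
    hSH.mono_set (Metric.ball_subset_ball hρR)
  have hpos : ∀ x, 0 ≤ shifted φ a (‖v x - mollify ψ v x‖ / κ) := fun x =>
    h.shifted_nonneg ha (by positivity)
  rw [← ofReal_integral_eq_lintegral_ofReal hSt
    (Eventually.of_forall fun x => h.shifted_nonneg ha (norm_nonneg _))] at hmol
  have hmi : IntegrableOn (fun x => shifted φ a (‖v x - mollify ψ v x‖ / κ))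
      (Metric.ball x₀ ρ) := by
    refine ⟨hmeas, ?_⟩
    rw [hasFiniteIntegral_iff_ofReal (Eventually.of_forall hpos)]
    exact hmol.trans_lt ENNReal.ofReal_lt_top
  rw [← ofReal_integral_eq_lintegral_ofReal hmi (Eventually.of_forall hpos),
    ENNReal.ofReal_le_ofReal_iff (integral_nonneg fun x => h.shifted_nonneg ha (norm_nonneg _))]
    at hmol
  set c := shifted φ a (R / d * (2 * R / κ) ^ n * t₀) with hc
  have hc0 : 0 ≤ c := h.shifted_nonneg ha (by positivity)
  refine ⟨q, ?_⟩
  have hpt : ∀ x ∈ Metric.ball x₀ ρ, shifted φ a (‖v x - q‖ / d) ≤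
      4 ^ (growthExp c₀ + 2) * (μ * shifted φ a (‖v x - mollify ψ v x‖ / κ)) +
        4 ^ (growthExp c₀ + 2) * c := by
    intro x hx
    have h1 : ‖v x - q‖ / d ≤ ‖v x - mollify ψ v x‖ / d + R / d * (2 * R / κ) ^ n * t₀ := by
      have h2 := norm_add_le (v x - mollify ψ v x) (mollify ψ v x - q)
      rw [sub_add_sub_cancel] at h2
      have h3 := hdiff x hx
      calc ‖v x - q‖ / d ≤ (‖v x - mollify ψ v x‖ + (2 * R / κ) ^ n * t₀ * R) / d := by
            gcongr; linarith
        _ = _ := by ring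
    -- The natural scale of this difference is `κ`, not `d`; by convexity the ratio `μ ≤ 1` comes
    -- out of `φ_a` as a factor.
    have h4 : ‖v x - mollify ψ v x‖ / d = μ * (‖v x - mollify ψ v x‖ / κ) := by
      rw [hκdef]; field_simp
    refine (h.shifted_mono ha (by positivity) h1).trans
      ((h.shifted_add_le hc₀ ha (by positivity) (by positivity)).trans ?_)
    rw [mul_add, h4]
    gcongr
    exact h.shifted_mul_le_of_le_one ha hμ.le hμ1 (by positivity)
  have hvi : IntegrableOn (fun x => shifted φ a (‖v x - q‖ / d)) (Metric.ball x₀ ρ) := by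
    have h1 := h.integrable_shifted_mul_norm_sub hc₀ hloc.meas.aestronglyMeasurable
      hloc.integrableOn ha (c := d⁻¹) (by positivity) q
    simp only [← div_eq_inv_mul] at h1
    exact IntegrableOn.mono_set h1 (Metric.ball_subset_ball (by linarith))
  have h5 := setIntegral_mono_on hvi
    (((hmi.const_mul μ).const_mul (4 ^ (growthExp c₀ + 2))).add
      (integrable_const (4 ^ (growthExp c₀ + 2) * c))) measurableSet_ball hpt
  refine h5.trans ?_
  simp only [Pi.add_apply]
  rw [integral_add ((hmi.const_mul μ).const_mul _) (integrable_const _), integral_const_mul,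
    integral_const_mul, setIntegral_const, smul_eq_mul]
  have hvol : volume.real (Metric.ball x₀ ρ) ≤ volume.real (Metric.ball x₀ R) :=
    measureReal_mono (Metric.ball_subset_ball (by linarith)) measure_ball_lt_top.ne
  have h6 : volume.real (Metric.ball x₀ ρ) * (4 ^ (growthExp c₀ + 2) * c) ≤
      4 ^ (growthExp c₀ + 2) * (volume.real (Metric.ball x₀ R) * c) := by
    calc _ ≤ volume.real (Metric.ball x₀ R) * (4 ^ (growthExp c₀ + 2) * c) := by gcongr
      _ = _ := by ring
  gcongr

/-- Reverse Hölder inequality with the mean value of the gradient on the right-hand side. -/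
theorem exists_reverse_holder (n N : ℕ) (c₀ c₁ k L : ℝ) (hc₀ : 0 < c₀) (hc₁ : 0 < c₁)
    (hk : 0 < k) :
    ∃ C : ℝ, 0 < C ∧ ∀ {φ : ℝ → ℝ} {Ω : Set (Vec n)} {f : Mat N n → ℝ} {K β : ℝ}
      {u : Vec n → Vec N} {G : Vec n → Mat N n}, IsRegularNFunction φ c₀ c₁ →
      IsIntegrand Ω φ f k K L β → IsLocalMinimizer φ f Ω u G →
      ∀ {x₀ : Vec n} {r : ℝ}, 0 < r → Metric.ball x₀ (2 * r) ⊆ Ω →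
      ∀ {Q : Mat N n}, Q ≠ 0 → ∀ {v : Vec n → Vec N} {H : Vec n → Mat N n},
      IsLocalized φ (Metric.ball x₀ (2 * r)) v H →
      (∀ᵐ x, x ∈ Metric.ball x₀ (2 * r) → H x = G x - Q) →
      ∫ x in Metric.ball x₀ r, shifted φ ‖Q‖ ‖H x‖ ≤
        C * (volume.real (Metric.ball x₀ (2 * r)) *
          shifted φ ‖Q‖ (⨍ x in Metric.ball x₀ (2 * r), ‖H x‖)) := by
  obtain ⟨C₁, hC₁, hcac⟩ := exists_caccioppoli n N c₀ c₁ L hc₀ hc₁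
  set p := growthExp c₀ with hp
  -- Chosen so that the energy produced by the oscillation estimate uses up at most `k/2` of the
  -- coercivity.
  set μ := min 1 (k / (2 * C₁ * 4 ^ (p + 2))) with hμdef
  have hμ : 0 < μ := lt_min one_pos (by positivity)
  have hμ1 : μ ≤ 1 := min_le_left _ _
  have hμk : C₁ * (4 ^ (p + 2) * μ) ≤ k / 2 := by
    have h1 : μ ≤ k / (2 * C₁ * 4 ^ (p + 2)) := min_le_right _ _
    rw [le_div_iff₀ (by positivity)] at h1
    linarith
  -- In the numerator, `C₁` comes from the annulus and `k/2` from the oscillation term; in the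
  -- denominator, `C₁` is the filled hole.
  set θ := (C₁ + k / 2) / (C₁ + k) with hθ
  have hθ0 : 0 ≤ θ := by positivity
  have hθ1 : θ < 1 := by rw [hθ, div_lt_one (by positivity)]; linarith
  -- The oscillation estimate produces `(r/(t - s))^(n+1)` inside `φ_a`, and taking it out raises it
  -- to the power `p + 2`.
  obtain ⟨C₂, hC₂, hit⟩ := exists_iteration θ hθ0 hθ1 ((n + 1) * (p + 2))
  set C₃ := C₁ * 4 ^ (p + 2) * (2 ^ (p + 2) * (8 * (16 / μ) ^ n) ^ (p + 2)) / (C₁ + k) with hC₃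
  have hC₃0 : 0 < C₃ := by positivity
  refine ⟨C₂ * C₃, by positivity, ?_⟩
  intro φ Ω f K β u G hφ hf hmin x₀ r hr hB Q hQ v H hloc hHG
  set a := ‖Q‖ with ha
  have ha0 : 0 ≤ a := norm_nonneg Q
  set X : ℝ → ℝ := fun s => ∫ x in Metric.ball x₀ s, shifted φ a ‖H x‖ with hX
  set t₀ := ⨍ x in Metric.ball x₀ (2 * r), ‖H x‖ with ht₀
  have ht₀0 : 0 ≤ t₀ := by
    rw [ht₀, setAverage_eq]
    exact mul_nonneg (by positivity) (integral_nonneg fun x => norm_nonneg _)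
  set vol := volume.real (Metric.ball x₀ (2 * r)) with hvol
  have hvol0 : 0 ≤ vol := measureReal_nonneg
  have := isFiniteMeasure_restrict_ball x₀ (2 * r)
  have hSH : IntegrableOn (fun x => shifted φ a ‖H x‖) (Metric.ball x₀ (2 * r)) := by
    have h1 := hφ.integrable_shifted_norm_sub hc₀ hloc.meas_grad.aestronglyMeasurable
      hloc.integrableOn_grad ha0 0
    simp only [sub_zero] at h1
    exact h1
  have hXmono : ∀ s t, s ≤ t → t ≤ 2 * r → X s ≤ X t := fun s t hst ht =>
    setIntegral_mono_set (hSH.mono_set (Metric.ball_subset_ball ht))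
      (Eventually.of_forall fun x => hφ.shifted_nonneg ha0 (norm_nonneg _))
      (Metric.ball_subset_ball hst).eventuallyLE
  have hs0 : 0 ≤ shifted φ a t₀ := hφ.shifted_nonneg ha0 ht₀0
  have key := hit X r (C₃ * (vol * shifted φ a t₀)) (X (2 * r)) hr (by positivity)
    (fun s _ => integral_nonneg fun x => hφ.shifted_nonneg ha0 (norm_nonneg _))
    (fun s hs => hXmono s _ hs.2 le_rfl) ?_
  · rw [mul_assoc]; exact key
  intro s hs t ht hst
  -- The Caccioppoli inequality enlarges the radius by `2d` and the oscillation estimate by at most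
  -- `2d` more, so everything stays within radius `t`.
  set d := (t - s) / 4 with hd
  have hd0 : 0 < d := by rw [hd]; linarith
  have hs0' : 0 < s := hr.trans_le hs.1
  set ρ := s + 2 * d with hρ
  have hμd : μ * d ≤ d := mul_le_of_le_one_left hd0.le hμ1
  have hρt : ρ + 2 * (μ * d) ≤ t := by rw [hρ]; linarith
  have hρ2 : ρ ≤ 2 * r := by linarith [ht.2, mul_pos hμ hd0]
  have hsubρ : Metric.ball x₀ ρ ⊆ Metric.ball x₀ (2 * r) := Metric.ball_subset_ball hρ2
  obtain ⟨q, hq⟩ := hloc.exists_oscillation_le hφ hc₀ ha0 hμ hμ1 hd0 (ρ := ρ)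
    (by rw [hρ]; positivity) (hρt.trans ht.2)
  have hlocρ : IsLocalized φ (Metric.ball x₀ ρ) v H :=
    ⟨hloc.weakGrad, hloc.meas, hloc.meas_grad, hloc.integrableOn.mono_set hsubρ,
      hloc.integrableOn_grad.mono_set hsubρ⟩
  have hc := hcac hφ hf hk.le hmin hs0' hd0 (hsubρ.trans hB) hQ hlocρ
    (hHG.mono fun x hx hxρ => hx (hsubρ hxρ)) q
  have hvi : IntegrableOn (fun x => shifted φ a (‖v x - q‖ / d)) (Metric.ball x₀ ρ) := by
    have h1 := hφ.integrable_shifted_mul_norm_sub hc₀ hloc.meas.aestronglyMeasurable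
      hloc.integrableOn ha0 (c := d⁻¹) (by positivity) q
    simp only [← div_eq_inv_mul] at h1
    exact IntegrableOn.mono_set h1 hsubρ
  have hsρ : Metric.ball x₀ s ⊆ Metric.ball x₀ ρ := Metric.ball_subset_ball (by linarith)
  have hrhs : ∫ x in Metric.ball x₀ ρ \ Metric.ball x₀ s,
      (shifted φ a ‖H x‖ + shifted φ a (‖v x - q‖ / d)) ≤
      X ρ - X s + ∫ x in Metric.ball x₀ ρ, shifted φ a (‖v x - q‖ / d) := by
    rw [integral_add ((hSH.mono_set hsubρ).mono_set sdiff_subset) (hvi.mono_set sdiff_subset)]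
    have h1 : ∫ x in Metric.ball x₀ ρ \ Metric.ball x₀ s, shifted φ a ‖H x‖ = X ρ - X s :=
      setIntegral_sdiff measurableSet_ball (hSH.mono_set hsubρ) hsρ
    rw [h1]
    refine add_le_add le_rfl (setIntegral_mono_set hvi (Eventually.of_forall fun x =>
      hφ.shifted_nonneg ha0 (by positivity)) sdiff_subset.eventuallyLE)
  have hXρ : X ρ ≤ X t := hXmono _ _ (by linarith [mul_pos hμ hd0]) ht.2
  have hXρ' : X (ρ + 2 * (μ * d)) ≤ X t := hXmono _ _ hρt ht.2
  -- the mean value term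
  have hts : 1 ≤ r / (t - s) := by
    rw [le_div_iff₀ (by linarith)]; linarith [hs.1, ht.2]
  set l := 8 * (16 / μ) ^ n * (r / (t - s)) ^ (n + 1) with hl
  have hl1 : 1 ≤ l := by
    have h1 : (1 : ℝ) ≤ (16 / μ) ^ n := by
      refine one_le_pow₀ ?_
      rw [le_div_iff₀ hμ]; linarith
    have h2 : (1 : ℝ) ≤ (r / (t - s)) ^ (n + 1) := one_le_pow₀ hts
    have h3 : (1 : ℝ) ≤ 8 * (16 / μ) ^ n := by linarith
    rw [hl]
    nlinarith
  have hleq : 2 * r / d * (2 * (2 * r) / (μ * d)) ^ n * t₀ = l * t₀ := by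
    have hts0 : t - s ≠ 0 := by linarith
    have e1 : 2 * r / d = 8 * (r / (t - s)) := by rw [hd]; field_simp; ring
    have e2 : 2 * (2 * r) / (μ * d) = 16 / μ * (r / (t - s)) := by rw [hd]; field_simp; ring
    rw [e1, e2, hl, mul_pow, pow_succ]
    ring
  rw [hleq] at hq
  have hsl : shifted φ a (l * t₀) ≤ 2 ^ (p + 2) * l ^ (p + 2) * shifted φ a t₀ :=
    hφ.shifted_mul_le hc₀ ha0 hl1 ht₀0
  have hlp : l ^ (p + 2) = (8 * (16 / μ) ^ n) ^ (p + 2) * (r / (t - s)) ^ ((n + 1) * (p + 2)) := by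
    rw [hl, mul_pow, ← pow_mul]
  -- Hole filling: the annulus contributes `C₁(X ρ - X s)`, and `C₁ X s` is moved to the left.
  have h1 : (C₁ + k) * X s ≤ (C₁ + k / 2) * X t +
      C₁ * (4 ^ (p + 2) * (vol * (2 ^ (p + 2) * l ^ (p + 2) * shifted φ a t₀))) := by
    have hXt0 : 0 ≤ X t := integral_nonneg fun x => hφ.shifted_nonneg ha0 (norm_nonneg _)
    have h2 : k * X s ≤ C₁ * (X ρ - X s + (4 ^ (p + 2) * (μ * X (ρ + 2 * (μ * d))) +
        4 ^ (p + 2) * (vol * shifted φ a (l * t₀)))) :=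
      hc.trans (mul_le_mul_of_nonneg_left (hrhs.trans (add_le_add le_rfl hq)) hC₁.le)
    have h3 : C₁ * (4 ^ (p + 2) * (vol * shifted φ a (l * t₀))) ≤
        C₁ * (4 ^ (p + 2) * (vol * (2 ^ (p + 2) * l ^ (p + 2) * shifted φ a t₀))) := by gcongr
    have h4 : C₁ * (4 ^ (p + 2) * (μ * X (ρ + 2 * (μ * d)))) ≤ k / 2 * X t := by
      calc C₁ * (4 ^ (p + 2) * (μ * X (ρ + 2 * (μ * d))))
          ≤ C₁ * (4 ^ (p + 2) * (μ * X t)) := by gcongr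
        _ = C₁ * (4 ^ (p + 2) * μ) * X t := by ring
        _ ≤ _ := mul_le_mul_of_nonneg_right hμk hXt0
    have h5 : C₁ * X ρ ≤ C₁ * X t := by gcongr
    linarith
  have hpos : 0 < C₁ + k := by positivity
  calc X s = (C₁ + k) * X s / (C₁ + k) := by field_simp
    _ ≤ ((C₁ + k / 2) * X t +
      C₁ * (4 ^ (p + 2) * (vol * (2 ^ (p + 2) * l ^ (p + 2) * shifted φ a t₀)))) / (C₁ + k) := by
        gcongr
    _ = _ := by
        rw [hlp, hθ, hC₃]
        ring

end OrliczGrowth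

/-! ### Test functions and the Euler–Lagrange equation. -/

namespace OrliczGrowth

variable {N n : ℕ} {φ : ℝ → ℝ} {c₀ c₁ : ℝ} {Ω : Set (Vec n)} {f : Mat N n → ℝ}
  {k K L β : ℝ} {u : Vec n → Vec N} {G : Vec n → Mat N n}

theorem hasCompactSupport_grad {ξ : Vec n → Vec N} (hξc : HasCompactSupport ξ) :
    HasCompactSupport (grad ξ) :=
  (hξc.fderiv (𝕜 := ℝ)).comp_left (g := toMat N n) (_root_.map_zero _)

theorem grad_eq_zero_of_notMem_tsupport {ξ : Vec n → Vec N} {x : Vec n} (hx : x ∉ tsupport ξ) :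
    grad ξ x = 0 := by
  have h : fderiv ℝ ξ x = 0 := by
    by_contra hne
    exact hx (support_fderiv_subset ℝ (f := ξ) hne)
  rw [grad_eq_toMat, h, _root_.map_zero]

theorem grad_const_smul {ξ : Vec n → Vec N} (hξ : ContDiff ℝ 1 ξ) (c : ℝ) (x : Vec n) :
    grad (fun y => c • ξ y) x = c • grad ξ x := by
  rw [grad_eq_toMat, grad_eq_toMat, fderiv_fun_const_smul ((hξ.differentiable (by norm_num)) x),
    _root_.map_smul]

/-- Integration by parts against the constant `1`. Constants such as `Df(Q)` and `D²f(Q)Q` can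
therefore be subtracted at no cost when tested with `∇ξ`. -/
theorem integral_clm_grad_eq_zero (ℓ : Mat N n →L[ℝ] ℝ) {ξ : Vec n → Vec N}
    (hξ : ContDiff ℝ 1 ξ) (hξc : HasCompactSupport ξ) : ∫ x, ℓ (grad ξ x) = 0 := by
  have hcont := continuous_grad hξ
  have hint : Integrable (grad ξ) :=
    hcont.integrable_of_hasCompactSupport (hasCompactSupport_grad hξc)
  rw [ContinuousLinearMap.integral_comp_comm ℓ hint]
  suffices h : ∫ x, grad ξ x = 0 by rw [h, _root_.map_zero]
  ext ⟨i, j⟩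
  have h1 : (∫ x, grad ξ x) (i, j) = ∫ x, grad ξ x (i, j) :=
    ((EuclideanSpace.proj (𝕜 := ℝ) (i, j) :
      Mat N n →L[ℝ] ℝ).integral_comp_comm hint).symm
  have hdiff := hξ.differentiable (by norm_num)
  have hi : ContDiff ℝ 1 fun y => ξ y i :=
    (EuclideanSpace.proj (𝕜 := ℝ) i : Vec N →L[ℝ] ℝ).contDiff.comp hξ
  have hic : HasCompactSupport fun y => ξ y i :=
    hξc.comp_left (g := fun v : Vec N => v i) rfl
  have h2 : ∀ x, grad ξ x (i, j) =
      1 * fderiv ℝ (fun y => ξ y i) x (EuclideanSpace.single j 1) := by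
    intro x
    have h3 : HasFDerivAt (fun y => ξ y i)
        ((EuclideanSpace.proj (𝕜 := ℝ) i : Vec N →L[ℝ] ℝ).comp (fderiv ℝ ξ x)) x :=
      (EuclideanSpace.proj (𝕜 := ℝ) i : Vec N →L[ℝ] ℝ).hasFDerivAt.comp x (hdiff x).hasFDerivAt
    rw [h3.fderiv, one_mul]; rfl
  rw [h1, integral_congr_ae (Eventually.of_forall h2),
    integral_mul_fderiv_eq_neg_fderiv_mul_of_integrable (f := fun _ => (1 : ℝ))]
  · simp
  · simp
  · simp only [one_mul]
    exact Continuous.integrable_of_hasCompactSupport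
      ((hi.continuous_fderiv (by norm_num)).clm_apply continuous_const)
      (HasWeakGradient.hasCompactSupport_fderiv_apply hic _)
  · simp only [one_mul]
    exact hi.continuous.integrable_of_hasCompactSupport hic
  · intro x _; fun_prop
  · intro x _; exact (hi.differentiable (by norm_num)) x

theorem setIntegral_clm_grad_eq_zero (ℓ : Mat N n →L[ℝ] ℝ) {ξ : Vec n → Vec N} {S : Set (Vec n)}
    (hξ : ContDiff ℝ 1 ξ) (hξc : HasCompactSupport ξ) (hS : tsupport ξ ⊆ S) :
    ∫ x in S, ℓ (grad ξ x) = 0 := by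
  rw [setIntegral_eq_integral_of_forall_compl_eq_zero, integral_clm_grad_eq_zero ℓ hξ hξc]
  intro x hx
  rw [grad_eq_zero_of_notMem_tsupport fun h => hx (hS h), _root_.map_zero]

theorem supGrad_nonneg (B : Set (Vec n)) (ξ : Vec n → Vec N) : 0 ≤ supGrad B ξ :=
  ENNReal.toReal_nonneg

/-- Continuity and compact support make the essential supremum finite, so taking its real value
loses nothing. -/
theorem ae_norm_grad_le_supGrad {ξ : Vec n → Vec N} (hξ : ContDiff ℝ 1 ξ)
    (hξc : HasCompactSupport ξ) (B : Set (Vec n)) :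
    ∀ᵐ x ∂(volume.restrict B), ‖grad ξ x‖ ≤ supGrad B ξ := by
  have hmem : MemLp (grad ξ) ∞ (volume.restrict B) :=
    ((continuous_grad hξ).memLp_top_of_hasCompactSupport (hasCompactSupport_grad hξc)
      volume).restrict B
  have h1 := ae_le_eLpNormEssSup (f := grad ξ) (μ := volume.restrict B)
  filter_upwards [h1] with x hx
  rw [← eLpNorm_exponent_top] at hx
  have := ENNReal.toReal_mono hmem.eLpNorm_ne_top hx
  rwa [toReal_enorm] at this

/-- The weak Euler–Lagrange equation. -/
theorem IsLocalMinimizer.integral_fderiv_eq_zero (hmin : IsLocalMinimizer φ f Ω u G)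
    (hf : IsIntegrand Ω φ f k K L β) (hφ : IsRegularNFunction φ c₀ c₁) (hc₀ : 0 < c₀)
    {x₀ : Vec n} {s ρ : ℝ} (hsρ : s < ρ) (hρ : Metric.ball x₀ ρ ⊆ Ω) {Q : Mat N n}
    {H : Vec n → Mat N n} (hHG : ∀ᵐ x, x ∈ Metric.ball x₀ ρ → H x = G x - Q)
    (hHm : StronglyMeasurable H)
    (hφH : IntegrableOn (fun x => φ ‖H x‖) (Metric.ball x₀ ρ)) {ξ : Vec n → Vec N}
    (hξ : ContDiff ℝ 1 ξ) (hξc : HasCompactSupport ξ)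
    (hξs : tsupport ξ ⊆ Metric.closedBall x₀ s) :
    ∫ x in Metric.ball x₀ ρ, fderiv ℝ f (Q + H x) (grad ξ x) = 0 := by
  have := isFiniteMeasure_restrict_ball x₀ ρ
  have hcg := continuous_grad hξ
  obtain ⟨M, hM⟩ := (hasCompactSupport_grad hξc).exists_bound_of_continuous hcg
  have hM0 : 0 ≤ M := (norm_nonneg _).trans (hM x₀)
  -- The summand `1` gives `φ'(t) ≤ t φ'(t) ≤ C φ(t)` at `t = b + |H|`; this integrable majorant
  -- allows differentiation under the integral for `|h| < 1`.
  set b := ‖Q‖ + M + 1 with hb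
  have hb1 : 1 ≤ b := by rw [hb]; linarith [norm_nonneg Q]
  have hbint := hφ.integrable_phi_add hc₀ hHm.aestronglyMeasurable hφH (b := b) (by linarith)
  have hmeas : ∀ h : ℝ, AEStronglyMeasurable (fun x => H x + h • grad ξ x)
      (volume.restrict (Metric.ball x₀ ρ)) := fun h =>
    hHm.aestronglyMeasurable.add (hcg.const_smul h).aestronglyMeasurable
  have hφHh : ∀ h : ℝ, IntegrableOn (fun x => φ ‖H x + h • grad ξ x‖) (Metric.ball x₀ ρ) := by
    intro h
    refine (hφ.integrable_phi_add hc₀ hHm.aestronglyMeasurable hφH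
      (b := |h| * M) (by positivity)).mono'
      (hφ.continuous_phi_norm.comp_aestronglyMeasurable (hmeas h)) (Eventually.of_forall fun x => ?_)
    rw [Real.norm_of_nonneg (hφ.nonneg (norm_nonneg _))]
    refine hφ.mono (norm_nonneg _) ?_
    have h1 := norm_add_le (H x) (h • grad ξ x)
    rw [norm_smul, Real.norm_eq_abs] at h1
    have h2 := mul_le_mul_of_nonneg_left (hM x) (abs_nonneg h)
    linarith
  have hint : ∀ h : ℝ, IntegrableOn (fun x => f (Q + (H x + h • grad ξ x)))
      (Metric.ball x₀ ρ) := fun h => hf.integrable_comp_add hφ hc₀ (hmeas h) (hφHh h) Q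
  have hder := hasDerivAt_integral_of_dominated_loc_of_deriv_le
    (μ := volume.restrict (Metric.ball x₀ ρ)) (x₀ := (0 : ℝ)) (s := Metric.ball 0 1)
    (F := fun h x => f (Q + (H x + h • grad ξ x)))
    (F' := fun h x => fderiv ℝ f (Q + (H x + h • grad ξ x)) (grad ξ x))
    (bound := fun x => |L| * M * (2 ^ (growthExp c₀ + 2) * φ (b + ‖H x‖)))
    (Metric.ball_mem_nhds _ one_pos)
    (Eventually.of_forall fun h => (hint h).aestronglyMeasurable) (hint 0)
    (by
      have h1 : AEStronglyMeasurable (fun x => fderiv ℝ f (Q + (H x + (0 : ℝ) • grad ξ x)))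
          (volume.restrict (Metric.ball x₀ ρ)) :=
        hf.continuous_fderiv.comp_aestronglyMeasurable ((hmeas 0).const_add Q)
      exact (ContinuousLinearMap.apply ℝ ℝ).aestronglyMeasurable_comp₂
        hcg.aestronglyMeasurable h1)
    (Eventually.of_forall fun x h hh => by
      have hh1 : |h| ≤ 1 := by
        rw [mem_ball_zero_iff, Real.norm_eq_abs] at hh; exact hh.le
      have hn : ‖Q + (H x + h • grad ξ x)‖ ≤ b + ‖H x‖ := by
        have h1 := norm_add_le Q (H x + h • grad ξ x)
        have h2 := norm_add_le (H x) (h • grad ξ x)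
        rw [norm_smul, Real.norm_eq_abs] at h2
        have h3 : |h| * ‖grad ξ x‖ ≤ 1 * M := by gcongr; exact hM x
        rw [hb]; linarith
      have h4 := hf.norm_fderiv_le hφ (Q + (H x + h • grad ξ x))
      have hbH : 1 ≤ b + ‖H x‖ := by linarith [norm_nonneg (H x)]
      have h5 : dphi φ ‖Q + (H x + h • grad ξ x)‖ ≤ 2 ^ (growthExp c₀ + 2) * φ (b + ‖H x‖) := by
        refine (hφ.dphi_mono (norm_nonneg _) hn).trans (le_trans ?_
          (hφ.mul_dphi_le hc₀ (by linarith)))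
        exact le_mul_of_one_le_left (hφ.dphi_nonneg (by linarith)) hbH
      have h6 : ‖fderiv ℝ f (Q + (H x + h • grad ξ x))‖ ≤
          |L| * (2 ^ (growthExp c₀ + 2) * φ (b + ‖H x‖)) :=
        h4.trans ((mul_le_mul_of_nonneg_right (le_abs_self L)
          (hφ.dphi_nonneg (norm_nonneg _))).trans (by gcongr))
      refine (ContinuousLinearMap.le_opNorm _ _).trans
        ((mul_le_mul h6 (hM x) (norm_nonneg _) ((norm_nonneg _).trans h6)).trans (le_of_eq ?_))
      ring)
    ((hbint.const_mul _).const_mul _)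
    (Eventually.of_forall fun x h _ => by
      have h1 : HasDerivAt (fun h : ℝ => Q + (H x + h • grad ξ x)) (grad ξ x) h := by
        simpa using (((hasDerivAt_id h).smul_const (grad ξ x)).const_add (H x)).const_add Q
      exact (hf.differentiable _).hasFDerivAt.comp_hasDerivAt h h1)
  have hzero : ∀ (h : ℝ) (x : Vec n), x ∉ Metric.closedBall x₀ s → (-h) • grad ξ x = 0 :=
    fun h x hx => by rw [grad_eq_zero_of_notMem_tsupport fun hh => hx (hξs hh), smul_zero]
  have hminh : ∀ h : ℝ, ∫ x in Metric.ball x₀ ρ, f (Q + (H x + (0 : ℝ) • grad ξ x)) ≤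
      ∫ x in Metric.ball x₀ ρ, f (Q + (H x + h • grad ξ x)) := by
    intro h
    have hw : ContDiff ℝ 1 fun x => (-h) • ξ x := hξ.const_smul (-h)
    have hweak := HasWeakGradient.of_contDiff hw
    have hgr : grad (fun x => (-h) • ξ x) = fun x => (-h) • grad ξ x :=
      funext fun x => grad_const_smul hξ (-h) x
    rw [hgr] at hweak
    have hsub : ∀ x, H x - (-h) • grad ξ x = H x + h • grad ξ x := fun x => by
      rw [neg_smul, sub_neg_eq_add]
    have h1 := hmin.integral_nonneg hf hφ hc₀ hsρ hρ hHG hHm hφH hweak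
      (fun x hx => by
        rw [image_eq_zero_of_notMem_tsupport fun hh => hx (hξs hh), smul_zero])
      (hzero h)
      (integrableOn_ball_of_continuous (hφ.continuous_phi_norm.comp hw.continuous) _ _)
      (integrableOn_ball_of_continuous (hφ.continuous_phi_norm.comp (hcg.const_smul (-h))) _ _)
      (by simpa only [hsub] using hφHh h)
    simp only [hsub] at h1
    have h0 := hint 0
    simp only [zero_smul, add_zero] at h0 ⊢
    rw [integral_sub (hint h) h0] at h1
    linarith
  have hloc : IsLocalMin (fun h : ℝ => ∫ x in Metric.ball x₀ ρ, f (Q + (H x + h • grad ξ x))) 0 :=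
    Eventually.of_forall hminh
  have := hloc.hasDerivAt_eq_zero hder.2
  simpa using this

end OrliczGrowth

/-! ### Linearization at `Q` and the quadratic range of `φ_a`. -/

namespace OrliczGrowth

variable {N n : ℕ} {φ : ℝ → ℝ} {c₀ c₁ : ℝ} {Ω : Set (Vec n)} {f : Mat N n → ℝ}
  {k K L β : ℝ} {u : Vec n → Vec N} {G : Vec n → Mat N n}

/-- The two terms cover the cases `|P| ≤ σ|Q|` and `|P| ≥ σ|Q|`. Small increments give a linear term
with the small factor `σ^β`; large ones pay `1/σ`, but only on `φ_{|Q|}(|P|)`, which the reverse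
Hölder inequality can make small. -/
theorem IsIntegrand.norm_linearization_le (hf : IsIntegrand Ω φ f k K L β)
    (hφ : IsRegularNFunction φ c₀ c₁) (hc₀ : 0 < c₀) (hc₁ : 0 < c₁) (hβ : 0 < β) {Q : Mat N n}
    (hQ : Q ≠ 0) {σ : ℝ} (hσ0 : 0 < σ) (hσ : σ ≤ 1 / 2) (P : Mat N n) :
    ‖fderiv ℝ f (Q + P) - fderiv ℝ f Q - D2 f Q P‖ ≤ L * σ ^ β * ddphi φ ‖Q‖ * ‖P‖ +
      L * (6 + 1 / c₀ * 2 ^ (growthExp c₀ + 2) + 2 / c₀) * 2 ^ (growthExp c₀ + 2) / σ *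
        (shifted φ ‖Q‖ ‖P‖ / ‖Q‖) := by
  have hL := hf.L_nonneg hφ hc₁ hQ
  have hQ0 := norm_pos_iff.2 hQ
  have hdd := hφ.ddphi_pos hc₁ hQ0
  have hs := hφ.shifted_nonneg hQ0.le (norm_nonneg P)
  rcases le_total ‖P‖ (σ * ‖Q‖) with h | h
  · exact (hf.norm_linearization_le_of_small hφ hc₁ hβ hQ hσ0 hσ h).trans
      (le_add_of_nonneg_right (by positivity))
  · exact (hf.norm_linearization_le_of_large hφ hc₀ hc₁ hQ hσ0 (by linarith) h).trans
      (le_add_of_nonneg_left (by positivity))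

/-- Linearization of the Euler–Lagrange equation at a constant matrix. -/
theorem IsLocalMinimizer.abs_integral_D2_le (hmin : IsLocalMinimizer φ f Ω u G)
    (hf : IsIntegrand Ω φ f k K L β) (hφ : IsRegularNFunction φ c₀ c₁) (hc₀ : 0 < c₀)
    (hc₁ : 0 < c₁) (hβ : 0 < β) {x₀ : Vec n} {r ρ : ℝ} (hrρ : r < ρ)
    (hρ : Metric.ball x₀ ρ ⊆ Ω) {Q : Mat N n} (hQ : Q ≠ 0)
    {H : Vec n → Mat N n} (hHG : ∀ᵐ x, x ∈ Metric.ball x₀ ρ → H x = G x - Q)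
    (hHm : StronglyMeasurable H) (hHint : IntegrableOn H (Metric.ball x₀ r))
    (hφH : IntegrableOn (fun x => φ ‖H x‖) (Metric.ball x₀ ρ)) {ξ : Vec n → Vec N}
    (hξ : IsTest (Metric.ball x₀ r) ξ) {σ : ℝ} (hσ0 : 0 < σ) (hσ : σ ≤ 1 / 2) :
    |∫ x in Metric.ball x₀ r, D2 f Q (H x) (grad ξ x)| ≤
      (L * σ ^ β * ddphi φ ‖Q‖ * (∫ x in Metric.ball x₀ r, ‖H x‖) +
        L * (6 + 1 / c₀ * 2 ^ (growthExp c₀ + 2) + 2 / c₀) * 2 ^ (growthExp c₀ + 2) / σ *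
          ((∫ x in Metric.ball x₀ r, shifted φ ‖Q‖ ‖H x‖) / ‖Q‖)) *
        supGrad (Metric.ball x₀ r) ξ := by
  have := isFiniteMeasure_restrict_ball x₀ r
  have := isFiniteMeasure_restrict_ball x₀ ρ
  have hξ1 : ContDiff ℝ 1 ξ := hξ.1.of_le (by norm_cast)
  have hcg := continuous_grad hξ1
  have hrsub : Metric.ball x₀ r ⊆ Metric.ball x₀ ρ := Metric.ball_subset_ball hrρ.le
  have hoff : ∀ x, x ∉ Metric.ball x₀ r → grad ξ x = 0 := fun x hx =>
    grad_eq_zero_of_notMem_tsupport fun h => hx (hξ.2.2 h)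
  have hEL : ∫ x in Metric.ball x₀ r, fderiv ℝ f (Q + H x) (grad ξ x) = 0 := by
    rw [← hmin.integral_fderiv_eq_zero hf hφ hc₀ hrρ hρ hHG hHm hφH hξ1 hξ.2.1
      (hξ.2.2.trans Metric.ball_subset_closedBall)]
    refine (setIntegral_eq_of_subset_of_forall_sdiff_eq_zero measurableSet_ball hrsub ?_).symm
    intro x hx
    rw [hoff x hx.2, _root_.map_zero]
  have hconst := setIntegral_clm_grad_eq_zero (fderiv ℝ f Q) hξ1 hξ.2.1 hξ.2.2
  have hS : Integrable (fun x => shifted φ ‖Q‖ ‖H x‖) (volume.restrict (Metric.ball x₀ r)) := by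
    have h1 := hφ.integrable_shifted_norm_sub hc₀ hHm.aestronglyMeasurable
      (IntegrableOn.mono_set hφH hrsub) (norm_nonneg Q) (0 : Mat N n)
    simpa only [sub_zero] using h1
  set M := supGrad (Metric.ball x₀ r) ξ with hM
  have hM0 : 0 ≤ M := supGrad_nonneg _ _
  have hMae := ae_norm_grad_le_supGrad hξ1 hξ.2.1 (Metric.ball x₀ r)
  set C := L * (6 + 1 / c₀ * 2 ^ (growthExp c₀ + 2) + 2 / c₀) * 2 ^ (growthExp c₀ + 2) / σ with hC
  set bd : Vec n → ℝ := fun x =>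
    (L * σ ^ β * ddphi φ ‖Q‖ * ‖H x‖ + C * (shifted φ ‖Q‖ ‖H x‖ / ‖Q‖)) * M with hbd
  have hbdint : Integrable bd (volume.restrict (Metric.ball x₀ r)) :=
    ((hHint.norm.const_mul _).add ((hS.div_const _).const_mul _)).mul_const _
  have hrem : ∀ᵐ x ∂(volume.restrict (Metric.ball x₀ r)),
      ‖(fderiv ℝ f (Q + H x) - fderiv ℝ f Q - D2 f Q (H x)) (grad ξ x)‖ ≤ bd x := by
    filter_upwards [hMae] with x hx
    have h1 := hf.norm_linearization_le hφ hc₀ hc₁ hβ hQ hσ0 hσ (H x)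
    exact (ContinuousLinearMap.le_opNorm _ _).trans
      (mul_le_mul h1 hx (norm_nonneg _) ((norm_nonneg _).trans h1))
  have happ : ∀ {A : Vec n → Mat N n →L[ℝ] ℝ},
      AEStronglyMeasurable A (volume.restrict (Metric.ball x₀ r)) →
      AEStronglyMeasurable (fun x => A x (grad ξ x)) (volume.restrict (Metric.ball x₀ r)) :=
    fun hA => (ContinuousLinearMap.apply ℝ ℝ).aestronglyMeasurable_comp₂
      hcg.aestronglyMeasurable hA
  have hm1 : AEStronglyMeasurable (fun x => fderiv ℝ f (Q + H x))
      (volume.restrict (Metric.ball x₀ r)) :=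
    hf.continuous_fderiv.comp_aestronglyMeasurable (hHm.aestronglyMeasurable.const_add Q)
  have hm2 : AEStronglyMeasurable (fun x => D2 f Q (H x)) (volume.restrict (Metric.ball x₀ r)) :=
    (D2 f Q).continuous.comp_aestronglyMeasurable hHm.aestronglyMeasurable
  have hi1 : Integrable (fun x => D2 f Q (H x) (grad ξ x))
      (volume.restrict (Metric.ball x₀ r)) := by
    refine (hHint.norm.const_mul (‖D2 f Q‖ * M)).mono' (happ hm2) ?_
    filter_upwards [hMae] with x hx
    calc ‖D2 f Q (H x) (grad ξ x)‖ ≤ ‖D2 f Q‖ * ‖H x‖ * ‖grad ξ x‖ := (D2 f Q).le_opNorm₂ _ _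
      _ ≤ ‖D2 f Q‖ * ‖H x‖ * M := by gcongr
      _ = _ := by ring
  have hi2 : Integrable (fun x => fderiv ℝ f Q (grad ξ x))
      (volume.restrict (Metric.ball x₀ r)) :=
    integrableOn_ball_of_continuous ((fderiv ℝ f Q).continuous.comp hcg) _ _
  have hi3 : Integrable
      (fun x => (fderiv ℝ f (Q + H x) - fderiv ℝ f Q - D2 f Q (H x)) (grad ξ x))
      (volume.restrict (Metric.ball x₀ r)) :=
    hbdint.mono' (happ ((hm1.sub aestronglyMeasurable_const).sub hm2)) hrem
  have hi4 : Integrable (fun x => fderiv ℝ f (Q + H x) (grad ξ x))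
      (volume.restrict (Metric.ball x₀ r)) := by
    refine ((hi3.add hi2).add hi1).congr (Eventually.of_forall fun x => ?_)
    simp only [Pi.add_apply, _root_.sub_apply]
    ring
  -- Both `Df(Q + H)` and the constant `Df(Q)` integrate to zero against `∇ξ`, so only the linear
  -- term survives.
  have hid : ∫ x in Metric.ball x₀ r,
      (fderiv ℝ f (Q + H x) - fderiv ℝ f Q - D2 f Q (H x)) (grad ξ x) =
      -∫ x in Metric.ball x₀ r, D2 f Q (H x) (grad ξ x) := by
    simp only [_root_.sub_apply]
    have hi5 : Integrable (fun x => fderiv ℝ f (Q + H x) (grad ξ x) - fderiv ℝ f Q (grad ξ x))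
        (volume.restrict (Metric.ball x₀ r)) := hi4.sub hi2
    rw [integral_sub hi5 hi1, integral_sub hi4 hi2, hEL, hconst]
    ring
  rw [← abs_neg, ← hid, ← Real.norm_eq_abs]
  refine (norm_integral_le_of_norm_le hbdint hrem).trans (le_of_eq ?_)
  rw [hbd, integral_mul_const, integral_add (hHint.norm.const_mul _)
    ((hS.div_const _).const_mul _), integral_const_mul, integral_const_mul, integral_div]

/-- If `t > τa`, then `φ_a(t) ≥ φ_a(τa)`, which is at least a constant times `τ² a φ'(a)`. This
contradicts `φ_a(t) ≤ Dφ(a) ≤ D a φ'(a)` when `D` is small compared with `τ²`. -/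
theorem IsRegularNFunction.le_mul_of_shifted_le (h : IsRegularNFunction φ c₀ c₁) (hc₀ : 0 < c₀)
    {a t τ D : ℝ} (ha : 0 < a) (hτ : 0 < τ) (hτ1 : τ ≤ 1)
    (hD0 : 0 ≤ D) (hD : 2 ^ (growthExp c₀ + 4) * D ≤ τ ^ 2)
    (hs : shifted φ a t ≤ D * φ a) : t ≤ τ * a := by
  by_contra! hlt
  have hτa : 0 ≤ τ * a := by positivity
  have h1 := h.mul_dshift_le hc₀ ha.le hτa
  have h2 := h.shifted_mono ha.le hτa hlt.le
  have hda : 0 < dphi φ a := h.deriv_pos a ha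
  have h3 : τ / 2 * dphi φ a ≤ dshift φ a (τ * a) := by
    have h4 : τ / 2 ≤ τ * a / (a + τ * a) := by
      rw [div_le_div_iff₀ two_pos (by positivity)]
      nlinarith [mul_nonneg hτ.le ha.le]
    rw [dshift, mul_comm]
    exact mul_le_mul (h.dphi_mono ha.le (by linarith)) h4 (by positivity)
      (h.dphi_nonneg (by linarith))
  have h5 : τ * a * (τ / 2 * dphi φ a) ≤ 2 ^ (growthExp c₀ + 2) * (D * (a * dphi φ a)) :=
    calc τ * a * (τ / 2 * dphi φ a) ≤ τ * a * dshift φ a (τ * a) := by gcongr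
      _ ≤ 2 ^ (growthExp c₀ + 2) * shifted φ a (τ * a) := h1
      _ ≤ 2 ^ (growthExp c₀ + 2) * (D * (a * dphi φ a)) := by
        gcongr
        exact h2.trans (hs.trans (mul_le_mul_of_nonneg_left (h.le_mul_dphi ha.le) hD0))
  have h6 : 2 ^ (growthExp c₀ + 4) * D * (a * dphi φ a) ≤ τ ^ 2 * (a * dphi φ a) := by gcongr
  have h7 : 0 < τ ^ 2 * (a * dphi φ a) := by positivity
  have h8 : (2 : ℝ) ^ (growthExp c₀ + 4) = 4 * 2 ^ (growthExp c₀ + 2) := by ring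
  rw [h8] at h6
  nlinarith

/-- For `t ≤ τa` the quotient `t / (a + t)` is at most `τ`, so `φ_a'(t) ≤ C τ φ'(a)`, and the upper
characteristic replaces `φ'(a)` by `a φ''(a)`. The bound is linear in `t` with the small factor `τ`.
-/
theorem IsRegularNFunction.shifted_le_of_le_mul (h : IsRegularNFunction φ c₀ c₁) (hc₀ : 0 < c₀)
    {a t τ : ℝ} (ha : 0 < a) (hτ : 0 < τ) (hτ1 : τ ≤ 1) (ht0 : 0 ≤ t) (ht : t ≤ τ * a) :
    shifted φ a t ≤ 2 ^ growthExp c₀ * c₁ * τ * (a * ddphi φ a) * t := by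
  have h1 := h.shifted_le ha.le ht0
  have hta : t ≤ a := ht.trans (mul_le_of_le_one_left ha.le hτ1)
  have h2 : dshift φ a t ≤ 2 ^ growthExp c₀ * dphi φ a * τ := by
    rw [dshift]
    refine mul_le_mul ?_ ?_ (by positivity)
      (mul_nonneg (by positivity) (h.dphi_nonneg ha.le))
    · exact (h.dphi_mono (by positivity) (by linarith : a + t ≤ 2 * a)).trans
        (h.dphi_mul_le hc₀ one_le_two ha.le)
    · rw [div_le_iff₀ (by positivity)]
      nlinarith [mul_nonneg hτ.le ht0]
  have h3 := h.upper a ha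
  calc shifted φ a t ≤ t * dshift φ a t := h1
    _ ≤ t * (2 ^ growthExp c₀ * (c₁ * (a * ddphi φ a)) * τ) := by
      refine mul_le_mul_of_nonneg_left (h2.trans ?_) ht0
      gcongr
    _ = _ := by ring

end OrliczGrowth

/-! ### Choice of parameters and conclusion. -/

namespace OrliczGrowth

theorem setAverage_eq_mul {n : ℕ} (x₀ : Vec n) (ρ : ℝ) (F : Vec n → ℝ) :
    ⨍ x in Metric.ball x₀ ρ, F x =
      (volume.real (Metric.ball x₀ ρ))⁻¹ * ∫ x in Metric.ball x₀ ρ, F x := by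
  rw [setAverage_eq, smul_eq_mul]

theorem volume_real_ball_pos {n : ℕ} (x₀ : Vec n) {ρ : ℝ} (hρ : 0 < ρ) :
    0 < volume.real (Metric.ball x₀ ρ) :=
  ENNReal.toReal_pos (Metric.measure_ball_pos _ _ hρ).ne' measure_ball_lt_top.ne

theorem isProbabilityMeasure_average_ball {n : ℕ} (x₀ : Vec n) {ρ : ℝ} (hρ : 0 < ρ) :
    IsProbabilityMeasure ((volume.restrict (Metric.ball x₀ ρ) univ)⁻¹ •
      volume.restrict (Metric.ball x₀ ρ)) := by
  have := isFiniteMeasure_restrict_ball x₀ ρ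
  have : NeZero (volume.restrict (Metric.ball x₀ ρ)) :=
    ⟨by rw [Ne, Measure.restrict_eq_zero]; exact (Metric.measure_ball_pos _ _ hρ).ne'⟩
  infer_instance

theorem integrable_average_ball {n : ℕ} {E : Type*} [NormedAddCommGroup E] {x₀ : Vec n} {ρ : ℝ}
    (hρ : 0 < ρ) {F : Vec n → E} (hF : IntegrableOn F (Metric.ball x₀ ρ)) :
    Integrable F ((volume.restrict (Metric.ball x₀ ρ) univ)⁻¹ •
      volume.restrict (Metric.ball x₀ ρ)) := by
  refine Integrable.smul_measure hF (ENNReal.inv_ne_top.2 ?_)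
  rw [Measure.restrict_apply_univ]
  exact (Metric.measure_ball_pos _ _ hρ).ne'

theorem MemSobolevLoc.integrableOn_ball {N n : ℕ} {φ : ℝ → ℝ} {Ω : Set (Vec n)}
    {u : Vec n → Vec N} {G : Vec n → Mat N n} (hu : MemSobolevLoc φ Ω u G) {x₀ : Vec n} {ρ : ℝ}
    (hB : Metric.closedBall x₀ ρ ⊆ Ω) : IntegrableOn G (Metric.ball x₀ ρ) ∧
      IntegrableOn (fun x => φ ‖G x‖) (Metric.ball x₀ ρ) :=
  ⟨(hu.weakGrad.locInt_grad.integrableOn_compact_subset hB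
      (isCompact_closedBall x₀ ρ)).mono_set Metric.ball_subset_closedBall,
    (hu.mem_grad _ (isCompact_closedBall x₀ ρ) hB).2.mono_set Metric.ball_subset_closedBall⟩

/-- The constant in the smallness condition of `small_excess`. -/
noncomputable def excessConst (c₀ : ℝ) : ℝ :=
  512 ^ (growthExp c₀ + 2) * (16 * (4096 * 32 ^ growthExp c₀))

theorem excessConst_pos (c₀ : ℝ) : 0 < excessConst c₀ := by
  unfold excessConst; positivity

theorem exists_rpow_mul_le {A β ε : ℝ} (hβ : 0 < β) (hε : 0 < ε) :
    ∃ σ : ℝ, 0 < σ ∧ σ ≤ 1 / 2 ∧ A * σ ^ β ≤ ε := by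
  have h1 : Tendsto (fun σ : ℝ => A * σ ^ β) (𝓝[>] 0) (𝓝 (A * 0 ^ β)) :=
    (((Real.continuousAt_rpow_const 0 β (Or.inr hβ.le)).const_mul A).tendsto).mono_left
      nhdsWithin_le_nhds
  rw [Real.zero_rpow hβ.ne', mul_zero] at h1
  obtain ⟨σ, h2, h3⟩ := ((h1.eventually (gt_mem_nhds hε)).and
    (Ioc_mem_nhdsGT (by norm_num : (0 : ℝ) < 1 / 2))).exists
  exact ⟨σ, h3.1, h3.2, h2.le⟩

/-- Almost harmonicity of `u - Q` under a small relative excess. -/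
theorem exists_abs_average_D2_le (n N : ℕ) (c₀ c₁ k L β : ℝ) (hc₀ : 0 < c₀) (hc₁ : 0 < c₁)
    (hk : 0 < k) (hβ : 0 < β) (ε : ℝ) (hε : 0 < ε) :
    ∃ δ : ℝ, 0 < δ ∧ 32 ^ (growthExp c₀ + 2) * excessConst c₀ * δ ≤ 1 ∧
      ∀ {φ : ℝ → ℝ} {Ω : Set (Vec n)} {f : Mat N n → ℝ} {K : ℝ}
      {u : Vec n → Vec N} {G : Vec n → Mat N n}, IsRegularNFunction φ c₀ c₁ → IsOpen Ω →
      IsIntegrand Ω φ f k K L β → IsLocalMinimizer φ f Ω u G →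
      ∀ {x₀ : Vec n} {r : ℝ}, 0 < r → Metric.closedBall x₀ (2 * r) ⊆ Ω →
      (⨍ x in Metric.ball x₀ (2 * r),
          ‖V φ (G x) - ⨍ y in Metric.ball x₀ (2 * r), V φ (G y)‖ ^ 2) ≤
        δ * (⨍ x in Metric.ball x₀ (2 * r), ‖V φ (G x)‖ ^ 2) →
      ∀ {Q : Mat N n}, Q ≠ 0 → Q = (⨍ x in Metric.ball x₀ (2 * r), G x) →
        ∀ ξ : Vec n → Vec N, IsTest (Metric.ball x₀ r) ξ →
          |⨍ x in Metric.ball x₀ r, D2 f Q (G x - Q) (grad ξ x)| ≤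
            ε * ddphi φ ‖Q‖ * (⨍ x in Metric.ball x₀ (2 * r), ‖G x - Q‖) *
              supGrad (Metric.ball x₀ r) ξ := by
  obtain ⟨CR, hCR, hrev⟩ := exists_reverse_holder n N c₀ c₁ k L hc₀ hc₁ hk
  set p := growthExp c₀ with hp
  -- First `σ`, for the small increments; the factor `2 ^ n` is `|2B| / |B|`.
  obtain ⟨σ, hσ0, hσ, hσε⟩ := exists_rpow_mul_le (A := 2 ^ n * |L|) hβ (half_pos hε)
  set C := |L| * (6 + 1 / c₀ * 2 ^ (p + 2) + 2 / c₀) * 2 ^ (p + 2) / σ with hC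
  have hC0 : 0 ≤ C := by positivity
  set C' := C * (CR * 2 ^ n * (2 ^ p * c₁)) with hC'
  have hC'0 : 0 ≤ C' := by positivity
  -- Next `τ`, for the large increments; `C'` contains the factor `1/σ` and is already fixed.
  set τ := min 1 (ε / 2 / (C' + 1)) with hτdef
  have hτ0 : 0 < τ := lt_min one_pos (by positivity)
  have hτ1 : τ ≤ 1 := min_le_left _ _
  have hτε : C' * τ ≤ ε / 2 := by
    have h1 : τ ≤ ε / 2 / (C' + 1) := min_le_right _ _
    rw [le_div_iff₀ (by positivity)] at h1
    linarith
  set A := excessConst c₀ with hA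
  have hA0 : 0 < A := excessConst_pos c₀
  set D := 4 * 32 ^ (p + 2) * A with hD
  have hD0 : 0 < D := by positivity
  -- Last `δ`: the first bound permits the absorption in `small_excess`, the second turns its
  -- conclusion into `t₀ ≤ τ|Q|`.
  set δ := min (1 / (32 ^ (p + 2) * A)) (τ ^ 2 / (2 ^ (p + 4) * D)) with hδdef
  have hδ0 : 0 < δ := lt_min (by positivity) (by positivity)
  have hδ1 : 32 ^ (p + 2) * A * δ ≤ 1 := by
    have h1 : δ ≤ 1 / (32 ^ (p + 2) * A) := min_le_left _ _
    rw [le_div_iff₀ (by positivity)] at h1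
    linarith
  have hδ2 : 2 ^ (p + 4) * (D * δ) ≤ τ ^ 2 := by
    have h1 : δ ≤ τ ^ 2 / (2 ^ (p + 4) * D) := min_le_right _ _
    rw [le_div_iff₀ (by positivity)] at h1
    linarith
  refine ⟨δ, hδ0, hδ1, ?_⟩
  intro φ Ω f K u G hφ hΩ hf hmin x₀ r hr hB hexc Q hQ hQG ξ hξ
  have h2r : 0 < 2 * r := by linarith
  set a := ‖Q‖ with ha
  have ha0 : 0 < a := norm_pos_iff.2 hQ
  have hdd := hφ.ddphi_pos hc₁ ha0
  have hL : 0 ≤ L := hf.L_nonneg hφ hc₁ hQ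
  have hLabs : |L| = L := abs_of_nonneg hL
  obtain ⟨hGint, hφG⟩ := hmin.memSobolevLoc.integrableOn_ball hB
  have hball : Metric.ball x₀ (2 * r) ⊆ Ω := Metric.ball_subset_closedBall.trans hB
  obtain ⟨v, H, hloc, hHG⟩ := hmin.memSobolevLoc.exists_localized hφ hc₀ hΩ h2r hB Q
  have hHG' : ∀ᵐ x ∂(volume.restrict (Metric.ball x₀ (2 * r))), H x = G x - Q := by
    rw [ae_restrict_iff' measurableSet_ball]; exact hHG
  have hsub : Metric.ball x₀ r ⊆ Metric.ball x₀ (2 * r) := Metric.ball_subset_ball (by linarith)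
  have hfin := isFiniteMeasure_restrict_ball x₀ (2 * r)
  have hHint : IntegrableOn H (Metric.ball x₀ (2 * r)) := by
    have h1 : Integrable (fun x => G x - Q) (volume.restrict (Metric.ball x₀ (2 * r))) :=
      Integrable.sub hGint (integrable_const Q)
    exact h1.congr (hHG'.mono fun x hx => hx.symm)
  set t₀ := ⨍ x in Metric.ball x₀ (2 * r), ‖G x - Q‖ with ht₀
  have ht₀H : ⨍ x in Metric.ball x₀ (2 * r), ‖H x‖ = t₀ := by
    rw [ht₀, setAverage_eq_mul, setAverage_eq_mul]
    congr 1
    exact integral_congr_ae (hHG'.mono fun x hx => by simp only [hx])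
  have ht₀0 : 0 ≤ t₀ := by
    rw [ht₀, setAverage_eq_mul]
    exact mul_nonneg (by positivity) (integral_nonneg fun x => norm_nonneg _)
  -- smallness of the mean oscillation
  have ht₀τ : t₀ ≤ τ * a := by
    have hprob := isProbabilityMeasure_average_ball x₀ h2r
    have hG' := integrable_average_ball h2r hGint
    have hφG' := integrable_average_ball h2r hφG
    have h1 := (hφ.small_excess hc₀ hG' hφG' hδ0.le rfl hδ1 hexc).2
    have h2 : ‖Q‖ = ‖∫ y, G y ∂((volume.restrict (Metric.ball x₀ (2 * r)) univ)⁻¹ •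
        volume.restrict (Metric.ball x₀ (2 * r)))‖ := congrArg norm hQG
    have h3 := hφ.shifted_norm_integral_le ha0.le (hG'.sub (integrable_const Q))
      (hφ.integrable_shifted_norm_sub hc₀ hG'.aestronglyMeasurable hφG' ha0.le Q)
    refine hφ.le_mul_of_shifted_le hc₀ ha0 hτ0 hτ1 (by positivity) hδ2 (h3.trans ?_)
    have h4 : Q = ∫ y, G y ∂((volume.restrict (Metric.ball x₀ (2 * r)) univ)⁻¹ •
        volume.restrict (Metric.ball x₀ (2 * r))) := hQG
    rw [← h4] at h1
    exact h1
  have hφt₀ := hφ.shifted_le_of_le_mul hc₀ ha0 hτ0 hτ1 ht₀0 ht₀τ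
  have hrev' := hrev hφ hf hmin hr hball hQ hloc hHG
  rw [ht₀H] at hrev'
  have hmain := hmin.abs_integral_D2_le hf hφ hc₀ hc₁ hβ (by linarith : r < 2 * r) hball hQ hHG
    hloc.meas_grad (hHint.mono_set hsub) hloc.integrableOn_grad hξ hσ0 hσ
  have hI1 : ∫ x in Metric.ball x₀ r, ‖H x‖ ≤ volume.real (Metric.ball x₀ (2 * r)) * t₀ := by
    rw [← ht₀H, setAverage_eq_mul, mul_inv_cancel_left₀ (volume_real_ball_pos x₀ h2r).ne']
    exact setIntegral_mono_set hHint.norm (Eventually.of_forall fun x => norm_nonneg _)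
      hsub.eventuallyLE
  have hvB := volume_real_ball_pos x₀ hr
  have hv2 : volume.real (Metric.ball x₀ (2 * r)) = 2 ^ n * volume.real (Metric.ball x₀ r) := by
    rw [volume_real_ball _ h2r, volume_real_ball _ hr]; ring
  set vB := volume.real (Metric.ball x₀ r) with hvBdef
  rw [hv2] at hI1 hrev'
  set M := supGrad (Metric.ball x₀ r) ξ with hM
  have hM0 : 0 ≤ M := supGrad_nonneg _ _
  have hcongr : ∫ x in Metric.ball x₀ r, D2 f Q (G x - Q) (grad ξ x) =
      ∫ x in Metric.ball x₀ r, D2 f Q (H x) (grad ξ x) :=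
    integral_congr_ae ((ae_restrict_of_ae_restrict_of_subset hsub hHG').mono fun x hx => by
      simp only [hx])
  rw [setAverage_eq_mul, abs_mul, abs_of_pos (inv_pos.2 hvB), hcongr]
  set Φ := ddphi φ a with hΦ
  rw [← hLabs, ← hC] at hmain
  -- The reverse Hölder inequality, then `φ_a(t₀) ≤ C τ a φ''(a) t₀`; the factor `a` cancels the
  -- division by `|Q|`.
  have hI2 : (∫ x in Metric.ball x₀ r, shifted φ a ‖H x‖) / a ≤
      CR * (2 ^ n * vB * (2 ^ p * c₁ * τ * Φ * t₀)) := by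
    rw [div_le_iff₀ ha0]
    refine hrev'.trans ((mul_le_mul_of_nonneg_left (mul_le_mul_of_nonneg_left hφt₀
      (by positivity)) hCR.le).trans (le_of_eq ?_))
    ring
  calc vB⁻¹ * |∫ x in Metric.ball x₀ r, D2 f Q (H x) (grad ξ x)|
      ≤ vB⁻¹ * ((|L| * σ ^ β * Φ * (2 ^ n * vB * t₀) +
          C * (CR * (2 ^ n * vB * (2 ^ p * c₁ * τ * Φ * t₀)))) * M) := by
        refine mul_le_mul_of_nonneg_left (hmain.trans ?_) (by positivity)
        gcongr
    _ = (2 ^ n * |L| * σ ^ β + C' * τ) * (Φ * t₀ * M) := by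
        rw [hC']; field_simp
    _ ≤ (ε / 2 + ε / 2) * (Φ * t₀ * M) := by gcongr
    _ = ε * Φ * t₀ * M := by ring

/-- If the relative excess is small and the mean of the gradient vanishes, so does the gradient. -/
theorem ae_eq_zero_of_average_eq_zero {N n : ℕ} {φ : ℝ → ℝ} {c₀ c₁ : ℝ}
    (hφ : IsRegularNFunction φ c₀ c₁) (hc₀ : 0 < c₀) {G : Vec n → Mat N n} {x₀ : Vec n} {ρ δ : ℝ}
    (hρ : 0 < ρ) (hG : IntegrableOn G (Metric.ball x₀ ρ))
    (hφG : IntegrableOn (fun x => φ ‖G x‖) (Metric.ball x₀ ρ)) (hδ0 : 0 ≤ δ)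
    (hδ : 32 ^ (growthExp c₀ + 2) * excessConst c₀ * δ ≤ 1)
    (hexc : (⨍ x in Metric.ball x₀ ρ, ‖V φ (G x) - ⨍ y in Metric.ball x₀ ρ, V φ (G y)‖ ^ 2) ≤
        δ * (⨍ x in Metric.ball x₀ ρ, ‖V φ (G x)‖ ^ 2))
    (h0 : ⨍ x in Metric.ball x₀ ρ, G x = 0) :
    ∀ᵐ x ∂(volume.restrict (Metric.ball x₀ ρ)), G x = 0 := by
  have hprob := isProbabilityMeasure_average_ball x₀ hρ
  have h1 := (hφ.small_excess hc₀ (integrable_average_ball hρ hG) (integrable_average_ball hρ hφG)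
    hδ0 rfl hδ hexc).1
  have h2 : ∫ y, G y ∂((volume.restrict (Metric.ball x₀ ρ) univ)⁻¹ •
      volume.restrict (Metric.ball x₀ ρ)) = 0 := h0
  rw [h2, norm_zero, hφ.map_zero, mul_zero] at h1
  have h3 : (⨍ x in Metric.ball x₀ ρ, ‖V φ (G x)‖ ^ 2) ≤ 0 := h1
  rw [setAverage_eq_mul] at h3
  have h4 : ∫ x in Metric.ball x₀ ρ, ‖V φ (G x)‖ ^ 2 = 0 :=
    le_antisymm (nonpos_of_mul_nonpos_right h3 (inv_pos.2 (volume_real_ball_pos x₀ hρ)))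
      (integral_nonneg fun x => by positivity)
  have h5 : Integrable (fun x => ‖V φ (G x)‖ ^ 2) (volume.restrict (Metric.ball x₀ ρ)) :=
    (hφ.memLp_V hc₀ hG.aestronglyMeasurable hφG).integrable_norm_pow (by norm_num)
  rw [integral_eq_zero_iff_of_nonneg (fun x => by positivity) h5] at h4
  filter_upwards [h4] with x hx
  refine hφ.V_eq_zero ?_
  simpa using hx

end OrliczGrowth
theorem lemma5p5 (n N : ℕ) (hn : 1 ≤ n) (hN : 1 ≤ N)
    (c₀ c₁ k K L β : ℝ) (hc₀ : 0 < c₀) (hc₁ : 0 < c₁) (hk : 0 < k) (hβ : 0 < β)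
    (ε : ℝ) (hε : 0 < ε) :
    ∃ δ : ℝ, 0 < δ ∧
      ∀ φ : ℝ → ℝ, IsRegularNFunction φ c₀ c₁ →
      ∀ (Ω : Set (Vec n)), IsOpen Ω →
      ∀ f : Mat N n → ℝ, IsIntegrand Ω φ f k K L β →
      ∀ (u : Vec n → Vec N) (G : Vec n → Mat N n), IsLocalMinimizer φ f Ω u G →
      ∀ (x₀ : Vec n) (r : ℝ), 0 < r → Metric.closedBall x₀ (2 * r) ⊆ Ω →
      (⨍ x in Metric.ball x₀ (2 * r),
          ‖V φ (G x) - ⨍ y in Metric.ball x₀ (2 * r), V φ (G y)‖ ^ 2) ≤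
        δ * (⨍ x in Metric.ball x₀ (2 * r), ‖V φ (G x)‖ ^ 2) →
      ∀ Q : Mat N n, Q = (⨍ x in Metric.ball x₀ (2 * r), G x) →
        (∀ ξ : Vec n → Vec N, IsTest (Metric.ball x₀ r) ξ →
          |⨍ x in Metric.ball x₀ r, D2 f Q (G x - Q) (grad ξ x)| ≤
            ε * ddphi φ ‖Q‖ * (⨍ x in Metric.ball x₀ (2 * r), ‖G x - Q‖) *
              supGrad (Metric.ball x₀ r) ξ) ∧
        AlmostHarmonic ((ddphi φ ‖Q‖)⁻¹ • D2 f Q) ε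
          (Metric.ball x₀ r) (Metric.ball x₀ (2 * r)) u G := by
  -- The second conclusion loses a factor `2` in `⨍ |∇u - Q| ≤ 2 ⨍ |∇u|`, hence `ε / 2`.
  obtain ⟨δ, hδ0, hδ1, hmain⟩ :=
    exists_abs_average_D2_le n N c₀ c₁ k L β hc₀ hc₁ hk hβ (ε / 2) (half_pos hε)
  refine ⟨δ, hδ0, ?_⟩
  intro φ hφ Ω hΩ f hf u G hmin x₀ r hr hB hexc Q hQG
  have h2r : 0 < 2 * r := by linarith
  obtain ⟨hGint, hφG⟩ := hmin.memSobolevLoc.integrableOn_ball hB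
  have hball : Metric.ball x₀ (2 * r) ⊆ Ω := Metric.ball_subset_closedBall.trans hB
  have hweak := hmin.memSobolevLoc.weakGrad.mono hball
  have hsub : Metric.ball x₀ r ⊆ Metric.ball x₀ (2 * r) := Metric.ball_subset_ball (by linarith)
  have hav : ∀ F : Mat N n → ℝ, (∀ P, 0 ≤ F P) →
      0 ≤ ⨍ x in Metric.ball x₀ (2 * r), F (G x) := by
    intro F hF
    rw [setAverage_eq_mul]
    exact mul_nonneg (by positivity) (integral_nonneg fun x => hF _)
  have hG0 := hav (fun P => ‖P‖) fun P => norm_nonneg P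
  have hGQ0 := hav (fun P => ‖P - Q‖) fun P => norm_nonneg _
  -- At `Q = 0` the expressions for `φ''(0)` and `D²f(0)` may be mere default values. They are
  -- harmless, because the small excess forces `∇u = 0` almost everywhere on the double ball.
  by_cases hQ : Q = 0
  · have hae := ae_restrict_of_ae_restrict_of_subset hsub (ae_eq_zero_of_average_eq_zero hφ hc₀ h2r
      hGint hφG hδ0.le hδ1 hexc (hQG.symm.trans hQ))
    have hzero : ∀ (A : Mat N n →L[ℝ] Mat N n →L[ℝ] ℝ) (ξ : Vec n → Vec N),
        ⨍ x in Metric.ball x₀ r, A (G x) (grad ξ x) = 0 := by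
      intro A ξ
      rw [setAverage_eq_mul, integral_eq_zero_of_ae, mul_zero]
      filter_upwards [hae] with x hx
      simp [hx]
    -- for `Q = 0` the left-hand sides vanish, and so does the mean oscillation
    have hosc : ⨍ x in Metric.ball x₀ (2 * r), ‖G x - Q‖ = 0 := by
      rw [setAverage_eq_mul, integral_eq_zero_of_ae, mul_zero]
      filter_upwards [ae_eq_zero_of_average_eq_zero hφ hc₀ h2r
        hGint hφG hδ0.le hδ1 hexc (hQG.symm.trans hQ)] with x hx
      simp [hx, hQ]
    refine ⟨fun ξ _ => ?_, hweak, fun ξ _ => ?_⟩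
    · rw [hosc]
      subst hQ
      simp only [sub_zero, hzero, abs_zero, mul_zero, zero_mul, le_refl]
    · rw [hzero, abs_zero]
      exact mul_nonneg (mul_nonneg hε.le hG0) (supGrad_nonneg _ _)
  · have hfirst := hmain hφ hΩ hf hmin hr hB hexc hQ hQG
    have hdd := hφ.ddphi_pos hc₁ (norm_pos_iff.2 hQ)
    refine ⟨fun ξ hξ => (hfirst ξ hξ).trans ?_, hweak, fun ξ hξ => ?_⟩
    · have := supGrad_nonneg (Metric.ball x₀ r) ξ
      gcongr
      linarith
    · have := isFiniteMeasure_restrict_ball x₀ r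
      have := isFiniteMeasure_restrict_ball x₀ (2 * r)
      have hξ1 : ContDiff ℝ 1 ξ := hξ.1.of_le (by norm_cast)
      set Φ := ddphi φ ‖Q‖ with hΦ
      set vB := volume.real (Metric.ball x₀ r) with hvB
      have hint : ∀ P : Mat N n, IntegrableOn (fun x => D2 f Q P (grad ξ x))
          (Metric.ball x₀ r) := fun P =>
        integrableOn_ball_of_continuous ((D2 f Q P).continuous.comp (continuous_grad hξ1)) _ _
      -- The constant part `D²f(Q)(Q, ∇ξ)` integrates to zero, so `∇u` may replace `∇u - Q`.
      have hsplit : ∫ x in Metric.ball x₀ r, (Φ⁻¹ • D2 f Q) (G x) (grad ξ x) =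
          Φ⁻¹ * ∫ x in Metric.ball x₀ r, D2 f Q (G x - Q) (grad ξ x) := by
        have hGξ : IntegrableOn (fun x => D2 f Q (G x) (grad ξ x)) (Metric.ball x₀ r) := by
          have hm : AEStronglyMeasurable (fun x => D2 f Q (G x))
              (volume.restrict (Metric.ball x₀ r)) :=
            (D2 f Q).continuous.comp_aestronglyMeasurable
              (hGint.mono_set hsub).aestronglyMeasurable
          refine Integrable.mono' ((hGint.mono_set hsub).norm.const_mul
            (‖D2 f Q‖ * supGrad (Metric.ball x₀ r) ξ))
            ((ContinuousLinearMap.apply ℝ ℝ).aestronglyMeasurable_comp₂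
              (continuous_grad hξ1).aestronglyMeasurable hm) ?_
          filter_upwards [ae_norm_grad_le_supGrad hξ1 hξ.2.1 (Metric.ball x₀ r)] with x hx
          calc ‖D2 f Q (G x) (grad ξ x)‖ ≤ ‖D2 f Q‖ * ‖G x‖ * ‖grad ξ x‖ :=
                (D2 f Q).le_opNorm₂ _ _
            _ ≤ ‖D2 f Q‖ * ‖G x‖ * supGrad (Metric.ball x₀ r) ξ := by gcongr
            _ = _ := by ring
        simp only [map_sub, _root_.sub_apply, _root_.smul_apply, smul_eq_mul]
        rw [integral_const_mul, integral_sub hGξ (hint Q),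
          setIntegral_clm_grad_eq_zero (D2 f Q Q) hξ1 hξ.2.1 hξ.2.2, sub_zero]
      have hosc : ⨍ x in Metric.ball x₀ (2 * r), ‖G x - Q‖ ≤
          2 * ⨍ x in Metric.ball x₀ (2 * r), ‖G x‖ := by
        have hprob := isProbabilityMeasure_average_ball x₀ h2r
        have hG' := integrable_average_ball h2r hGint
        have h1 : ‖Q‖ ≤ ⨍ x in Metric.ball x₀ (2 * r), ‖G x‖ := by
          rw [hQG]; exact norm_integral_le_integral_norm _
        have h2 : ⨍ x in Metric.ball x₀ (2 * r), ‖G x - Q‖ ≤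
            (⨍ x in Metric.ball x₀ (2 * r), ‖G x‖) + ‖Q‖ := by
          have h3 := integral_mono (hG'.sub (integrable_const Q)).norm
            (hG'.norm.add (integrable_const ‖Q‖)) (fun x => norm_sub_le (G x) Q)
          simp only [Pi.add_apply] at h3
          rw [integral_add hG'.norm (integrable_const _), integral_const, probReal_univ,
            one_smul] at h3
          exact h3
        linarith
      have h1 := hfirst ξ hξ
      rw [setAverage_eq_mul, abs_mul] at h1 ⊢
      rw [hsplit, abs_mul, abs_of_pos (inv_pos.2 hdd)]
      have hM0 := supGrad_nonneg (Metric.ball x₀ r) ξ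
      calc _ = Φ⁻¹ * (|vB⁻¹| * |∫ x in Metric.ball x₀ r, D2 f Q (G x - Q) (grad ξ x)|) := by ring
        _ ≤ Φ⁻¹ * (ε / 2 * Φ * (⨍ x in Metric.ball x₀ (2 * r), ‖G x - Q‖) *
            supGrad (Metric.ball x₀ r) ξ) := by gcongr
        _ = ε / 2 * (⨍ x in Metric.ball x₀ (2 * r), ‖G x - Q‖) *
            supGrad (Metric.ball x₀ r) ξ := by field_simp
        _ ≤ ε / 2 * (2 * ⨍ x in Metric.ball x₀ (2 * r), ‖G x‖) *
            supGrad (Metric.ball x₀ r) ξ := by gcongr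
        _ = _ := by ring
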